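/- Let $\Omega=\mathbb{R}\times(0,1)$ and $\langle t\rangle=\max\{1,t\}$. For $m\in\mathbb{N}$, $p\in[1,\infty]$ let $W^{m,p}$ be the space of functions on $\Omega$ with all weak derivatives up to order $m$ in $L^p(\Omega)$, with $\|f\|_{W^{m,p}}=\sum_{|\alpha|=m}\|\partial^\alpha f\|_{L^p}+\|f\|_{L^p}$, and $H^m=W^{m,2}$. Let $\mathfrak{D}^{m,p}$ (respectively $\mathfrak{N}^{m,p}$) be the set of $f\in W^{m,p}$ such that $\partial_2^n f=0$ on $\partial\Omega$, in the sense of traces, for all even (respectively odd) $n$ with $0\le n\le m-1$. For $f\in L^2(\Omega)$ let $(-\Delta)^{-1}f$ be the unique $\psi\in H^2\cap H^1_0$ with $-\Delta\psi=f$ in $\Omega$. For every $\nu>0$ there is a constant $C>0$ depending only on $\nu$ with the following property. Let $\phi_0\in\mathfrak{D}^{8,1}$, let $\mathbf{u}_0=(u_{10},u_{20})$ with $u_{10}\in\mathfrak{N}^{6,1}$ and $u_{20}\in\mathfrak{D}^{6,1}$, and let $w_0=\partial_1u_{20}-\partial_2u_{10}$. Then $w_0\in\mathfrak{D}^{5,1}$,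 and the linearized system $$\partial_t w-\nu\Delta w=\partial_1\phi,\qquad \partial_t\phi+u_2=0,\qquad u_2=-\partial_1(-\Delta)^{-1}w\qquad\text{in }\Omega,\ t>0,$$ $$(w,\phi)|_{t=0}=(w_0,\phi_0)\ \text{in }\Omega,\qquad w=0\ \text{on }\partial\Omega,\ t>0,$$ has a unique strong solution, that is, a unique pair $w,\phi\in C([0,\infty);L^2(\Omega))$, both differentiable in $L^2(\Omega)$ at every $t>0$, with $w(t)\in H^2\cap H^1_0$ for $t>0$, which satisfies the equations with weak spatial derivatives. For every $t>0$ it satisfies $$\|w(t)\|_{L^\infty}\le C\langle t\rangle^{-1}\big(\|w_0\|_{W^{5,1}}+\|\phi_0\|_{W^{8,1}}\big),\qquad \|w(t)\|_{L^2}\le C\langle t\rangle^{-3/4}\big(\|w_0\|_{W^{3,1}}+\|\phi_0\|_{W^{6,1}}\big),$$ $$\|\partial_1w(t)\|_{L^2}\le C\langle t\rangle^{-5/4}\big(\|w_0\|_{W^{5,1}}+\|\phi_0\|_{W^{8,1}}\big),\qquad \|\partial_2w(t)\|_{L^2}\le C\langle t\rangle^{-3/4}\big(\|w_0\|_{W^{4,1}}+\|\phi_0\|_{W^{7,1}}\big),$$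 $$\|\nabla w(t)\|_{H^1}\le C\langle t\rangle^{-3/4}\big(\|w_0\|_{W^{5,1}}+\|\phi_0\|_{W^{8,1}}\big),\qquad \|\partial_tw(t)\|_{H^2}\le C\langle t\rangle^{-5/4}\big(\|w_0\|_{W^{5,1}}+\|\phi_0\|_{W^{8,1}}\big),$$ where $\|\nabla w\|_{H^1}=\|\partial_1w\|_{H^1}+\|\partial_2w\|_{H^1}$. -/

import Mathlib

open MeasureTheory Set Filter
open scoped ENNReal ContDiff

noncomputable section

namespace StripBoussinesq

/-- The infinite strip `Ω = ℝ × (0,1)`. -/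
def strip : Set (ℝ × ℝ) := univ ×ˢ Ioo (0 : ℝ) 1

/-- Lebesgue measure on the strip. -/
abbrev μΩ : Measure (ℝ × ℝ) := volume.restrict strip

/-- The space `L²(Ω)`. -/
abbrev L2Ω : Type := Lp ℝ 2 μΩ

/-- `⟨t⟩ = max {1, t}`. -/
def bracket (t : ℝ) : ℝ := max 1 t

/-- Classical partial derivative in the first variable. -/
def pd₁ (η : ℝ × ℝ → ℝ) : ℝ × ℝ → ℝ := fun z => fderiv ℝ η z (1, 0)

/-- Classical partial derivative in the second variable. -/
def pd₂ (η : ℝ × ℝ → ℝ) : ℝ × ℝ → ℝ := fun z => fderiv ℝ η z (0, 1)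

/-- Smooth functions on the plane with compact support contained in the open strip. -/
def IsTest (η : ℝ × ℝ → ℝ) : Prop :=
  ContDiff ℝ ∞ η ∧ HasCompactSupport η ∧ tsupport η ⊆ strip

/-- `g` is the weak derivative `∂₁^a ∂₂^b f` in the strip. -/
def IsWeakDeriv (a b : ℕ) (f g : ℝ × ℝ → ℝ) : Prop :=
  LocallyIntegrableOn f strip ∧ LocallyIntegrableOn g strip ∧
    ∀ η : ℝ × ℝ → ℝ, IsTest η →
      ∫ z, f z * (pd₁^[a] (pd₂^[b] η)) z ∂μΩ = (-1) ^ (a + b) * ∫ z, g z * η z ∂μΩ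

/-- `f ∈ W^{m,p}(Ω)`: all weak derivatives up to order `m` lie in `L^p(Ω)`. -/
def MemW (m : ℕ) (p : ℝ≥0∞) (f : ℝ × ℝ → ℝ) : Prop :=
  MemLp f p μΩ ∧ ∀ a b : ℕ, a + b ≤ m → ∃ g, IsWeakDeriv a b f g ∧ MemLp g p μΩ

/-- The `L^p(Ω)` norm of the weak derivative `∂₁^a ∂₂^b f`. Weak derivatives are unique up to null
sets, so the infimum runs over equal values; it is `∞` if there is no weak derivative. -/
def derivNorm (a b : ℕ) (p : ℝ≥0∞) (f : ℝ × ℝ → ℝ) : ℝ≥0∞ :=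
  ⨅ (g : ℝ × ℝ → ℝ) (_ : IsWeakDeriv a b f g), eLpNorm g p μΩ

/-- `‖f‖_{W^{m,p}} = ‖f‖_{Ẇ^{m,p}} + ‖f‖_{L^p}`, where the homogeneous seminorm collects the
derivatives of order exactly `m`. -/
def wNorm (m : ℕ) (p : ℝ≥0∞) (f : ℝ × ℝ → ℝ) : ℝ≥0∞ :=
  (∑ α ∈ Finset.HasAntidiagonal.antidiagonal m, derivNorm α.1 α.2 p f) + eLpNorm f p μΩ

/-- `f`, with `f` and `∂₂ f` locally integrable up to the boundary, has trace `h₀` on `y = 0` and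
`h₁` on `y = 1`: the trace is the boundary term in the divergence theorem, tested against smooth
compactly supported functions on the plane, which need not vanish on `∂Ω`. -/
def HasTrace (f : ℝ × ℝ → ℝ) (h₀ h₁ : ℝ → ℝ) : Prop :=
  LocallyIntegrable h₀ ∧ LocallyIntegrable h₁ ∧ LocallyIntegrable f μΩ ∧
    ∃ g, IsWeakDeriv 0 1 f g ∧ LocallyIntegrable g μΩ ∧
      ∀ η : ℝ × ℝ → ℝ, ContDiff ℝ ∞ η → HasCompactSupport η →
        ∫ z, f z * pd₂ η z ∂μΩ + ∫ z, g z * η z ∂μΩ =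
          (∫ x, h₁ x * η (x, 1)) - ∫ x, h₀ x * η (x, 0)

/-- `f = 0` on `∂Ω`. -/
def VanishesOnBoundary (f : ℝ × ℝ → ℝ) : Prop := HasTrace f 0 0

/-- The space `𝔇^{m,p}`: functions in `W^{m,p}` whose `∂₂^n f` vanish on `∂Ω` for all even
`n ≤ m - 1`, that is for `n = 0, 2, …, 2[(m-1)/2]`. -/
def MemD (m : ℕ) (p : ℝ≥0∞) (f : ℝ × ℝ → ℝ) : Prop :=
  MemW m p f ∧ ∀ n < m, Even n → ∃ g, IsWeakDeriv 0 n f g ∧ VanishesOnBoundary g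

/-- The space `𝔑^{m,p}`: functions in `W^{m,p}` whose `∂₂^n f` vanish on `∂Ω` for all odd
`n ≤ m - 1`, that is for `n = 1, 3, …, 2[m/2]-1`. -/
def MemN (m : ℕ) (p : ℝ≥0∞) (f : ℝ × ℝ → ℝ) : Prop :=
  MemW m p f ∧ ∀ n < m, Odd n → ∃ g, IsWeakDeriv 0 n f g ∧ VanishesOnBoundary g

/-- `w = ∂₁ u₂ - ∂₂ u₁` in the weak sense. -/
def IsCurl (u₁ u₂ w : ℝ × ℝ → ℝ) : Prop :=
  ∃ g₁ g₂, IsWeakDeriv 1 0 u₂ g₁ ∧ IsWeakDeriv 0 1 u₁ g₂ ∧ w =ᵐ[μΩ] g₁ - g₂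

/-- `g = Δ f` in the weak sense, with both second derivatives existing separately. -/
def IsLaplacian (f g : ℝ × ℝ → ℝ) : Prop :=
  ∃ g₁ g₂, IsWeakDeriv 2 0 f g₁ ∧ IsWeakDeriv 0 2 f g₂ ∧ g =ᵐ[μΩ] g₁ + g₂

/-- `ψ = (-Δ)⁻¹ f`: the function `ψ ∈ H² ∩ H¹₀` with `-Δ ψ = f`. -/
def IsInvNegLaplacian (f ψ : ℝ × ℝ → ℝ) : Prop :=
  MemW 2 2 ψ ∧ VanishesOnBoundary ψ ∧ IsLaplacian ψ (-f)

/-- `(w, φ)` is a (global, strong) solution of the linearized system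
`∂ₜ w - ν Δ w = ∂₁ φ`, `∂ₜ φ + u₂ = 0`, `u₂ = -∂₁ (-Δ)⁻¹ w` in the strip, with `w = 0` on the
boundary for `t > 0` and initial data `(w₀, φ₀)`. Time derivatives are taken in `L²(Ω)`; only the
values at times `t ≥ 0` matter. -/
structure IsSolution (ν : ℝ) (w₀ φ₀ : ℝ × ℝ → ℝ) (w φ : ℝ → L2Ω) : Prop where
  cont_w : ContinuousOn w (Ici 0)
  cont_φ : ContinuousOn φ (Ici 0)
  init_w : w 0 =ᵐ[μΩ] w₀
  init_φ : φ 0 =ᵐ[μΩ] φ₀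
  reg_w : ∀ t : ℝ, 0 < t → MemW 2 2 (w t)
  boundary_w : ∀ t : ℝ, 0 < t → VanishesOnBoundary (w t)
  eq_w : ∀ t : ℝ, 0 < t → ∃ (wt : L2Ω) (lap φx : ℝ × ℝ → ℝ),
    HasDerivAt w wt t ∧ IsLaplacian (w t) lap ∧ IsWeakDeriv 1 0 (φ t) φx ∧
      ∀ᵐ z ∂μΩ, wt z - ν * lap z = φx z
  eq_φ : ∀ t : ℝ, 0 < t → ∃ (φt : L2Ω) (u₂ ψ ψx : ℝ × ℝ → ℝ),
    HasDerivAt φ φt t ∧ IsInvNegLaplacian (w t) ψ ∧ IsWeakDeriv 1 0 ψ ψx ∧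
      u₂ = -ψx ∧ ∀ᵐ z ∂μΩ, φt z + u₂ z = 0

end StripBoussinesq

end

open StripBoussinesq

noncomputable section

namespace StripBoussinesq

/-! The vorticity vanishes on the boundary, so the system is diagonalised by the Fourier transform
in `x` and the sine series in `y`. Write `p = 2πξ`, `k = (n+1)π` and `λ² = p² + k²` (`waveX`,
`waveY`, `freq`). Once the coefficient of `φ` is multiplied by `i`, each mode solves the real system
`q' = -νλ²q + pφ`, `φ' = -(p/λ²)q`.

The energy `q²/λ² + φ²` dissipates only through `q`. A small multiple of the cross term `qφ` turns
it into a Lyapunov functional that decays at a rate comparable to `p²/λ⁴`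
(`IsModeSolution.lyapunov`). Duhamel's formula then splits `q` into a part that decays like
`exp(-νλ²t)` and a slow part slaved to `φ`, which carries an additional factor `p/λ²`
(`IsModeSolution.bound_fst`). The same argument for `q'` gives the factor `p³/λ⁶`
(`IsModeSolution.bound_deriv_fst`).

The slow rate degenerates as `p → 0` and as `λ → ∞`. The first degeneracy makes the decay algebraic:
integration in `ξ` gains `t^(-1/2)`, and so does every factor `|p|`, at the price of powers of `λ`
(`exists_slow_bound`). With one factor `p` in `w` this gives `t^(-3/4)` in `L²` and `t^(-1)` for the
integral of the coefficients, hence in `L^∞`; a second factor gives `t^(-5/4)`. The second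
degeneracy makes the estimates lose derivatives. The powers of `λ` are paid for by the data: the
even traces required in `𝔇` are exactly those that allow repeated integration by parts against sines
and cosines, so that `λ^m` times a sine coefficient is bounded by the `W^{m,1}` norm
(`MemD.freq_pow_mul_le`).

One term resists this count. In the `H²` norm of `∂ₜw` the fast part contains `λ⁴ŵ₀`, and
boundedness of `λ⁵ŵ₀` just fails to make it square integrable. Here the embedding of `W^{1,1}` into
`L²` is applied to fourth derivatives (`exists_sobolev_strip`, `exists_eLpNorm_freq_pow_four`).

Existence is read off from the series, whose time derivatives are dominated in `L²`
(`hasDerivAt_curve`, `isSolution_series`). Uniqueness holds among all strong solutions: their sine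
coefficients satisfy the mode equations, and the energy of a difference of two solutions cannot grow
(`energy_dissipation`, `isSolution_unique`). Hence every solution is the series, and the estimates
apply to it. -/

theorem isOpen_strip : IsOpen strip := isOpen_univ.prod isOpen_Ioo

theorem measurableSet_strip : MeasurableSet strip := isOpen_strip.measurableSet

/-! ### Classical partial derivatives of test functions -/

theorem contDiff_pd₁ {η : ℝ × ℝ → ℝ} (h : ContDiff ℝ ∞ η) : ContDiff ℝ ∞ (pd₁ η) :=
  (h.fderiv_right (m := ∞) (by simp)).clm_apply contDiff_const

theorem contDiff_pd₂ {η : ℝ × ℝ → ℝ} (h : ContDiff ℝ ∞ η) : ContDiff ℝ ∞ (pd₂ η) :=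
  (h.fderiv_right (m := ∞) (by simp)).clm_apply contDiff_const

theorem tsupport_pd₁ (η : ℝ × ℝ → ℝ) : tsupport (pd₁ η) ⊆ tsupport η :=
  tsupport_fderiv_apply_subset ℝ (1, 0)

theorem tsupport_pd₂ (η : ℝ × ℝ → ℝ) : tsupport (pd₂ η) ⊆ tsupport η :=
  tsupport_fderiv_apply_subset ℝ (0, 1)

theorem hasCompactSupport_pd₁ {η : ℝ × ℝ → ℝ} (h : HasCompactSupport η) :
    HasCompactSupport (pd₁ η) := h.fderiv_apply ℝ (1, 0)

theorem hasCompactSupport_pd₂ {η : ℝ × ℝ → ℝ} (h : HasCompactSupport η) :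
    HasCompactSupport (pd₂ η) := h.fderiv_apply ℝ (0, 1)

theorem IsTest.pd₁ {η : ℝ × ℝ → ℝ} (h : IsTest η) : IsTest (pd₁ η) :=
  ⟨contDiff_pd₁ h.1, hasCompactSupport_pd₁ h.2.1, (tsupport_pd₁ η).trans h.2.2⟩

theorem IsTest.pd₂ {η : ℝ × ℝ → ℝ} (h : IsTest η) : IsTest (pd₂ η) :=
  ⟨contDiff_pd₂ h.1, hasCompactSupport_pd₂ h.2.1, (tsupport_pd₂ η).trans h.2.2⟩

theorem IsTest.iterate {η : ℝ × ℝ → ℝ} (h : IsTest η) (a b : ℕ) :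
    IsTest (StripBoussinesq.pd₁^[a] (StripBoussinesq.pd₂^[b] η)) := by
  have h2 : IsTest (StripBoussinesq.pd₂^[b] η) := by
    induction b with
    | zero => simpa using h
    | succ b ih => rw [Function.iterate_succ_apply']; exact ih.pd₂
  induction a with
  | zero => simpa using h2
  | succ b ih => rw [Function.iterate_succ_apply']; exact ih.pd₁

theorem pd₁_pd₂_comm {η : ℝ × ℝ → ℝ} (h : ContDiff ℝ ∞ η) : pd₁ (pd₂ η) = pd₂ (pd₁ η) := by
  funext z
  have hd : DifferentiableAt ℝ (fderiv ℝ η) z :=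
    ((h.fderiv_right (m := 1) (by norm_cast)).differentiable (by norm_num)) z
  have e1 : pd₁ (pd₂ η) z = fderiv ℝ (fderiv ℝ η) z (1, 0) (0, 1) := by
    have := (hd.hasFDerivAt.clm_apply (hasFDerivAt_const ((0 : ℝ), (1 : ℝ)) z)).fderiv
    change fderiv ℝ (fun y => fderiv ℝ η y (0, 1)) z (1, 0) = _
    rw [this]; simp
  have e2 : pd₂ (pd₁ η) z = fderiv ℝ (fderiv ℝ η) z (0, 1) (1, 0) := by
    have := (hd.hasFDerivAt.clm_apply (hasFDerivAt_const ((1 : ℝ), (0 : ℝ)) z)).fderiv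
    change fderiv ℝ (fun y => fderiv ℝ η y (1, 0)) z (0, 1) = _
    rw [this]; simp
  rw [e1, e2]
  exact ((h.of_le (m := 2) (WithTop.coe_le_coe.2 le_top)).contDiffAt.isSymmSndFDerivAt
    (by simp)) _ _

theorem contDiff_iterate_pd₁ {η : ℝ × ℝ → ℝ} (h : ContDiff ℝ ∞ η) (a : ℕ) :
    ContDiff ℝ ∞ (pd₁^[a] η) := by
  induction a with
  | zero => simpa using h
  | succ b ih => rw [Function.iterate_succ_apply']; exact contDiff_pd₁ ih

theorem pd₂_iterate_pd₁ {η : ℝ × ℝ → ℝ} (h : ContDiff ℝ ∞ η) (a : ℕ) :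
    pd₂ (pd₁^[a] η) = pd₁^[a] (pd₂ η) := by
  induction a with
  | zero => rfl
  | succ a ih =>
    rw [Function.iterate_succ_apply', Function.iterate_succ_apply', ← ih,
      pd₁_pd₂_comm (contDiff_iterate_pd₁ h a)]

theorem iterate_pd₂_iterate_pd₁ {η : ℝ × ℝ → ℝ} (h : ContDiff ℝ ∞ η) (a b : ℕ) :
    pd₂^[b] (pd₁^[a] η) = pd₁^[a] (pd₂^[b] η) := by
  induction b generalizing η with
  | zero => rfl
  | succ b ih =>
    rw [Function.iterate_succ_apply, Function.iterate_succ_apply, pd₂_iterate_pd₁ h,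
      ih (contDiff_pd₂ h)]

theorem iterate_pd_add {η : ℝ × ℝ → ℝ} (hη : IsTest η) (a b c d : ℕ) :
    pd₁^[a] (pd₂^[b] (pd₁^[c] (pd₂^[d] η))) = pd₁^[a + c] (pd₂^[b + d] η) := by
  have : ContDiff ℝ ∞ (pd₂^[d] η) := (hη.iterate 0 d).1
  rw [iterate_pd₂_iterate_pd₁ this, ← Function.iterate_add_apply, ← Function.iterate_add_apply]

/-! ### Weak derivatives -/

theorem locallyIntegrableOn_of_locallyIntegrable {f : ℝ × ℝ → ℝ} (h : LocallyIntegrable f μΩ) :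
    LocallyIntegrableOn f strip := by
  rw [locallyIntegrableOn_iff (isOpen_strip.isLocallyClosed)]
  intro K hK hKc
  have := h.integrableOn_isCompact hKc
  rwa [IntegrableOn, Measure.restrict_restrict hKc.measurableSet, inter_eq_left.2 hK] at this

theorem LocallyIntegrableOn.congr_strip {f f' : ℝ × ℝ → ℝ} (h : LocallyIntegrableOn f strip)
    (hf : f =ᵐ[μΩ] f') : LocallyIntegrableOn f' strip := by
  rw [locallyIntegrableOn_iff (isOpen_strip.isLocallyClosed)] at h ⊢
  intro K hK hKc
  exact (h K hK hKc).congr (ae_mono (Measure.restrict_mono hK le_rfl) hf)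

theorem IsWeakDeriv.congr {a b : ℕ} {f f' g g' : ℝ × ℝ → ℝ} (h : IsWeakDeriv a b f g)
    (hf : f =ᵐ[μΩ] f') (hg : g =ᵐ[μΩ] g') : IsWeakDeriv a b f' g' := by
  refine ⟨LocallyIntegrableOn.congr_strip h.1 hf, LocallyIntegrableOn.congr_strip h.2.1 hg,
    fun η hη => ?_⟩
  have e1 : ∫ z, f' z * (pd₁^[a] (pd₂^[b] η)) z ∂μΩ = ∫ z, f z * (pd₁^[a] (pd₂^[b] η)) z ∂μΩ :=
    integral_congr_ae (by filter_upwards [hf] with z hz; rw [hz])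
  have e2 : ∫ z, g' z * η z ∂μΩ = ∫ z, g z * η z ∂μΩ :=
    integral_congr_ae (by filter_upwards [hg] with z hz; rw [hz])
  rw [e1, e2, h.2.2 η hη]

theorem integrable_mul_test {f η : ℝ × ℝ → ℝ} (hf : LocallyIntegrableOn f strip)
    (hη : IsTest η) : Integrable (fun z => f z * η z) μΩ := by
  have h1 : IntegrableOn f (tsupport η) := by
    rw [locallyIntegrableOn_iff (isOpen_strip.isLocallyClosed)] at hf
    exact hf _ hη.2.2 hη.2.1
  have h2 : IntegrableOn (fun z => f z * η z) (tsupport η) := by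
    have := h1.mul_continuousOn hη.1.continuous.continuousOn hη.2.1
    exact this
  have h3 : Integrable (fun z => f z * η z) := by
    rw [← integrableOn_iff_integrable_of_support_subset (s := tsupport η)]
    · exact h2
    · intro z hz
      apply subset_tsupport η
      intro h0
      exact hz (by simp [h0])
  exact h3.restrict

theorem integrable_mul_compact {f η : ℝ × ℝ → ℝ} (hf : LocallyIntegrable f μΩ)
    (hη : Continuous η) (hc : HasCompactSupport η) : Integrable (fun z => f z * η z) μΩ := by
  have := hf.integrable_smul_left_of_hasCompactSupport hη hc
  refine this.congr (Eventually.of_forall fun z => ?_)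
  simp [mul_comm]

/-- The fundamental lemma of the calculus of variations on the open strip. It lets existentially
given derivatives, in `MemW` or `HasTrace`, be exchanged for any others. -/
theorem IsWeakDeriv.unique {a b : ℕ} {f g g' : ℝ × ℝ → ℝ} (h : IsWeakDeriv a b f g)
    (h' : IsWeakDeriv a b f g') : g =ᵐ[μΩ] g' := by
  have := isOpen_strip.ae_eq_zero_of_integral_contDiff_smul_eq_zero (μ := volume)
    (f := fun z => g z - g' z) (h.2.1.sub h'.2.1) (fun η h1 h2 h3 => by
      have hη : IsTest η := ⟨h1, h2, h3⟩
      have e1 := h.2.2 η hη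
      rw [h'.2.2 η hη] at e1
      have e2 : ∫ z, g' z * η z ∂μΩ = ∫ z, g z * η z ∂μΩ :=
        mul_left_cancel₀ (pow_ne_zero _ (by norm_num)) e1
      have e3 : ∫ z, η z • (g z - g' z) = ∫ z, η z • (g z - g' z) ∂μΩ := by
        rw [setIntegral_eq_integral_of_forall_compl_eq_zero]
        intro z hz
        have : η z = 0 := image_eq_zero_of_notMem_tsupport (fun hh => hz (h3 hh))
        simp [this]
      rw [e3]
      have e4 : ∀ z, η z • (g z - g' z) = g z * η z - g' z * η z := fun z => by
        simp only [smul_eq_mul]; ring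
      simp_rw [e4]
      rw [integral_sub (integrable_mul_test h.2.1 hη) (integrable_mul_test h'.2.1 hη), e2, sub_self])
  rw [Filter.EventuallyEq, ae_restrict_iff' measurableSet_strip]
  filter_upwards [this] with z hz hzs
  linarith [hz hzs]

theorem IsWeakDeriv.trans {a b c d : ℕ} {f g h : ℝ × ℝ → ℝ} (h1 : IsWeakDeriv a b f g)
    (h2 : IsWeakDeriv c d g h) : IsWeakDeriv (a + c) (b + d) f h := by
  refine ⟨h1.1, h2.2.1, fun η hη => ?_⟩
  rw [← iterate_pd_add hη, h1.2.2 _ (hη.iterate c d), h2.2.2 η hη]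
  ring

/-- Test the definition of `g` with a derivative of `η`. This is needed because `MemW` supplies
every derivative of `f` separately, without relating them to one another. -/
theorem IsWeakDeriv.of_add {a b c d : ℕ} {f g h : ℝ × ℝ → ℝ} (h1 : IsWeakDeriv a b f g)
    (h2 : IsWeakDeriv (a + c) (b + d) f h) : IsWeakDeriv c d g h := by
  refine ⟨h1.2.1, h2.2.1, fun η hη => ?_⟩
  have e1 := h1.2.2 _ (hη.iterate c d)
  rw [iterate_pd_add hη, h2.2.2 η hη] at e1
  have e2 : ((-1 : ℝ) ^ (a + c + (b + d))) = (-1) ^ (a + b) * (-1) ^ (c + d) := by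
    rw [← pow_add]; congr 1; ring
  rw [e2, mul_assoc] at e1
  exact (mul_left_cancel₀ (pow_ne_zero _ (by norm_num)) e1).symm

theorem IsWeakDeriv.refl {f : ℝ × ℝ → ℝ} (h : LocallyIntegrableOn f strip) :
    IsWeakDeriv 0 0 f f := ⟨h, h, fun η _ => by simp⟩

theorem IsWeakDeriv.sub {a b : ℕ} {f g f' g' : ℝ × ℝ → ℝ} (h : IsWeakDeriv a b f g)
    (h' : IsWeakDeriv a b f' g') : IsWeakDeriv a b (f - f') (g - g') := by
  refine ⟨h.1.sub h'.1, h.2.1.sub h'.2.1, fun η hη => ?_⟩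
  simp only [Pi.sub_apply, sub_mul]
  rw [integral_sub (integrable_mul_test h.1 (hη.iterate a b))
    (integrable_mul_test h'.1 (hη.iterate a b)),
    integral_sub (integrable_mul_test h.2.1 hη) (integrable_mul_test h'.2.1 hη), h.2.2 η hη,
    h'.2.2 η hη, mul_sub]

theorem MemW.mono {m m' : ℕ} {p : ℝ≥0∞} {f : ℝ × ℝ → ℝ} (h : MemW m p f) (hm : m' ≤ m) :
    MemW m' p f := ⟨h.1, fun a b hab => h.2 a b (hab.trans hm)⟩

theorem MemD.mono {m m' : ℕ} {p : ℝ≥0∞} {f : ℝ × ℝ → ℝ} (h : MemD m p f) (hm : m' ≤ m) :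
    MemD m' p f := ⟨h.1.mono hm, fun n hn => h.2 n (hn.trans_le hm)⟩

theorem MemW.memLp {m a b : ℕ} {p : ℝ≥0∞} {f g : ℝ × ℝ → ℝ} (h : MemW m p f) (hab : a + b ≤ m)
    (hg : IsWeakDeriv a b f g) : MemLp g p μΩ := by
  obtain ⟨g', h1, h2⟩ := h.2 a b hab
  exact (memLp_congr_ae (hg.unique h1)).2 h2

/-- The derivative hidden in `HasTrace` agrees almost everywhere with `g`, by uniqueness. -/
theorem IsWeakDeriv.trace {f g : ℝ × ℝ → ℝ} (hf : VanishesOnBoundary f) (hg : IsWeakDeriv 0 1 f g)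
    {η : ℝ × ℝ → ℝ} (hη : ContDiff ℝ ∞ η) (hc : HasCompactSupport η) :
    ∫ z, f z * pd₂ η z ∂μΩ = - ∫ z, g z * η z ∂μΩ := by
  obtain ⟨-, -, -, g', hg', -, h⟩ := hf
  have := h η hη hc
  have e : ∫ z, g z * η z ∂μΩ = ∫ z, g' z * η z ∂μΩ :=
    integral_congr_ae (by filter_upwards [hg.unique hg'] with z hz; rw [hz])
  simp only [Pi.zero_apply, zero_mul, integral_zero, sub_zero] at this
  rw [e]; linarith

/-- The integration by parts formula against functions free on the boundary contains the one against
`IsTest` functions, so a single identity gives both the derivative and the trace. -/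
theorem vanishesOnBoundary_of {f g : ℝ × ℝ → ℝ} (hf : LocallyIntegrable f μΩ)
    (hg : LocallyIntegrable g μΩ) (h : ∀ η : ℝ × ℝ → ℝ, ContDiff ℝ ∞ η → HasCompactSupport η →
      ∫ z, f z * pd₂ η z ∂μΩ = - ∫ z, g z * η z ∂μΩ) :
    IsWeakDeriv 0 1 f g ∧ VanishesOnBoundary f := by
  have hw : IsWeakDeriv 0 1 f g := ⟨locallyIntegrableOn_of_locallyIntegrable hf,
    locallyIntegrableOn_of_locallyIntegrable hg, fun η hη => by simp [h η hη.1 hη.2.1]⟩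
  refine ⟨hw, ?_, ?_, hf, g, hw, hg, fun η h1 h2 => ?_⟩
  · exact (integrable_zero ℝ ℝ volume).locallyIntegrable
  · exact (integrable_zero ℝ ℝ volume).locallyIntegrable
  · simp [h η h1 h2]

theorem VanishesOnBoundary.congr {f f' : ℝ × ℝ → ℝ} (h : VanishesOnBoundary f)
    (hf : f =ᵐ[μΩ] f') : VanishesOnBoundary f' := by
  obtain ⟨h0, h1, hl, g, hg, hgl, hη⟩ := h
  refine ⟨h0, h1, hl.congr hf, g, hg.congr hf ae_eq_rfl, hgl, fun η h1 h2 => ?_⟩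
  rw [← hη η h1 h2]
  congr 1
  exact integral_congr_ae (by filter_upwards [hf] with z hz; rw [hz])

section

open Topology

/-! ### Cutoff functions -/

/-- A fixed smooth bump on the line, equal to one on `[-1,1]`. -/
def lineBump : ContDiffBump (0 : ℝ) := ⟨1, 2, one_pos, one_lt_two⟩

/-- Cutoff in the unbounded direction. -/
def xCut (n : ℕ) (x : ℝ) : ℝ := lineBump ((n + 1 : ℝ)⁻¹ * x)

theorem contDiff_xCut (n : ℕ) : ContDiff ℝ ∞ (xCut n) :=
  lineBump.contDiff.comp (contDiff_const.mul contDiff_id)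

theorem hasCompactSupport_xCut (n : ℕ) : HasCompactSupport (xCut n) := by
  have : (n + 1 : ℝ)⁻¹ ≠ 0 := by positivity
  exact lineBump.hasCompactSupport.comp_homeomorph (Homeomorph.mulLeft₀ _ this)

theorem abs_xCut_le (n : ℕ) (x : ℝ) : |xCut n x| ≤ 1 := by
  rw [xCut, abs_of_nonneg lineBump.nonneg]; exact lineBump.le_one

theorem tendsto_xCut (x : ℝ) : Tendsto (fun n => xCut n x) atTop (𝓝 1) := by
  have h0 : Tendsto (fun n : ℕ => (n + 1 : ℝ)⁻¹ * x) atTop (𝓝 (0 * x)) := by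
    have := (tendsto_one_div_add_atTop_nhds_zero_nat (𝕜 := ℝ)).mul_const x
    simpa using this
  have h1 : Tendsto (fun n : ℕ => lineBump ((n + 1 : ℝ)⁻¹ * x)) atTop (𝓝 (lineBump (0 * x))) :=
    (lineBump.continuous.tendsto _).comp h0
  have : lineBump (0 * x) = 1 := by
    apply lineBump.one_of_mem_closedBall
    simp [lineBump]
  rwa [this] at h1

theorem exists_deriv_xCut_bound : ∃ K : ℝ, 0 ≤ K ∧ ∀ n x, |deriv (xCut n) x| ≤ K / (n + 1) := by
  have hd : Continuous (deriv lineBump) := (lineBump.contDiff (n := 1)).continuous_deriv le_rfl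
  obtain ⟨K, hK⟩ := (lineBump.hasCompactSupport.deriv).exists_bound_of_continuous hd
  refine ⟨K, (norm_nonneg _).trans (hK 0), fun n x => ?_⟩
  have h : deriv (xCut n) x = (n + 1 : ℝ)⁻¹ * deriv lineBump ((n + 1 : ℝ)⁻¹ * x) := by
    have := deriv_comp_mul_left (n + 1 : ℝ)⁻¹ lineBump x
    simpa only [smul_eq_mul] using! this
  rw [h, abs_mul, abs_of_pos (by positivity), inv_mul_eq_div]
  gcongr
  exact hK _

/-- Cutoff in the bounded direction, supported in `(0,1)`. -/
def yCut (n : ℕ) (y : ℝ) : ℝ :=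
  Real.smoothTransition ((n + 1) * y - 1) * Real.smoothTransition ((n + 1) * (1 - y) - 1)

theorem contDiff_yCut (n : ℕ) : ContDiff ℝ ∞ (yCut n) := by
  unfold yCut
  exact (Real.smoothTransition.contDiff.comp (by fun_prop)).mul
    (Real.smoothTransition.contDiff.comp (by fun_prop))

theorem abs_yCut_le (n : ℕ) (y : ℝ) : |yCut n y| ≤ 1 := by
  rw [yCut, abs_of_nonneg (mul_nonneg (Real.smoothTransition.nonneg _)
    (Real.smoothTransition.nonneg _))]
  exact mul_le_one₀ (Real.smoothTransition.le_one _) (Real.smoothTransition.nonneg _)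
    (Real.smoothTransition.le_one _)

theorem yCut_eq_zero {n : ℕ} {y : ℝ} (h : y ∉ Icc (n + 1 : ℝ)⁻¹ (1 - (n + 1 : ℝ)⁻¹)) :
    yCut n y = 0 := by
  have hn : (0 : ℝ) < n + 1 := by positivity
  rw [mem_Icc, not_and_or, not_le, not_le] at h
  rcases h with h | h
  · rw [yCut, Real.smoothTransition.zero_of_nonpos, zero_mul]
    rw [← one_div, lt_div_iff₀ hn] at h
    linarith
  · rw [yCut, mul_comm, Real.smoothTransition.zero_of_nonpos, zero_mul]
    have : 1 - y < (n + 1 : ℝ)⁻¹ := by linarith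
    rw [← one_div, lt_div_iff₀ hn] at this
    linarith

theorem yCut_eventually_one {y : ℝ} (hy : y ∈ Ioo (0 : ℝ) 1) :
    ∀ᶠ n : ℕ in atTop, ∀ᶠ y' in 𝓝 y, yCut n y' = 1 := by
  have hm : 0 < min y (1 - y) := lt_min hy.1 (by linarith [hy.2])
  obtain ⟨N, hN⟩ := exists_nat_gt (2 / (min y (1 - y) / 2))
  filter_upwards [eventually_ge_atTop N] with n hn
  have hn' : 2 < (n + 1 : ℝ) * (min y (1 - y) / 2) := by
    rw [div_lt_iff₀ (by positivity)] at hN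
    have : (N : ℝ) ≤ n := by exact_mod_cast hn
    nlinarith
  have h1 : ∀ᶠ y' in 𝓝 y, y / 2 < y' := eventually_gt_nhds (by linarith [hy.1])
  have h2 : ∀ᶠ y' in 𝓝 y, y' < (1 + y) / 2 := eventually_lt_nhds (by linarith [hy.2])
  filter_upwards [h1, h2] with y' h1 h2
  have hn0 : (0 : ℝ) < n + 1 := by positivity
  rw [yCut, Real.smoothTransition.one_of_one_le, Real.smoothTransition.one_of_one_le, one_mul]
  · have : min y (1 - y) / 2 ≤ 1 - y' := by linarith [min_le_right y (1 - y)]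
    nlinarith
  · have : min y (1 - y) / 2 ≤ y' := by linarith [min_le_left y (1 - y)]
    nlinarith

theorem tendsto_yCut {y : ℝ} (hy : y ∈ Ioo (0 : ℝ) 1) :
    Tendsto (fun n => yCut n y) atTop (𝓝 1) := by
  refine tendsto_const_nhds.congr' ?_
  filter_upwards [yCut_eventually_one hy] with n hn
  exact hn.self_of_nhds.symm

theorem tendsto_deriv_yCut {y : ℝ} (hy : y ∈ Ioo (0 : ℝ) 1) :
    Tendsto (fun n => deriv (yCut n) y) atTop (𝓝 0) := by
  refine tendsto_const_nhds.congr' ?_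
  filter_upwards [yCut_eventually_one hy] with n hn
  have : yCut n =ᶠ[𝓝 y] fun _ => 1 := hn
  rw [this.deriv_eq]; simp

theorem exists_deriv_smoothTransition_bound :
    ∃ K : ℝ, 0 ≤ K ∧ ∀ x, |deriv Real.smoothTransition x| ≤ K ∧
      (x ∉ Icc (0 : ℝ) 1 → deriv Real.smoothTransition x = 0) := by
  have hd : Continuous (deriv Real.smoothTransition) :=
    (Real.smoothTransition.contDiff (n := 1)).continuous_deriv le_rfl
  obtain ⟨K, hK⟩ := (isCompact_Icc (a := (0 : ℝ)) (b := 1)).exists_bound_of_continuousOn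
    hd.continuousOn
  have h0 : ∀ x, x ∉ Icc (0 : ℝ) 1 → deriv Real.smoothTransition x = 0 := by
    intro x hx
    rw [mem_Icc, not_and_or, not_le, not_le] at hx
    rcases hx with hx | hx
    · have : Real.smoothTransition =ᶠ[𝓝 x] fun _ => 0 := by
        filter_upwards [eventually_lt_nhds hx] with y hy
        exact Real.smoothTransition.zero_of_nonpos hy.le
      rw [this.deriv_eq]; simp
    · have : Real.smoothTransition =ᶠ[𝓝 x] fun _ => 1 := by
        filter_upwards [eventually_gt_nhds hx] with y hy
        exact Real.smoothTransition.one_of_one_le hy.le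
      rw [this.deriv_eq]; simp
  have hK0 : 0 ≤ K := (norm_nonneg _).trans (hK 0 (by simp))
  refine ⟨K, hK0, fun x => ⟨?_, h0 x⟩⟩
  by_cases hx : x ∈ Icc (0 : ℝ) 1
  · exact hK x hx
  · rw [h0 x hx]; simpa using hK0

theorem deriv_yCut (n : ℕ) (y : ℝ) : deriv (yCut n) y =
    (n + 1) * deriv Real.smoothTransition ((n + 1) * y - 1) *
      Real.smoothTransition ((n + 1) * (1 - y) - 1) -
    Real.smoothTransition ((n + 1) * y - 1) *
      ((n + 1) * deriv Real.smoothTransition ((n + 1) * (1 - y) - 1)) := by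
  have hS : ∀ x, HasDerivAt Real.smoothTransition (deriv Real.smoothTransition x) x := fun x =>
    ((Real.smoothTransition.contDiff (n := 1)).differentiable (by simp) x).hasDerivAt
  have h1 : HasDerivAt (fun y : ℝ => (n + 1 : ℝ) * y - 1) (n + 1 : ℝ) y := by
    simpa using ((hasDerivAt_id y).const_mul (n + 1 : ℝ)).sub_const 1
  have h2 : HasDerivAt (fun y : ℝ => (n + 1 : ℝ) * (1 - y) - 1) (-(n + 1 : ℝ)) y := by
    simpa using (((hasDerivAt_id y).const_sub 1).const_mul (n + 1 : ℝ)).sub_const 1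
  have := (((hS _).comp y h1).mul ((hS _).comp y h2)).deriv
  have e : yCut n = (Real.smoothTransition ∘ fun y => (n + 1 : ℝ) * y - 1) *
      (Real.smoothTransition ∘ fun y => (n + 1 : ℝ) * (1 - y) - 1) := by
    funext y; simp [yCut]
  rw [e, this]
  simp only [Function.comp]
  ring

/-- The derivative of the cutoff is of size `n + 1`, but it lives only within `2/(n+1)` of the
boundary, where a function vanishing there linearly is of size `2L/(n+1)`. -/
theorem exists_deriv_yCut_mul_bound {s : ℝ → ℝ} {L : ℝ} (h0 : ∀ y ∈ Icc (0 : ℝ) 1, |s y| ≤ L * y)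
    (h1 : ∀ y ∈ Icc (0 : ℝ) 1, |s y| ≤ L * (1 - y)) :
    ∃ K : ℝ, ∀ n, ∀ y ∈ Icc (0 : ℝ) 1, |deriv (yCut n) y * s y| ≤ K := by
  obtain ⟨K, hK0, hK⟩ := exists_deriv_smoothTransition_bound
  have hL : 0 ≤ L := by
    have := h0 1 (by simp)
    have h2 := abs_nonneg (s 1)
    linarith
  have key : ∀ (n : ℕ) (y r : ℝ), 0 ≤ y → |r| ≤ L * y →
      |(n + 1) * deriv Real.smoothTransition ((n + 1) * y - 1) * r| ≤ 2 * K * L := by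
    intro n y r hy hr
    have hn : (0 : ℝ) < n + 1 := by positivity
    by_cases hx : (n + 1) * y - 1 ∈ Icc (0 : ℝ) 1
    · rw [abs_mul, abs_mul, abs_of_pos hn]
      calc (n + 1 : ℝ) * |deriv Real.smoothTransition ((n + 1) * y - 1)| * |r|
          ≤ (n + 1 : ℝ) * K * (L * y) := by
            gcongr; exact (hK _).1
        _ = K * L * ((n + 1) * y) := by ring
        _ ≤ K * L * 2 := by
            gcongr; linarith [hx.2]
        _ = _ := by ring
    · rw [(hK _).2 hx]; simp; positivity
  have hS : ∀ x, |Real.smoothTransition x| ≤ 1 := fun x => by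
    rw [abs_of_nonneg (Real.smoothTransition.nonneg _)]; exact Real.smoothTransition.le_one _
  refine ⟨4 * K * L, fun n y hy => ?_⟩
  rw [deriv_yCut, sub_mul]
  refine (abs_sub _ _).trans ?_
  have a1 := key n y (s y) hy.1 (h0 y hy)
  have a2 := key n (1 - y) (s y) (by linarith [hy.2]) (h1 y hy)
  have b1 : |(n + 1) * deriv Real.smoothTransition ((n + 1) * y - 1) *
      Real.smoothTransition ((n + 1) * (1 - y) - 1) * s y| ≤ 2 * K * L := by
    rw [mul_right_comm, abs_mul]
    exact (mul_le_of_le_one_right (abs_nonneg _) (hS _)).trans a1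
  have b2 : |Real.smoothTransition ((n + 1) * y - 1) *
      ((n + 1) * deriv Real.smoothTransition ((n + 1) * (1 - y) - 1)) * s y| ≤ 2 * K * L := by
    rw [mul_assoc, abs_mul]
    exact (mul_le_of_le_one_left (abs_nonneg _) (hS _)).trans a2
  linarith

/-! ### Test functions of product form -/

theorem pd₁_prod {h s : ℝ → ℝ} (hh : Differentiable ℝ h) (hs : Differentiable ℝ s) (z : ℝ × ℝ) :
    pd₁ (fun z => h z.1 * s z.2) z = deriv h z.1 * s z.2 := by
  have h1 : HasFDerivAt (fun z : ℝ × ℝ => h z.1) _ z :=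
    (hh z.1).hasDerivAt.hasFDerivAt.comp z hasFDerivAt_fst
  have h2 : HasFDerivAt (fun z : ℝ × ℝ => s z.2) _ z :=
    (hs z.2).hasDerivAt.hasFDerivAt.comp z hasFDerivAt_snd
  have := (h1.mul h2).fderiv
  change fderiv ℝ ((fun z : ℝ × ℝ => h z.1) * fun z => s z.2) z (1, 0) = _
  rw [this]
  simp [mul_comm]

theorem pd₂_prod {h s : ℝ → ℝ} (hh : Differentiable ℝ h) (hs : Differentiable ℝ s) (z : ℝ × ℝ) :
    pd₂ (fun z => h z.1 * s z.2) z = h z.1 * deriv s z.2 := by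
  have h1 : HasFDerivAt (fun z : ℝ × ℝ => h z.1) _ z :=
    (hh z.1).hasDerivAt.hasFDerivAt.comp z hasFDerivAt_fst
  have h2 : HasFDerivAt (fun z : ℝ × ℝ => s z.2) _ z :=
    (hs z.2).hasDerivAt.hasFDerivAt.comp z hasFDerivAt_snd
  have := (h1.mul h2).fderiv
  change fderiv ℝ ((fun z : ℝ × ℝ => h z.1) * fun z => s z.2) z (0, 1) = _
  rw [this]
  simp [mul_comm]

theorem contDiff_prod_mul {h s : ℝ → ℝ} (hh : ContDiff ℝ ∞ h) (hs : ContDiff ℝ ∞ s) :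
    ContDiff ℝ ∞ (fun z : ℝ × ℝ => h z.1 * s z.2) :=
  (hh.comp contDiff_fst).mul (hs.comp contDiff_snd)

theorem isTest_prod {h s : ℝ → ℝ} (hh : ContDiff ℝ ∞ h) (hs : ContDiff ℝ ∞ s)
    (hc : HasCompactSupport h) {a b : ℝ} (ha : 0 < a) (hb : b < 1)
    (h0 : ∀ y, y ∉ Icc a b → s y = 0) : IsTest (fun z => h z.1 * s z.2) := by
  have hsub : tsupport (fun z : ℝ × ℝ => h z.1 * s z.2) ⊆ tsupport h ×ˢ Icc a b := by
    apply closure_minimal _ ((isClosed_tsupport _).prod isClosed_Icc)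
    intro z hz
    refine ⟨subset_tsupport _ fun h1 => hz (by simp [h1]), ?_⟩
    by_contra hcon
    exact hz (by simp [h0 _ hcon])
  refine ⟨contDiff_prod_mul hh hs, ?_, ?_⟩
  · exact IsCompact.of_isClosed_subset (hc.isCompact.prod isCompact_Icc) (isClosed_tsupport _) hsub
  · refine hsub.trans fun z hz => ⟨trivial, ?_⟩
    exact ⟨ha.trans_le hz.2.1, hz.2.2.trans_lt hb⟩

/-- A smooth function of two variables is compactly supported once cut off in both. -/
theorem isTest_cut {E : ℝ × ℝ → ℝ} (hE : ContDiff ℝ ∞ E) (n m : ℕ) :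
    IsTest (fun z => xCut n z.1 * yCut m z.2 * E z) := by
  have h := isTest_prod (contDiff_xCut n) (contDiff_yCut m) (hasCompactSupport_xCut n)
    (a := (m + 1 : ℝ)⁻¹) (b := 1 - (m + 1 : ℝ)⁻¹) (by positivity)
    (by have : (0 : ℝ) < (m + 1 : ℝ)⁻¹ := by positivity
        linarith) (fun y => yCut_eq_zero)
  exact ⟨h.1.mul hE, h.2.1.mul_right, (tsupport_mul_subset_left).trans h.2.2⟩

theorem pd₁_mul {F E : ℝ × ℝ → ℝ} (hF : Differentiable ℝ F) (hE : Differentiable ℝ E) (z : ℝ × ℝ) :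
    pd₁ (fun z => F z * E z) z = pd₁ F z * E z + F z * pd₁ E z := by
  change fderiv ℝ (F * E) z (1, 0) = _
  rw [((hF z).hasFDerivAt.mul (hE z).hasFDerivAt).fderiv]
  simp [pd₁, mul_comm]; ring

theorem pd₂_mul {F E : ℝ × ℝ → ℝ} (hF : Differentiable ℝ F) (hE : Differentiable ℝ E) (z : ℝ × ℝ) :
    pd₂ (fun z => F z * E z) z = pd₂ F z * E z + F z * pd₂ E z := by
  change fderiv ℝ (F * E) z (0, 1) = _
  rw [((hF z).hasFDerivAt.mul (hE z).hasFDerivAt).fderiv]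
  simp [pd₂, mul_comm]; ring

theorem ae_mem_strip : ∀ᵐ z ∂μΩ, z.2 ∈ Ioo (0 : ℝ) 1 := by
  filter_upwards [ae_restrict_mem measurableSet_strip] with z hz
  exact hz.2

/-- Limits of integrals of an integrable function against bounded, pointwise convergent factors. -/
theorem tendsto_integral_mul_of_bounded {f : ℝ × ℝ → ℝ} (hf : Integrable f μΩ)
    {c : ℕ → ℝ × ℝ → ℝ} {l : ℝ} {K : ℝ} (hc : ∀ n, Continuous (c n))
    (hK : ∀ n, ∀ᵐ z ∂μΩ, |c n z| ≤ K) (hl : ∀ᵐ z ∂μΩ, Tendsto (fun n => c n z) atTop (𝓝 l)) :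
    Tendsto (fun n => ∫ z, f z * c n z ∂μΩ) atTop (𝓝 (l * ∫ z, f z ∂μΩ)) := by
  have : l * ∫ z, f z ∂μΩ = ∫ z, f z * l ∂μΩ := by rw [integral_mul_const, mul_comm]
  rw [this]
  refine tendsto_integral_of_dominated_convergence (fun z => |f z| * K) (fun n => ?_) ?_ ?_ ?_
  · exact hf.aestronglyMeasurable.mul (hc n).aestronglyMeasurable
  · exact hf.abs.mul_const K
  · intro n
    filter_upwards [hK n] with z hz
    rw [Real.norm_eq_abs, abs_mul]
    gcongr
  · filter_upwards [hl] with z hz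
    exact hz.const_mul _

theorem continuous_cut (n m : ℕ) : Continuous fun z : ℝ × ℝ => xCut n z.1 * yCut m z.2 :=
  ((contDiff_xCut n).continuous.comp continuous_fst).mul
    ((contDiff_yCut m).continuous.comp continuous_snd)

/-- Integration by parts in `x` against smooth functions that need not vanish on the boundary. -/
theorem IsWeakDeriv.integral_pd₁ {f g E : ℝ × ℝ → ℝ} (h : IsWeakDeriv 1 0 f g)
    (hE : ContDiff ℝ ∞ E) (h1 : Integrable (fun z => f z * E z) μΩ)
    (h2 : Integrable (fun z => f z * pd₁ E z) μΩ) (h3 : Integrable (fun z => g z * E z) μΩ) :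
    ∫ z, f z * pd₁ E z ∂μΩ = - ∫ z, g z * E z ∂μΩ := by
  obtain ⟨K, hK0, hK⟩ := exists_deriv_xCut_bound
  have hdx : ∀ n, Continuous (deriv (xCut n)) := fun n =>
    (contDiff_xCut n).continuous_deriv (by simp)
  have hcut : ∀ n z, |xCut n z| ≤ 1 := abs_xCut_le
  have T2 := tendsto_integral_mul_of_bounded (l := 1) (K := 1) h2
    (c := fun n z => xCut n z.1 * yCut n z.2) (fun n => continuous_cut n n)
    (fun n => Eventually.of_forall fun z => by
      rw [abs_mul]; exact mul_le_one₀ (abs_xCut_le _ _) (abs_nonneg _) (abs_yCut_le _ _))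
    (by filter_upwards [ae_mem_strip] with z hz
        simpa using (tendsto_xCut z.1).mul (tendsto_yCut hz))
  have T3 := tendsto_integral_mul_of_bounded (l := 1) (K := 1) h3
    (c := fun n z => xCut n z.1 * yCut n z.2) (fun n => continuous_cut n n)
    (fun n => Eventually.of_forall fun z => by
      rw [abs_mul]; exact mul_le_one₀ (abs_xCut_le _ _) (abs_nonneg _) (abs_yCut_le _ _))
    (by filter_upwards [ae_mem_strip] with z hz
        simpa using (tendsto_xCut z.1).mul (tendsto_yCut hz))
  have hKn : ∀ (n : ℕ), K / (n + 1) ≤ K := fun n => div_le_self hK0 (by simp)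
  -- Only the horizontal cutoff is differentiated, and its derivative is at most `K/(n+1)`; the
  -- vertical cutoff costs nothing, so `E` need not vanish on the boundary.
  have T1 := tendsto_integral_mul_of_bounded (l := 0) (K := K) h1
    (c := fun n z => deriv (xCut n) z.1 * yCut n z.2)
    (fun n => ((hdx n).comp continuous_fst).mul
      ((contDiff_yCut n).continuous.comp continuous_snd))
    (fun n => Eventually.of_forall fun z => by
      rw [abs_mul]
      exact (mul_le_of_le_one_right (abs_nonneg _) (abs_yCut_le _ _)).trans
        ((hK _ _).trans (hKn n)))
    (Eventually.of_forall fun z => by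
      have ht : Tendsto (fun n : ℕ => K / (n + 1 : ℝ)) atTop (𝓝 0) := by
        have := (tendsto_one_div_add_atTop_nhds_zero_nat (𝕜 := ℝ)).const_mul K
        simpa [div_eq_mul_inv] using this
      refine squeeze_zero_norm (fun n => ?_) ht
      rw [Real.norm_eq_abs, abs_mul]
      exact (mul_le_of_le_one_right (abs_nonneg _) (abs_yCut_le _ _)).trans (hK _ _))
  have hD : ∀ n, ∫ z, f z * E z * (deriv (xCut n) z.1 * yCut n z.2) ∂μΩ +
      ∫ z, f z * pd₁ E z * (xCut n z.1 * yCut n z.2) ∂μΩ =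
      - ∫ z, g z * E z * (xCut n z.1 * yCut n z.2) ∂μΩ := by
    intro n
    have ht := isTest_cut hE n n
    have e := h.2.2 _ ht
    simp only [Function.iterate_one, Function.iterate_zero, id] at e
    have e1 : ∀ z, f z * pd₁ (fun z => xCut n z.1 * yCut n z.2 * E z) z =
        f z * E z * (deriv (xCut n) z.1 * yCut n z.2) +
          f z * pd₁ E z * (xCut n z.1 * yCut n z.2) := by
      intro z
      rw [pd₁_mul ((contDiff_prod_mul (contDiff_xCut n) (contDiff_yCut n)).differentiable
        (by simp)) (hE.differentiable (by simp)), pd₁_prod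
          ((contDiff_xCut n).differentiable (by simp)) ((contDiff_yCut n).differentiable (by simp))]
      ring
    simp_rw [e1] at e
    rw [integral_add] at e
    · rw [e]
      simp only [add_zero, pow_one, neg_mul, one_mul, neg_inj]
      congr 1; funext z; ring
    · refine h1.mul_bdd (c := K) ?_ (Eventually.of_forall fun z => ?_)
      · exact (((hdx n).comp continuous_fst).mul
          ((contDiff_yCut n).continuous.comp continuous_snd)).aestronglyMeasurable
      · rw [Real.norm_eq_abs, abs_mul]
        exact (mul_le_of_le_one_right (abs_nonneg _) (abs_yCut_le _ _)).trans
          ((hK _ _).trans (hKn n))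
    · refine h2.mul_bdd (c := 1) (continuous_cut n n).aestronglyMeasurable
        (Eventually.of_forall fun z => ?_)
      rw [Real.norm_eq_abs, abs_mul]
      exact mul_le_one₀ (abs_xCut_le _ _) (abs_nonneg _) (abs_yCut_le _ _)
  have T := T1.add T2
  simp_rw [hD] at T
  have := tendsto_nhds_unique T T3.neg
  simpa using this

/-- Integration by parts in `y` against products `h(x) s(y)` vanishing on the boundary. -/
theorem IsWeakDeriv.integral_pd₂ {f g : ℝ × ℝ → ℝ} {h s : ℝ → ℝ} (hw : IsWeakDeriv 0 1 f g)
    (hh : ContDiff ℝ ∞ h) (hs : ContDiff ℝ ∞ s) (hs0 : s 0 = 0) (hs1 : s 1 = 0)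
    (h1 : Integrable (fun z => f z * h z.1) μΩ) (h3 : Integrable (fun z => g z * h z.1) μΩ) :
    ∫ z, f z * (h z.1 * deriv s z.2) ∂μΩ = - ∫ z, g z * (h z.1 * s z.2) ∂μΩ := by
  have hds : Continuous (deriv s) := hs.continuous_deriv (by simp)
  have hdy : ∀ n, Continuous (deriv (yCut n)) := fun n =>
    (contDiff_yCut n).continuous_deriv (by simp)
  obtain ⟨L, hL⟩ := (isCompact_Icc (a := (0 : ℝ)) (b := 1)).exists_bound_of_continuousOn
    hds.continuousOn
  have hLip : ∀ a ∈ Icc (0 : ℝ) 1, ∀ b ∈ Icc (0 : ℝ) 1, |s b - s a| ≤ L * |b - a| := by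
    intro a ha b hb
    exact (convex_Icc (0 : ℝ) 1).norm_image_sub_le_of_norm_deriv_le
      (fun x _ => hs.differentiable (by simp) x) hL ha hb
  have hsL0 : ∀ y ∈ Icc (0 : ℝ) 1, |s y| ≤ L * y := fun y hy => by
    have := hLip 0 (by simp) y hy
    rwa [hs0, sub_zero, sub_zero, abs_of_nonneg hy.1] at this
  have hsL1 : ∀ y ∈ Icc (0 : ℝ) 1, |s y| ≤ L * (1 - y) := fun y hy => by
    have := hLip 1 (by simp) y hy
    rwa [hs1, sub_zero, abs_sub_comm, abs_of_nonneg (sub_nonneg.2 hy.2)] at this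
  -- Vanishing of `s` at both ends compensates the blow-up of the differentiated vertical cutoff.
  -- The product stays bounded and tends to zero pointwise, which is enough for dominated
  -- convergence.
  obtain ⟨K, hK⟩ := exists_deriv_yCut_mul_bound hsL0 hsL1
  obtain ⟨M, hM⟩ := (isCompact_Icc (a := (0 : ℝ)) (b := 1)).exists_bound_of_continuousOn
    hs.continuous.continuousOn
  have hfs : Integrable (fun z => f z * h z.1 * deriv s z.2) μΩ :=
    h1.mul_bdd (c := L) (hds.comp continuous_snd).aestronglyMeasurable
      (by filter_upwards [ae_mem_strip] with z hz using hL _ (Ioo_subset_Icc_self hz))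
  have hgs : Integrable (fun z => g z * h z.1 * s z.2) μΩ :=
    h3.mul_bdd (c := M) (hs.continuous.comp continuous_snd).aestronglyMeasurable
      (by filter_upwards [ae_mem_strip] with z hz using hM _ (Ioo_subset_Icc_self hz))
  have cutb : ∀ n, ∀ᵐ z ∂μΩ, |xCut n z.1 * yCut n z.2| ≤ 1 := fun n =>
    Eventually.of_forall fun z => by
      rw [abs_mul]; exact mul_le_one₀ (abs_xCut_le _ _) (abs_nonneg _) (abs_yCut_le _ _)
  have cutl : ∀ᵐ z ∂μΩ, Tendsto (fun n => xCut n z.1 * yCut n z.2) atTop (𝓝 1) := by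
    filter_upwards [ae_mem_strip] with z hz
    simpa using (tendsto_xCut z.1).mul (tendsto_yCut hz)
  have T2 := tendsto_integral_mul_of_bounded hfs (fun n => continuous_cut n n) cutb cutl
  have T3 := tendsto_integral_mul_of_bounded hgs (fun n => continuous_cut n n) cutb cutl
  have c1 : ∀ n, Continuous fun z : ℝ × ℝ => xCut n z.1 * (deriv (yCut n) z.2 * s z.2) := fun n =>
    ((contDiff_xCut n).continuous.comp continuous_fst).mul
      (((hdy n).comp continuous_snd).mul (hs.continuous.comp continuous_snd))
  have b1 : ∀ n, ∀ᵐ z ∂μΩ, |xCut n z.1 * (deriv (yCut n) z.2 * s z.2)| ≤ K := fun n => by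
    filter_upwards [ae_mem_strip] with z hz
    rw [abs_mul]
    exact (mul_le_of_le_one_left (abs_nonneg _) (abs_xCut_le _ _)).trans
      (hK n _ (Ioo_subset_Icc_self hz))
  have T1 := tendsto_integral_mul_of_bounded (l := 0) (K := K) h1 c1 b1
    (by filter_upwards [ae_mem_strip] with z hz
        have := (tendsto_xCut z.1).mul ((tendsto_deriv_yCut hz).mul_const (s z.2))
        simpa using this)
  have hD : ∀ n, ∫ z, f z * h z.1 * (xCut n z.1 * (deriv (yCut n) z.2 * s z.2)) ∂μΩ +
      ∫ z, f z * h z.1 * deriv s z.2 * (xCut n z.1 * yCut n z.2) ∂μΩ =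
      - ∫ z, g z * h z.1 * s z.2 * (xCut n z.1 * yCut n z.2) ∂μΩ := by
    intro n
    have ht := isTest_cut (contDiff_prod_mul hh hs) n n
    have e := hw.2.2 _ ht
    simp only [Function.iterate_one, Function.iterate_zero, id] at e
    have e1 : ∀ z, f z * pd₂ (fun z => xCut n z.1 * yCut n z.2 * (h z.1 * s z.2)) z =
        f z * h z.1 * (xCut n z.1 * (deriv (yCut n) z.2 * s z.2)) +
          f z * h z.1 * deriv s z.2 * (xCut n z.1 * yCut n z.2) := by
      intro z
      rw [pd₂_mul ((contDiff_prod_mul (contDiff_xCut n) (contDiff_yCut n)).differentiable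
        (by simp)) ((contDiff_prod_mul hh hs).differentiable (by simp)), pd₂_prod
          ((contDiff_xCut n).differentiable (by simp)) ((contDiff_yCut n).differentiable (by simp)),
        pd₂_prod (hh.differentiable (by simp)) (hs.differentiable (by simp))]
      ring
    simp_rw [e1] at e
    rw [integral_add] at e
    · rw [e]
      simp only [zero_add, pow_one, neg_mul, one_mul, neg_inj]
      congr 1; funext z; ring
    · exact h1.mul_bdd (c := K) (c1 n).aestronglyMeasurable (b1 n)
    · exact hfs.mul_bdd (c := 1) (continuous_cut n n).aestronglyMeasurable (cutb n)
  have T := T1.add T2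
  simp_rw [hD] at T
  have := tendsto_nhds_unique T T3.neg
  simpa [mul_assoc] using this

/-- Integration by parts in `y` for functions with vanishing trace. -/
theorem IsWeakDeriv.integral_pd₂_of_vanishes {f g : ℝ × ℝ → ℝ} {h s : ℝ → ℝ}
    (hw : IsWeakDeriv 0 1 f g) (hf : VanishesOnBoundary f)
    (hh : ContDiff ℝ ∞ h) (hs : ContDiff ℝ ∞ s)
    (h1 : Integrable (fun z => f z * h z.1) μΩ) (h3 : Integrable (fun z => g z * h z.1) μΩ) :
    ∫ z, f z * (h z.1 * deriv s z.2) ∂μΩ = - ∫ z, g z * (h z.1 * s z.2) ∂μΩ := by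
  have hds : Continuous (deriv s) := hs.continuous_deriv (by simp)
  obtain ⟨L, hL⟩ := (isCompact_Icc (a := (0 : ℝ)) (b := 1)).exists_bound_of_continuousOn
    hds.continuousOn
  obtain ⟨M, hM⟩ := (isCompact_Icc (a := (0 : ℝ)) (b := 1)).exists_bound_of_continuousOn
    hs.continuous.continuousOn
  have hfs : Integrable (fun z => f z * h z.1 * deriv s z.2) μΩ :=
    h1.mul_bdd (c := L) (hds.comp continuous_snd).aestronglyMeasurable
      (by filter_upwards [ae_mem_strip] with z hz using hL _ (Ioo_subset_Icc_self hz))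
  have hgs : Integrable (fun z => g z * h z.1 * s z.2) μΩ :=
    h3.mul_bdd (c := M) (hs.continuous.comp continuous_snd).aestronglyMeasurable
      (by filter_upwards [ae_mem_strip] with z hz using hM _ (Ioo_subset_Icc_self hz))
  -- The trace formula asks for compact support in the plane. A bump equal to one around `[0,1]`
  -- supplies it in `y` without changing anything on the strip.
  obtain ⟨φ, hφ⟩ : ∃ φ : ContDiffBump (0 : ℝ), φ = ⟨2, 3, by norm_num, by norm_num⟩ := ⟨_, rfl⟩
  have hφ1 : ∀ y ∈ Ioo (0 : ℝ) 1, φ =ᶠ[𝓝 y] 1 := fun y hy => by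
    apply φ.eventuallyEq_one_of_mem_ball
    rw [hφ]; simp only [Metric.mem_ball, Real.dist_eq, sub_zero]
    rw [abs_of_pos hy.1]; linarith [hy.2]
  have cutb : ∀ n, ∀ᵐ z ∂μΩ, |xCut n (z : ℝ × ℝ).1| ≤ 1 := fun n =>
    Eventually.of_forall fun z => abs_xCut_le _ _
  have cutl : ∀ᵐ z ∂μΩ, Tendsto (fun n => xCut n (z : ℝ × ℝ).1) atTop (𝓝 1) :=
    Eventually.of_forall fun z => tendsto_xCut z.1
  have cx : ∀ n, Continuous fun z : ℝ × ℝ => xCut n z.1 := fun n =>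
    (contDiff_xCut n).continuous.comp continuous_fst
  have T2 := tendsto_integral_mul_of_bounded hfs cx cutb cutl
  have T3 := tendsto_integral_mul_of_bounded hgs cx cutb cutl
  have hD : ∀ n, ∫ z, f z * h z.1 * deriv s z.2 * xCut n z.1 ∂μΩ =
      - ∫ z, g z * h z.1 * s z.2 * xCut n z.1 ∂μΩ := by
    intro n
    have s1 : ContDiff ℝ ∞ fun x => xCut n x * h x := (contDiff_xCut n).mul hh
    have s2 : ContDiff ℝ ∞ fun y => φ y * s y := φ.contDiff.mul hs
    have hc : HasCompactSupport fun z : ℝ × ℝ => (xCut n z.1 * h z.1) * (φ z.2 * s z.2) := by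
      have hsub : tsupport (fun z : ℝ × ℝ => (xCut n z.1 * h z.1) * (φ z.2 * s z.2)) ⊆
          tsupport (xCut n) ×ˢ tsupport φ := by
        apply closure_minimal _ ((isClosed_tsupport _).prod (isClosed_tsupport _))
        intro z hz
        exact ⟨subset_tsupport _ fun h1 => hz (by simp [h1]),
          subset_tsupport _ fun h1 => hz (by simp [h1])⟩
      exact IsCompact.of_isClosed_subset ((hasCompactSupport_xCut n).isCompact.prod
        φ.hasCompactSupport.isCompact) (isClosed_tsupport _) hsub
    have e := IsWeakDeriv.trace hf hw (contDiff_prod_mul s1 s2) hc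
    have e1 : ∫ z, f z * h z.1 * deriv s z.2 * xCut n z.1 ∂μΩ =
        ∫ z, f z * pd₂ (fun z => (xCut n z.1 * h z.1) * (φ z.2 * s z.2)) z ∂μΩ := by
      apply integral_congr_ae
      filter_upwards [ae_mem_strip] with z hz
      rw [pd₂_prod (s1.differentiable (by simp)) (s2.differentiable (by simp))]
      have : (fun y => φ y * s y) =ᶠ[𝓝 z.2] s := by
        filter_upwards [hφ1 _ hz] with y hy
        rw [hy]; simp
      rw [this.deriv_eq]; ring
    rw [e1, e]
    congr 1
    apply integral_congr_ae
    filter_upwards [ae_mem_strip] with z hz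
    have := (hφ1 _ hz).self_of_nhds
    simp only [Pi.one_apply] at this
    simp only [this]; ring
  simp_rw [hD] at T2
  have := tendsto_nhds_unique T2 T3.neg
  simpa [mul_assoc] using this

end

section

open Topology Convolution

/-! ### Vanishing traces -/

theorem VanishesOnBoundary.sub {f f' : ℝ × ℝ → ℝ} (h : VanishesOnBoundary f)
    (h' : VanishesOnBoundary f') : VanishesOnBoundary (f - f') := by
  obtain ⟨-, -, hl, g, hg, hgl, -⟩ := id h
  obtain ⟨-, -, hl', g', hg', hgl', -⟩ := id h'
  refine (vanishesOnBoundary_of (hl.sub hl') (hgl.sub hgl') fun η h1 h2 => ?_).2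
  have c2 := (contDiff_pd₂ h1).continuous
  have s2 := hasCompactSupport_pd₂ h2
  simp only [Pi.sub_apply, sub_mul]
  rw [integral_sub (integrable_mul_compact hl c2 s2) (integrable_mul_compact hl' c2 s2),
    integral_sub (integrable_mul_compact hgl h1.continuous h2)
      (integrable_mul_compact hgl' h1.continuous h2), IsWeakDeriv.trace h hg h1 h2,
    IsWeakDeriv.trace h' hg' h1 h2]
  ring

/-- Test the trace of `f` with `∂₁η`: integration by parts in `x` is tangential to the boundary and
creates no boundary term. -/
theorem VanishesOnBoundary.deriv_fst {f f₁ g k : ℝ × ℝ → ℝ} (hf : VanishesOnBoundary f)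
    (h1 : IsWeakDeriv 1 0 f f₁) (h2 : IsWeakDeriv 0 1 f g) (h3 : IsWeakDeriv 1 0 g k)
    (l0 : LocallyIntegrable f μΩ) (l1 : LocallyIntegrable f₁ μΩ) (l2 : LocallyIntegrable g μΩ)
    (l3 : LocallyIntegrable k μΩ) : VanishesOnBoundary f₁ := by
  refine (vanishesOnBoundary_of l1 l3 fun η hη hc => ?_).2
  have c1 := contDiff_pd₁ hη
  have c2 := contDiff_pd₂ hη
  have s1 := hasCompactSupport_pd₁ hc
  have s2 := hasCompactSupport_pd₂ hc
  have e1 := h1.integral_pd₁ c2 (integrable_mul_compact l0 c2.continuous s2)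
    (integrable_mul_compact l0 (contDiff_pd₁ c2).continuous (hasCompactSupport_pd₁ s2))
    (integrable_mul_compact l1 c2.continuous s2)
  have e2 := h3.integral_pd₁ hη (integrable_mul_compact l2 hη.continuous hc)
    (integrable_mul_compact l2 c1.continuous s1) (integrable_mul_compact l3 hη.continuous hc)
  have e3 := IsWeakDeriv.trace hf h2 c1 s1
  rw [pd₁_pd₂_comm hη, e3, e2] at e1
  linarith

/-- The vorticity of a velocity field in `𝔑^{m+1,p} × 𝔇^{m+1,p}` belongs to `𝔇^{m,p}`. -/
theorem memD_curl {m : ℕ} {p : ℝ≥0∞} (hp : 1 ≤ p) {u₁ u₂ w : ℝ × ℝ → ℝ} (h₁ : MemN (m + 1) p u₁)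
    (h₂ : MemD (m + 1) p u₂) (hw : IsCurl u₁ u₂ w) : MemD m p w := by
  obtain ⟨g₁, g₂, hg₁, hg₂, hwe⟩ := hw
  have key : ∀ a b : ℕ, a + b ≤ m → ∀ A B, IsWeakDeriv (a + 1) b u₂ A →
      IsWeakDeriv a (b + 1) u₁ B → IsWeakDeriv a b w (A - B) := by
    intro a b hab A B hA hB
    have hA' : IsWeakDeriv a b g₁ A := hg₁.of_add (by rwa [add_comm 1 a, zero_add])
    have hB' : IsWeakDeriv a b g₂ B := hg₂.of_add (by rwa [add_comm 1 b, zero_add])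
    exact (hA'.sub hB').congr hwe.symm ae_eq_rfl
  refine ⟨⟨?_, ?_⟩, ?_⟩
  · exact (memLp_congr_ae hwe).2 ((h₂.1.memLp (by omega) hg₁).sub (h₁.1.memLp (by omega) hg₂))
  · intro a b hab
    obtain ⟨A, hA, hAp⟩ := h₂.1.2 (a + 1) b (by omega)
    obtain ⟨B, hB, hBp⟩ := h₁.1.2 a (b + 1) (by omega)
    exact ⟨A - B, key a b hab A B hA hB, hAp.sub hBp⟩
  · intro n hn he
    obtain ⟨f, hf, hfv⟩ := h₂.2 n (by omega) he
    -- For even `n` the trace of `∂₂^n w` has two pieces: `∂₁∂₂^n u₂`, a tangential derivative of a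
    -- vanishing trace, and `∂₂^{n+1} u₁`, of odd order and so covered by `𝔑`.
    obtain ⟨B, hB, hBv⟩ := h₁.2 (n + 1) (by omega) he.add_one
    obtain ⟨A, hA, hAp⟩ := h₂.1.2 1 n (by omega)
    obtain ⟨g, hg, hgp⟩ := h₂.1.2 0 (n + 1) (by omega)
    obtain ⟨k, hk, hkp⟩ := h₂.1.2 1 (n + 1) (by omega)
    refine ⟨A - B, key 0 n (by omega) A B (by simpa using hA) hB, ?_⟩
    refine VanishesOnBoundary.sub ?_ hBv
    have i1 : IsWeakDeriv 1 0 f A := hf.of_add (by simpa using hA)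
    have i2 : IsWeakDeriv 0 1 f g := hf.of_add (by simpa using hg)
    have i3 : IsWeakDeriv 1 0 g k := hg.of_add (by simpa using hk)
    exact hfv.deriv_fst i1 i2 i3 ((h₂.1.memLp (by omega) hf).locallyIntegrable hp)
      (hAp.locallyIntegrable hp) (hgp.locallyIntegrable hp) (hkp.locallyIntegrable hp)

/-! ### The embedding of `W^{1,1}` into `L²` -/

theorem norm_clm_prod_le (L : ℝ × ℝ →L[ℝ] ℝ) : ‖L‖ ≤ |L (1, 0)| + |L (0, 1)| := by
  refine L.opNorm_le_bound (by positivity) fun v => ?_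
  have : L v = v.1 * L (1, 0) + v.2 * L (0, 1) := by
    have h : v = v.1 • ((1, 0) : ℝ × ℝ) + v.2 • ((0, 1) : ℝ × ℝ) := by ext <;> simp
    conv_lhs => rw [h, map_add, map_smul, map_smul]
    rfl
  rw [this]
  refine (norm_add_le _ _).trans ?_
  rw [norm_mul, norm_mul, add_mul, mul_comm |L (1, 0)|, mul_comm |L (0, 1)|]
  have h1 := norm_fst_le v
  have h2 := norm_snd_le v
  simp only [Real.norm_eq_abs] at *
  gcongr

/-- A shrinking sequence of bump functions. -/
def mollifier (n : ℕ) : ContDiffBump (0 : ℝ × ℝ) :=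
  ⟨(n + 1 : ℝ)⁻¹, 2 * (n + 1 : ℝ)⁻¹, by positivity, by
    have : (0 : ℝ) < (n + 1 : ℝ)⁻¹ := by positivity
    linarith⟩

/-- Mollification of a function on the plane. -/
def mollify (n : ℕ) (F : ℝ × ℝ → ℝ) : ℝ × ℝ → ℝ :=
  (mollifier n).normed volume ⋆[ContinuousLinearMap.lsmul ℝ ℝ, volume] F

theorem mollify_apply (n : ℕ) (F : ℝ × ℝ → ℝ) (x : ℝ × ℝ) :
    mollify n F x = ∫ t, (mollifier n).normed volume (x - t) * F t := by
  rw [mollify, convolution_lsmul_swap]; rfl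

theorem contDiff_mollify (n : ℕ) {F : ℝ × ℝ → ℝ} (hF : Integrable F) :
    ContDiff ℝ 1 (mollify n F) := by
  have := (mollifier n).hasCompactSupport_normed (μ := volume) |>.contDiff_convolution_left
    (n := 1) (ContinuousLinearMap.lsmul ℝ ℝ) (mollifier n).contDiff_normed
    hF.locallyIntegrable
  exact_mod_cast this

theorem fderiv_mollify (n : ℕ) {F : ℝ × ℝ → ℝ} (hF : Integrable F) (x v : ℝ × ℝ) :
    fderiv ℝ (mollify n F) x v =
      ∫ t, fderiv ℝ ((mollifier n).normed volume) (x - t) v * F t := by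
  have hc := (mollifier n).hasCompactSupport_normed (μ := volume)
  have hd : ContDiff ℝ 1 ((mollifier n).normed volume) := by
    exact_mod_cast (mollifier n).contDiff_normed (n := 1)
  have := hc.hasFDerivAt_convolution_left (ContinuousLinearMap.lsmul ℝ ℝ) hd
    hF.locallyIntegrable x
  rw [mollify, this.fderiv, convolution_eq_swap, ContinuousLinearMap.integral_apply]
  · simp
  · have hcf : HasCompactSupport (fderiv ℝ ((mollifier n).normed volume)) := hc.fderiv ℝ
    have := (hcf.convolutionExists_left
      ((ContinuousLinearMap.lsmul ℝ ℝ : ℝ →L[ℝ] ℝ →L[ℝ] ℝ).precompL (ℝ × ℝ))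
      (hd.continuous_fderiv one_ne_zero) hF.locallyIntegrable) x
    exact this.integrable_swap

/-- Young's inequality for a kernel of mass one, by Tonelli and translation invariance. -/
theorem lintegral_enorm_mollify_le (n : ℕ) {F : ℝ × ℝ → ℝ} (hF : Integrable F) :
    ∫⁻ x, ‖mollify n F x‖ₑ ≤ ∫⁻ x, ‖F x‖ₑ := by
  set ρ := (mollifier n).normed volume with hρ
  have hρc : Continuous ρ := (mollifier n).continuous_normed
  have hρi : ∫⁻ x, ‖ρ x‖ₑ = 1 := by
    have h1 : ∫ x, ρ x = 1 := (mollifier n).integral_normed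
    have h2 : Integrable ρ := (mollifier n).integrable_normed
    have h3 := ofReal_integral_norm_eq_lintegral_enorm h2
    rw [← h3]
    have : ∀ x, ‖ρ x‖ = ρ x := fun x => by
      rw [Real.norm_eq_abs, abs_of_nonneg ((mollifier n).nonneg_normed x)]
    simp_rw [this, h1]; simp
  calc ∫⁻ x, ‖mollify n F x‖ₑ ≤ ∫⁻ x, ∫⁻ t, ‖ρ (x - t)‖ₑ * ‖F t‖ₑ := by
        refine lintegral_mono fun x => ?_
        rw [mollify_apply]
        refine (enorm_integral_le_lintegral_enorm _).trans (le_of_eq ?_)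
        simp_rw [enorm_mul]; rfl
    _ = ∫⁻ t, ∫⁻ x, ‖ρ (x - t)‖ₑ * ‖F t‖ₑ := by
        refine lintegral_lintegral_swap ?_
        have a1 : AEMeasurable (fun z : (ℝ × ℝ) × (ℝ × ℝ) => ‖ρ (z.1 - z.2)‖ₑ)
            (volume.prod volume) :=
          (hρc.comp (continuous_fst.sub continuous_snd)).enorm.measurable.aemeasurable
        have a2 : AEMeasurable (fun z : (ℝ × ℝ) × (ℝ × ℝ) => ‖F z.2‖ₑ) (volume.prod volume) :=
          hF.aestronglyMeasurable.enorm.comp_snd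
        exact a1.mul a2
    _ = ∫⁻ t, ‖F t‖ₑ := by
        refine lintegral_congr fun t => ?_
        rw [lintegral_mul_const' _ _ enorm_ne_top,
          lintegral_sub_right_eq_self (fun x => ‖ρ x‖ₑ) t, hρi, one_mul]

/-- Use `t ↦ ρ(x - t)` as test function; the sign from the reflection cancels the sign of the
integration by parts. -/
theorem fderiv_mollify_of_weak (n : ℕ) {F G : ℝ × ℝ → ℝ} (v : ℝ × ℝ) (hF : Integrable F)
    (h : ∀ η : ℝ × ℝ → ℝ, ContDiff ℝ ∞ η → HasCompactSupport η →
      ∫ z, F z * fderiv ℝ η z v = - ∫ z, G z * η z) (x : ℝ × ℝ) :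
    fderiv ℝ (mollify n F) x v = mollify n G x := by
  set ρ := (mollifier n).normed volume with hρ
  have hρs : ContDiff ℝ ∞ ρ := (mollifier n).contDiff_normed
  have hη : ContDiff ℝ ∞ (fun t => ρ (x - t)) := hρs.comp (contDiff_const.sub contDiff_id)
  have hc : HasCompactSupport (fun t => ρ (x - t)) :=
    (mollifier n).hasCompactSupport_normed.comp_homeomorph (Homeomorph.subLeft x)
  have e := h _ hη hc
  have hd : ∀ t, fderiv ℝ (fun t => ρ (x - t)) t v = - fderiv ℝ ρ (x - t) v := by
    intro t
    have h1 : HasFDerivAt (fun t : ℝ × ℝ => x - t) (-(ContinuousLinearMap.id ℝ (ℝ × ℝ))) t := by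
      simpa using (hasFDerivAt_id t).const_sub x
    have h2 := ((hρs.differentiable (by simp) (x - t)).hasFDerivAt.comp t h1).fderiv
    change fderiv ℝ (ρ ∘ fun t => x - t) t v = _
    rw [h2]; simp
  rw [fderiv_mollify n hF, mollify_apply]
  simp_rw [hd] at e
  simp only [mul_neg, integral_neg, neg_inj] at e
  simp_rw [mul_comm (F _)] at e
  rw [e]
  simp_rw [mul_comm (G _)]; rfl

/-- The Gagliardo–Nirenberg–Sobolev inequality with exponent one in dimension two, applied to
cut-off mollifications. Fatou's lemma passes to the limit. -/
theorem exists_sobolev_plane : ∃ C : NNReal, ∀ F G₁ G₂ : ℝ × ℝ → ℝ, Integrable F →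
    Integrable G₁ → Integrable G₂ →
    (∀ η : ℝ × ℝ → ℝ, ContDiff ℝ ∞ η → HasCompactSupport η →
      ∫ z, F z * pd₁ η z = - ∫ z, G₁ z * η z) →
    (∀ η : ℝ × ℝ → ℝ, ContDiff ℝ ∞ η → HasCompactSupport η →
      ∫ z, F z * pd₂ η z = - ∫ z, G₂ z * η z) →
    eLpNorm F 2 volume ≤ C * (eLpNorm G₁ 1 volume + eLpNorm G₂ 1 volume) := by
  refine ⟨eLpNormLESNormFDerivOneConst (volume : Measure (ℝ × ℝ)) 2, ?_⟩
  intro F G₁ G₂ hF hG₁ hG₂ h₁ h₂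
  set C := eLpNormLESNormFDerivOneConst (volume : Measure (ℝ × ℝ)) 2
  obtain ⟨K, hK0, hK⟩ := exists_deriv_xCut_bound
  set v : ℕ → ℝ × ℝ → ℝ := fun n z => (xCut n z.1 * xCut n z.2) * mollify n F z with hv
  have cutd : ∀ n, ContDiff ℝ ∞ fun z : ℝ × ℝ => xCut n z.1 * xCut n z.2 := fun n =>
    contDiff_prod_mul (contDiff_xCut n) (contDiff_xCut n)
  have cutc : ∀ n, HasCompactSupport fun z : ℝ × ℝ => xCut n z.1 * xCut n z.2 := by
    intro n
    have hsub : tsupport (fun z : ℝ × ℝ => xCut n z.1 * xCut n z.2) ⊆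
        tsupport (xCut n) ×ˢ tsupport (xCut n) := by
      apply closure_minimal _ ((isClosed_tsupport _).prod (isClosed_tsupport _))
      intro z hz
      exact ⟨subset_tsupport _ fun h1 => hz (by simp [h1]),
        subset_tsupport _ fun h1 => hz (by simp [h1])⟩
    exact IsCompact.of_isClosed_subset ((hasCompactSupport_xCut n).isCompact.prod
      (hasCompactSupport_xCut n).isCompact) (isClosed_tsupport _) hsub
  have hvd : ∀ n, ContDiff ℝ 1 (v n) := fun n =>
    ((cutd n).of_le (by simp)).mul (contDiff_mollify n hF)
  have hvc : ∀ n, HasCompactSupport (v n) := fun n => (cutc n).mul_right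
  have hlim : ∀ᵐ z : ℝ × ℝ, Tendsto (fun n => v n z) atTop (𝓝 (F z)) := by
    have hr : Tendsto (fun n : ℕ => (mollifier n).rOut) atTop (𝓝 0) := by
      have := (tendsto_one_div_add_atTop_nhds_zero_nat (𝕜 := ℝ)).const_mul 2
      simpa [mollifier] using this
    have := ContDiffBump.ae_convolution_tendsto_right_of_locallyIntegrable (φ := mollifier)
      (l := atTop) (K := 2) (μ := volume) hr (Eventually.of_forall fun n => le_rfl)
      hF.locallyIntegrable
    filter_upwards [this] with z hz
    have := ((tendsto_xCut z.1).mul (tendsto_xCut z.2)).mul hz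
    rw [one_mul, one_mul] at this
    exact this
  -- The last term is the price of the cutoff, one `K/(n+1)` for each partial derivative, and
  -- disappears in the limit.
  have hnorm : ∀ n, eLpNorm (v n) 2 volume ≤ C * (eLpNorm G₁ 1 volume + eLpNorm G₂ 1 volume +
      ENNReal.ofReal (2 * K / (n + 1)) * eLpNorm F 1 volume) := by
    intro n
    -- The Sobolev exponent of `1` is the conjugate of the dimension; in the plane this is `2`.
    have hconj : NNReal.HolderConjugate (Module.finrank ℝ (ℝ × ℝ)) 2 := by
      have : ((Module.finrank ℝ (ℝ × ℝ) : ℕ) : NNReal) = 2 := by simp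
      rw [this]
      exact ⟨by norm_num [← NNReal.coe_inj], by norm_num, by norm_num⟩
    have h0 := eLpNorm_le_eLpNorm_fderiv_one (volume : Measure (ℝ × ℝ)) (hvd n) (hvc n) hconj
    refine h0.trans ?_
    refine mul_le_mul_right ?_ _
    simp_rw [eLpNorm_one_eq_lintegral_enorm]
    have m1 := lintegral_enorm_mollify_le n hG₁
    have m2 := lintegral_enorm_mollify_le n hG₂
    have m0 := lintegral_enorm_mollify_le n hF
    have hpt : ∀ z, ‖fderiv ℝ (v n) z‖ₑ ≤ ‖mollify n G₁ z‖ₑ + ‖mollify n G₂ z‖ₑ +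
        ENNReal.ofReal (2 * K / (n + 1)) * ‖mollify n F z‖ₑ := by
      intro z
      have dm : Differentiable ℝ (mollify n F) := (contDiff_mollify n hF).differentiable (by simp)
      have dc : Differentiable ℝ fun z : ℝ × ℝ => xCut n z.1 * xCut n z.2 :=
        (cutd n).differentiable (by simp)
      have dx : Differentiable ℝ (xCut n) := (contDiff_xCut n).differentiable (by simp)
      have e1 : fderiv ℝ (v n) z (1, 0) = deriv (xCut n) z.1 * xCut n z.2 * mollify n F z +
          xCut n z.1 * xCut n z.2 * mollify n G₁ z := by
        have := pd₁_mul dc dm z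
        rw [pd₁_prod dx dx] at this
        rw [← fderiv_mollify_of_weak n (1, 0) hF h₁ z]
        exact this
      have e2 : fderiv ℝ (v n) z (0, 1) = xCut n z.1 * deriv (xCut n) z.2 * mollify n F z +
          xCut n z.1 * xCut n z.2 * mollify n G₂ z := by
        have := pd₂_mul dc dm z
        rw [pd₂_prod dx dx] at this
        rw [← fderiv_mollify_of_weak n (0, 1) hF h₂ z]
        exact this
      have c := abs_xCut_le n
      have b : ∀ (a b m g : ℝ), |a| ≤ K / (n + 1) → |b| ≤ 1 →
          |a * m + b * g| ≤ K / (n + 1) * |m| + |g| := by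
        intro a b m g ha hb
        refine (abs_add_le _ _).trans ?_
        rw [abs_mul, abs_mul]
        gcongr
        exact mul_le_of_le_one_left (abs_nonneg _) hb
      have hcc : |xCut n z.1 * xCut n z.2| ≤ 1 := by
        rw [abs_mul]; exact mul_le_one₀ (c _) (abs_nonneg _) (c _)
      have b1 := b (deriv (xCut n) z.1 * xCut n z.2) _ (mollify n F z) (mollify n G₁ z) (by
        rw [abs_mul]
        exact (mul_le_of_le_one_right (abs_nonneg _) (c _)).trans (hK _ _)) hcc
      have b2 := b (xCut n z.1 * deriv (xCut n) z.2) _ (mollify n F z) (mollify n G₂ z) (by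
        rw [abs_mul]
        exact (mul_le_of_le_one_left (abs_nonneg _) (c _)).trans (hK _ _)) hcc
      have hle : ‖fderiv ℝ (v n) z‖ ≤ |mollify n G₁ z| + |mollify n G₂ z| +
          2 * K / (n + 1) * |mollify n F z| := by
        refine (norm_clm_prod_le _).trans ?_
        rw [e1, e2]
        have : 2 * K / (n + 1) * |mollify n F z| = K / (n + 1) * |mollify n F z| +
          K / (n + 1) * |mollify n F z| := by ring
        linarith
      have := ENNReal.ofReal_le_ofReal hle
      rw [ofReal_norm] at this
      refine this.trans (le_of_eq ?_)
      rw [ENNReal.ofReal_add (by positivity) (by positivity),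
        ENNReal.ofReal_add (by positivity) (by positivity), ENNReal.ofReal_mul (by positivity)]
      simp only [← Real.norm_eq_abs, ofReal_norm]
    have cm : ∀ G : ℝ × ℝ → ℝ, Integrable G → Measurable fun z => ‖mollify n G z‖ₑ := fun G hG =>
      (contDiff_mollify n hG).continuous.enorm.measurable
    calc ∫⁻ z, ‖fderiv ℝ (v n) z‖ₑ ≤ ∫⁻ z, (‖mollify n G₁ z‖ₑ + ‖mollify n G₂ z‖ₑ +
        ENNReal.ofReal (2 * K / (n + 1)) * ‖mollify n F z‖ₑ) := lintegral_mono hpt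
      _ = (∫⁻ z, ‖mollify n G₁ z‖ₑ) + (∫⁻ z, ‖mollify n G₂ z‖ₑ) +
        ENNReal.ofReal (2 * K / (n + 1)) * ∫⁻ z, ‖mollify n F z‖ₑ := by
          rw [lintegral_add_right _ ((cm _ hF).const_mul _), lintegral_add_left (cm _ hG₁),
            lintegral_const_mul _ (cm _ hF)]
      _ ≤ _ := by gcongr
  have hF1 : eLpNorm F 1 volume ≠ ⊤ := (memLp_one_iff_integrable.2 hF).2.ne
  have hT : Tendsto (fun n : ℕ => C * (eLpNorm G₁ 1 volume + eLpNorm G₂ 1 volume +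
      ENNReal.ofReal (2 * K / (n + 1)) * eLpNorm F 1 volume)) atTop
      (𝓝 (C * (eLpNorm G₁ 1 volume + eLpNorm G₂ 1 volume +
        ENNReal.ofReal 0 * eLpNorm F 1 volume))) := by
    refine ENNReal.Tendsto.const_mul (Tendsto.const_add _ ?_) (Or.inr ENNReal.coe_ne_top)
    refine ENNReal.Tendsto.mul_const (ENNReal.tendsto_ofReal ?_) (Or.inr hF1)
    have := (tendsto_one_div_add_atTop_nhds_zero_nat (𝕜 := ℝ)).const_mul (2 * K)
    simpa [div_eq_mul_inv] using this
  have := Lp.eLpNorm_lim_le_liminf_eLpNorm (p := 2)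
    (fun n => (hvd n).continuous.aestronglyMeasurable) F hlim
  refine this.trans ?_
  have h3 := liminf_le_liminf (f := atTop) (Eventually.of_forall hnorm)
  refine h3.trans ?_
  rw [hT.liminf_eq]
  simp

/-- Functions in `W^{1,1}` of the strip that vanish on the boundary are square integrable. -/
theorem exists_sobolev_strip : ∃ C : NNReal, ∀ f g₁ g₂ : ℝ × ℝ → ℝ, MemLp f 1 μΩ →
    MemLp g₁ 1 μΩ → MemLp g₂ 1 μΩ → IsWeakDeriv 1 0 f g₁ → IsWeakDeriv 0 1 f g₂ →
    VanishesOnBoundary f →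
    eLpNorm f 2 μΩ ≤ C * (eLpNorm g₁ 1 μΩ + eLpNorm g₂ 1 μΩ) := by
  obtain ⟨C, hC⟩ := exists_sobolev_plane
  refine ⟨C, fun f g₁ g₂ hf hg₁ hg₂ h₁ h₂ hv => ?_⟩
  have ind : ∀ k : ℝ × ℝ → ℝ, MemLp k 1 μΩ → Integrable (strip.indicator k) := fun k hk =>
    (integrable_indicator_iff measurableSet_strip).2 (memLp_one_iff_integrable.1 hk)
  have ii : ∀ k η : ℝ × ℝ → ℝ, ∫ z, strip.indicator k z * η z = ∫ z, k z * η z ∂μΩ := by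
    intro k η
    rw [← integral_indicator measurableSet_strip]
    congr 1; funext z
    by_cases hz : z ∈ strip <;> simp [hz]
  have l1 := hf.locallyIntegrable le_rfl
  have l2 := hg₁.locallyIntegrable le_rfl
  -- Zero trace means that the extension by zero has no jump across `∂Ω`, so its weak gradient is
  -- the extension of the gradient by zero.
  have := hC (strip.indicator f) (strip.indicator g₁) (strip.indicator g₂) (ind _ hf) (ind _ hg₁)
    (ind _ hg₂) (fun η hη hc => by
      rw [ii, ii]
      exact h₁.integral_pd₁ hη (integrable_mul_compact l1 hη.continuous hc)
        (integrable_mul_compact l1 (contDiff_pd₁ hη).continuous (hasCompactSupport_pd₁ hc))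
        (integrable_mul_compact l2 hη.continuous hc))
    (fun η hη hc => by
      rw [ii, ii]
      exact IsWeakDeriv.trace hv h₂ hη hc)
  simpa only [eLpNorm_indicator_eq_eLpNorm_restrict measurableSet_strip] using this

end

/-! ### Sine and cosine series on the unit interval -/

section

open Topology Complex

/-- The vertical wave number `(n+1)π`. -/
def waveY (n : ℕ) : ℝ := (n + 1) * Real.pi

/-- The normalized vertical profiles: `√2 sin((n+1)πy)` for `false`, `√2 cos((n+1)πy)` for
`true`. -/
def profile (c : Bool) (n : ℕ) (y : ℝ) : ℝ :=
  if c then √2 * Real.cos (waveY n * y) else √2 * Real.sin (waveY n * y)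

theorem contDiff_profile (c : Bool) (n : ℕ) : ContDiff ℝ ∞ (profile c n) := by
  unfold profile
  cases c
  · simpa using contDiff_const.mul (Real.contDiff_sin.comp (contDiff_const.mul contDiff_id))
  · simpa using contDiff_const.mul (Real.contDiff_cos.comp (contDiff_const.mul contDiff_id))

theorem abs_profile_le (c : Bool) (n : ℕ) (y : ℝ) : |profile c n y| ≤ √2 := by
  have h : (0 : ℝ) ≤ √2 := Real.sqrt_nonneg 2
  cases c
  · simp only [profile, Bool.false_eq_true, if_false, abs_mul, abs_of_nonneg h]
    exact mul_le_of_le_one_right h (Real.abs_sin_le_one _)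
  · simp only [profile, if_true, abs_mul, abs_of_nonneg h]
    exact mul_le_of_le_one_right h (Real.abs_cos_le_one _)

/-- Extension of a function on `(0,1)` to `(-1,1)` with parity `ε`. -/
def parityExt (ε : ℂ) (f : ℝ → ℂ) (y : ℝ) : ℂ := if 0 < y then f y else ε * f (-y)

theorem restrict_Ioc_eq_Ioo (a b : ℝ) :
    (volume : Measure ℝ).restrict (Ioc a b) = volume.restrict (Ioo a b) :=
  Measure.restrict_congr_set Ioo_ae_eq_Ioc.symm

theorem measurePreserving_neg_Ioo :
    MeasurePreserving (fun y : ℝ => -y) (volume.restrict (Ioo (-1) 0))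
      (volume.restrict (Ioo 0 1)) := by
  have := (Measure.measurePreserving_neg (volume : Measure ℝ)).restrict_preimage
    (measurableSet_Ioo (a := (0 : ℝ)) (b := 1))
  have e : (Neg.neg ⁻¹' Ioo (0 : ℝ) 1) = Ioo (-1) 0 := by simp
  rwa [e] at this

theorem memLp_parityExt {ε : ℂ} {f : ℝ → ℂ} (hf : MemLp f 2 (volume.restrict (Ioo 0 1))) :
    MemLp (parityExt ε f) 2 (volume.restrict (Ioc (-1) 1)) := by
  have hu : Ioc (-1 : ℝ) 1 = Ioc (-1) 0 ∪ Ioc 0 1 := (Ioc_union_Ioc_eq_Ioc (by norm_num)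
    (by norm_num)).symm
  have h1 : MemLp (parityExt ε f) 2 (volume.restrict (Ioc 0 1)) := by
    rw [restrict_Ioc_eq_Ioo]
    refine (memLp_congr_ae ?_).2 hf
    filter_upwards [ae_restrict_mem measurableSet_Ioo] with y hy
    simp [parityExt, hy.1]
  have h2 : MemLp (parityExt ε f) 2 (volume.restrict (Ioc (-1) 0)) := by
    rw [restrict_Ioc_eq_Ioo]
    refine (memLp_congr_ae ?_).2
      ((hf.comp_measurePreserving measurePreserving_neg_Ioo).const_mul ε)
    filter_upwards [ae_restrict_mem measurableSet_Ioo] with y hy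
    simp [parityExt, not_lt.2 hy.2.le]
  rw [hu]
  have hm := aestronglyMeasurable_union_iff.2 ⟨h2.1, h1.1⟩
  rw [memLp_two_iff_integrable_sq_norm hm]
  exact IntegrableOn.union ((memLp_two_iff_integrable_sq_norm h2.1).1 h2)
    ((memLp_two_iff_integrable_sq_norm h1.1).1 h1)

theorem integral_symm_split {E : Type*} [NormedAddCommGroup E] [NormedSpace ℝ E] {g : ℝ → E}
    (hg : IntervalIntegrable g volume (-1) 1) :
    ∫ y in (-1)..1, g y = (∫ y in Ioo (0 : ℝ) 1, g y) + ∫ y in Ioo (0 : ℝ) 1, g (-y) := by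
  have i1 : IntervalIntegrable g volume (-1) 0 := hg.mono_set (by
    rw [uIcc_of_le (by norm_num), uIcc_of_le (by norm_num)]; exact Icc_subset_Icc_right (by norm_num))
  have i2 : IntervalIntegrable g volume 0 1 := hg.mono_set (by
    rw [uIcc_of_le (by norm_num), uIcc_of_le (by norm_num)]; exact Icc_subset_Icc_left (by norm_num))
  rw [← intervalIntegral.integral_add_adjacent_intervals i1 i2, add_comm]
  congr 1
  · rw [intervalIntegral.integral_of_le (by norm_num), restrict_Ioc_eq_Ioo]
  · have := intervalIntegral.integral_comp_neg (a := 0) (b := 1) g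
    rw [neg_zero] at this
    rw [← this, intervalIntegral.integral_of_le (by norm_num), restrict_Ioc_eq_Ioo]

/-- Folding `(-1,0)` onto `(0,1)` turns the exponential into `e^{-iθ} + ε e^{iθ}`. The value `ε =
-1` produces sines and `ε = 1` cosines, so both expansions come from one Fourier series of period
two. -/
theorem fourierCoeffOn_parityExt {ε : ℂ} {f : ℝ → ℂ}
    (hf : MemLp f 2 (volume.restrict (Ioo 0 1))) (n : ℤ) :
    fourierCoeffOn (show (-1 : ℝ) < 1 by norm_num) (parityExt ε f) n =
      (1 / 2) * ∫ y in Ioo (0 : ℝ) 1, (cexp (-(n * Real.pi * y * I)) +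
        ε * cexp (n * Real.pi * y * I)) * f y := by
  have hi : IntervalIntegrable (parityExt ε f) volume (-1) 1 := by
    rw [intervalIntegrable_iff, uIoc_of_le (by norm_num)]
    have := (memLp_parityExt (ε := ε) hf).integrable (by norm_num)
    exact this
  have hfour : ∀ y : ℝ, fourier (-n) (y : AddCircle (1 - (-1) : ℝ)) =
      cexp (-(n * Real.pi * y * I)) := by
    intro y
    rw [fourier_coe_apply]
    congr 1
    push_cast
    ring
  rw [fourierCoeffOn_eq_integral]
  simp only [hfour, smul_eq_mul]
  have hcont : Continuous fun y : ℝ => cexp (-(n * Real.pi * y * I)) := by fun_prop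
  rw [integral_symm_split (hi.continuousOn_mul hcont.continuousOn)]
  have hfi : IntegrableOn f (Ioo 0 1) := hf.integrable (by norm_num)
  have hb : ∀ r : ℝ → ℂ, Continuous r → IntegrableOn (fun y => r y * f y) (Ioo 0 1) := by
    intro r hr
    obtain ⟨K, hK⟩ := (isCompact_Icc (a := (0 : ℝ)) (b := 1)).exists_bound_of_continuousOn
      hr.continuousOn
    exact hfi.bdd_mul (c := K) hr.aestronglyMeasurable
      ((ae_restrict_mem measurableSet_Ioo).mono fun y hy => hK y (Ioo_subset_Icc_self hy))
  have e1 : ∫ y in Ioo (0 : ℝ) 1, cexp (-(n * Real.pi * y * I)) * parityExt ε f y =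
      ∫ y in Ioo (0 : ℝ) 1, cexp (-(n * Real.pi * y * I)) * f y :=
    setIntegral_congr_fun measurableSet_Ioo fun y hy => by simp [parityExt, hy.1]
  have e2 : ∫ y in Ioo (0 : ℝ) 1, cexp (-(n * Real.pi * (-y : ℝ) * I)) * parityExt ε f (-y) =
      ∫ y in Ioo (0 : ℝ) 1, (ε * cexp (n * Real.pi * y * I)) * f y :=
    setIntegral_congr_fun measurableSet_Ioo fun y hy => by
      have : ¬ (y < 0) := not_lt.2 hy.1.le
      simp only [parityExt, Left.neg_pos_iff, this, if_false, neg_neg]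
      push_cast
      ring_nf
  rw [e1, e2, ← integral_add (hb _ hcont) (hb _ (by fun_prop))]
  simp_rw [← add_mul]
  rw [Complex.real_smul]
  norm_num

theorem integral_norm_parityExt {ε : ℂ} (hε : ‖ε‖ = 1) {f : ℝ → ℂ}
    (hf : MemLp f 2 (volume.restrict (Ioo 0 1))) :
    ∫ y in (-1)..1, ‖parityExt ε f y‖ ^ 2 = 2 * ∫ y in Ioo (0 : ℝ) 1, ‖f y‖ ^ 2 := by
  have hi : IntervalIntegrable (fun y => ‖parityExt ε f y‖ ^ 2) volume (-1) 1 := by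
    rw [intervalIntegrable_iff, uIoc_of_le (by norm_num)]
    exact (memLp_parityExt (ε := ε) hf).integrable_norm_pow (by norm_num)
  rw [integral_symm_split hi, two_mul]
  congr 1
  · exact setIntegral_congr_fun measurableSet_Ioo fun y hy => by simp [parityExt, hy.1]
  · refine setIntegral_congr_fun measurableSet_Ioo fun y hy => ?_
    have : ¬ (y < 0) := not_lt.2 hy.1.le
    simp [parityExt, this, hε]

/-- Pairing `n` with `-n` leaves the positive indices, numbered from zero in agreement with `waveY`,
and the zeroth term, which has to be removed separately. -/
theorem hasSum_of_even {a : ℤ → ℝ} {m : ℝ} (h : HasSum a m) (he : ∀ n, a (-n) = a n) :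
    HasSum (fun n : ℕ => 2 * a (n + 1)) (m - a 0) := by
  have h1 := h.nat_add_neg
  have h2 := (hasSum_nat_add_iff' 1).2 h1
  simp only [he, Finset.range_one, Finset.sum_singleton, Nat.cast_zero, Nat.cast_add,
    Nat.cast_one] at h2
  have e : m + a 0 - (a 0 + a 0) = m - a 0 := by ring
  rw [e] at h2
  simpa only [two_mul] using h2

/-- Parseval's identity for sine series. -/
theorem hasSum_sine {f : ℝ → ℂ} (hf : MemLp f 2 (volume.restrict (Ioo 0 1))) :
    HasSum (fun n : ℕ => ‖∫ y in Ioo (0 : ℝ) 1, f y * profile false n y‖ ^ 2)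
      (∫ y in Ioo (0 : ℝ) 1, ‖f y‖ ^ 2) := by
  have hc : ∀ n : ℤ, fourierCoeffOn (show (-1 : ℝ) < 1 by norm_num) (parityExt (-1) f) n =
      -I * ∫ y in Ioo (0 : ℝ) 1, f y * Real.sin (n * Real.pi * y) := by
    intro n
    rw [fourierCoeffOn_parityExt hf, ← integral_const_mul, ← integral_const_mul]
    congr 1; funext y
    rw [Complex.ofReal_sin, Complex.sin]
    push_cast
    have : (I : ℂ) * I = -1 := I_mul_I
    rw [neg_mul (↑n * ↑Real.pi * ↑y : ℂ) I]
    linear_combination (f y * (cexp (-(n * Real.pi * y * I)) - cexp (n * Real.pi * y * I)) / 2)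
      * this
  have h := hasSum_sq_fourierCoeffOn (show (-1 : ℝ) < 1 by norm_num)
    (memLp_parityExt (ε := -1) hf)
  rw [integral_norm_parityExt (by simp) hf] at h
  have h2 := hasSum_of_even h (fun n => by
    rw [hc, hc, norm_mul, norm_mul]
    congr 2
    rw [← norm_neg, ← integral_neg]
    congr 2; funext y
    push_cast
    rw [show (-(n : ℂ)) * Real.pi * y = -(n * Real.pi * y) by ring, Complex.sin_neg]; ring)
  convert h2 using 1
  · funext n
    rw [hc, norm_mul, norm_neg, norm_I, one_mul]
    have : ∫ y in Ioo (0 : ℝ) 1, f y * profile false n y =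
        (√2 : ℝ) * ∫ y in Ioo (0 : ℝ) 1, f y * Real.sin (((n + 1 : ℤ) : ℝ) * Real.pi * y) := by
      rw [← integral_const_mul]
      congr 1; funext y
      simp only [profile, waveY, Bool.false_eq_true, if_false]
      push_cast
      ring
    rw [this, norm_mul, mul_pow, Complex.norm_real, Real.norm_eq_abs, sq_abs, Real.sq_sqrt (by norm_num)]
  · rw [hc]; simp; ring

/-- Bessel's inequality for cosine series. -/
theorem hasSum_cosine {f : ℝ → ℂ} (hf : MemLp f 2 (volume.restrict (Ioo 0 1))) :
    HasSum (fun n : ℕ => ‖∫ y in Ioo (0 : ℝ) 1, f y * profile true n y‖ ^ 2)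
      ((∫ y in Ioo (0 : ℝ) 1, ‖f y‖ ^ 2) - ‖∫ y in Ioo (0 : ℝ) 1, f y‖ ^ 2) := by
  have hc : ∀ n : ℤ, fourierCoeffOn (show (-1 : ℝ) < 1 by norm_num) (parityExt 1 f) n =
      ∫ y in Ioo (0 : ℝ) 1, f y * Real.cos (n * Real.pi * y) := by
    intro n
    rw [fourierCoeffOn_parityExt hf, ← integral_const_mul]
    congr 1; funext y
    rw [Complex.ofReal_cos, Complex.cos]
    push_cast
    ring_nf
  have h := hasSum_sq_fourierCoeffOn (show (-1 : ℝ) < 1 by norm_num)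
    (memLp_parityExt (ε := 1) hf)
  rw [integral_norm_parityExt (by simp) hf] at h
  have h2 := hasSum_of_even h (fun n => by
    rw [hc, hc]
    congr 3; funext y
    push_cast
    rw [show (-(n : ℂ)) * Real.pi * y = -(n * Real.pi * y) by ring, Complex.cos_neg])
  convert h2 using 1
  · funext n
    rw [hc]
    have : ∫ y in Ioo (0 : ℝ) 1, f y * profile true n y =
        (√2 : ℝ) * ∫ y in Ioo (0 : ℝ) 1, f y * Real.cos (((n + 1 : ℤ) : ℝ) * Real.pi * y) := by
      rw [← integral_const_mul]
      congr 1; funext y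
      simp only [profile, waveY, if_true]
      push_cast
      ring
    rw [this, norm_mul, mul_pow, Complex.norm_real, Real.norm_eq_abs, sq_abs, Real.sq_sqrt (by norm_num)]
  · rw [hc]; simp; ring

theorem enorm_sq_eq_ofReal (z : ℂ) : ‖z‖ₑ ^ 2 = ENNReal.ofReal (‖z‖ ^ 2) := by
  rw [ENNReal.ofReal_pow (norm_nonneg _), ofReal_norm]

theorem ofReal_integral_sq {α : Type*} [MeasurableSpace α] {μ : Measure α} {f : α → ℂ}
    (hf : MemLp f 2 μ) :
    ENNReal.ofReal (∫ y, ‖f y‖ ^ 2 ∂μ) = ∫⁻ y, ‖f y‖ₑ ^ 2 ∂μ := by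
  rw [ofReal_integral_eq_lintegral_ofReal (hf.integrable_norm_pow (by norm_num))
    (Eventually.of_forall fun y => by positivity)]
  simp_rw [enorm_sq_eq_ofReal]

theorem tsum_sine {f : ℝ → ℂ} (hf : MemLp f 2 (volume.restrict (Ioo 0 1))) :
    ∑' n : ℕ, ‖∫ y in Ioo (0 : ℝ) 1, f y * profile false n y‖ₑ ^ 2 =
      ∫⁻ y in Ioo (0 : ℝ) 1, ‖f y‖ₑ ^ 2 := by
  have h := hasSum_sine hf
  rw [← ofReal_integral_sq hf, ← h.tsum_eq,
    ENNReal.ofReal_tsum_of_nonneg (fun n => by positivity) h.summable]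
  simp_rw [enorm_sq_eq_ofReal]

/-- The cosine profiles start at frequency `π` and miss the constants. For them the square of the
mean is dropped and only an inequality remains. -/
theorem tsum_profile_le (c : Bool) {f : ℝ → ℂ} (hf : MemLp f 2 (volume.restrict (Ioo 0 1))) :
    ∑' n : ℕ, ‖∫ y in Ioo (0 : ℝ) 1, f y * profile c n y‖ₑ ^ 2 ≤
      ∫⁻ y in Ioo (0 : ℝ) 1, ‖f y‖ₑ ^ 2 := by
  cases c
  · exact (tsum_sine hf).le
  · have h := hasSum_cosine hf
    rw [← ofReal_integral_sq hf]
    simp_rw [enorm_sq_eq_ofReal]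
    rw [← ENNReal.ofReal_tsum_of_nonneg (fun n => by positivity) h.summable, h.tsum_eq]
    apply ENNReal.ofReal_le_ofReal
    have : 0 ≤ ‖∫ y in Ioo (0 : ℝ) 1, f y‖ ^ 2 := by positivity
    linarith

/-! ### Plancherel's identity on the line -/

open FourierTransform SchwartzMap in
/-- On `L¹ ∩ L²` the `L²` Fourier transform is given by the Fourier integral. -/
theorem fourier_toLp_ae_eq {f : ℝ → ℂ} (h1 : Integrable f) (h2 : MemLp f 2 volume) :
    (𝓕 (h2.toLp f) : Lp ℂ 2 (volume : Measure ℝ)) =ᵐ[volume] (𝓕 f : ℝ → ℂ) := by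
  have hc : Continuous (𝓕 f : ℝ → ℂ) := by
    exact VectorFourier.fourierIntegral_continuous Real.continuous_fourierChar
      (L := innerₗ ℝ) continuous_inner h1
  refine ae_eq_of_integral_contDiff_smul_eq
    ((Lp.memLp _).locallyIntegrable (by norm_num)) hc.locallyIntegrable fun g hg hgc => ?_
  have hg' : ContDiff ℝ ∞ (fun x => (g x : ℂ)) := Complex.ofRealCLM.contDiff.comp hg
  have hgc' : HasCompactSupport (fun x => (g x : ℂ)) :=
    hgc.comp_left (g := ((↑) : ℝ → ℂ)) Complex.ofReal_zero
  set G : 𝓢(ℝ, ℂ) := hgc'.toSchwartzMap hg' with hG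
  have hGv : ∀ x, G x = g x := fun x => rfl
  -- Paired with a Schwartz function, the `L²` transform moves onto that function through tempered
  -- distributions; for the integral transform the same identity is the multiplication formula
  -- below.
  have e1 := congrArg (fun T => T G) (Lp.fourier_toTemperedDistribution_eq (h2.toLp f))
  simp only [TemperedDistribution.fourier_apply, Lp.toTemperedDistribution_apply] at e1
  have e2 : ∫ x, g x • (𝓕 (h2.toLp f) : Lp ℂ 2 (volume : Measure ℝ)) x =
      ∫ x, G x • (𝓕 (h2.toLp f) : Lp ℂ 2 (volume : Measure ℝ)) x := by
    congr 1
  rw [e2, ← e1]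
  have e3 : ∫ x, (𝓕 G) x • (h2.toLp f) x = ∫ x, (𝓕 G) x • f x :=
    integral_congr_ae (by filter_upwards [h2.coeFn_toLp] with x hx; rw [hx])
  rw [e3]
  have e4 := VectorFourier.integral_fourierIntegral_smul_eq_flip (L := innerₗ ℝ) (μ := volume)
    (ν := volume) (f := G) (g := f) Real.continuous_fourierChar continuous_inner G.integrable h1
  have e5 : ∫ x, g x • (𝓕 f : ℝ → ℂ) x = ∫ x, G x • (𝓕 f : ℝ → ℂ) x := by congr 1
  rw [e5]
  have hflip : (innerₗ ℝ).flip = innerₗ ℝ := by ext; simp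
  rw [hflip] at e4
  exact e4

open FourierTransform in
/-- Plancherel's identity on `L¹ ∩ L²`. -/
theorem lintegral_fourier_sq {f : ℝ → ℂ} (h1 : Integrable f) (h2 : MemLp f 2 volume) :
    ∫⁻ ξ, ‖(𝓕 f : ℝ → ℂ) ξ‖ₑ ^ 2 = ∫⁻ x, ‖f x‖ₑ ^ 2 := by
  have key : ∀ g : Lp ℂ 2 (volume : Measure ℝ), ∫⁻ x, ‖g x‖ₑ ^ 2 = ENNReal.ofReal (‖g‖ ^ 2) := by
    intro g
    have := eLpNorm_nnreal_pow_eq_lintegral (f := g) (μ := volume) (p := 2) (by norm_num)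
    rw [ENNReal.ofReal_pow (norm_nonneg _), Lp.norm_def, ENNReal.ofReal_toReal (Lp.eLpNorm_ne_top g)]
    simp only [NNReal.coe_ofNat, ENNReal.rpow_ofNat] at this
    exact this.symm
  have e1 : ∫⁻ ξ, ‖(𝓕 f : ℝ → ℂ) ξ‖ₑ ^ 2 =
      ∫⁻ ξ, ‖(𝓕 (h2.toLp f) : Lp ℂ 2 (volume : Measure ℝ)) ξ‖ₑ ^ 2 :=
    lintegral_congr_ae (by filter_upwards [fourier_toLp_ae_eq h1 h2] with x hx; rw [hx])
  have e2 : ∫⁻ x, ‖f x‖ₑ ^ 2 = ∫⁻ x, ‖(h2.toLp f) x‖ₑ ^ 2 :=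
    lintegral_congr_ae (by filter_upwards [h2.coeFn_toLp] with x hx; rw [hx])
  rw [e1, e2, key, key, Lp.norm_fourier_eq]

end

section

open Topology Complex FourierTransform

/-! ### The Fourier transform of the strip -/

/-- The measure on frequency space: Lebesgue measure in `ξ`, counting measure in `n`. -/
abbrev μF : Measure (ℝ × ℕ) := (volume : Measure ℝ).prod Measure.count

/-- Square integrable functions on frequency space. -/
abbrev L2F : Type := Lp ℂ 2 μF

/-- The kernel `e^{-2πixξ}` times a vertical profile. -/
def kernel (c : Bool) (ζ : ℝ × ℕ) (z : ℝ × ℝ) : ℂ :=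
  cexp (((-2 * Real.pi * z.1 * ζ.1 : ℝ) : ℂ) * I) * (profile c ζ.2 z.2 : ℝ)

/-- The Fourier coefficients of an integrable function on the strip. -/
def coeff (c : Bool) (f : ℝ × ℝ → ℂ) (ζ : ℝ × ℕ) : ℂ := ∫ z, f z * kernel c ζ z ∂μΩ

theorem norm_kernel_le (c : Bool) (ζ : ℝ × ℕ) (z : ℝ × ℝ) : ‖kernel c ζ z‖ ≤ √2 := by
  rw [kernel, norm_mul, Complex.norm_exp_ofReal_mul_I, one_mul, Complex.norm_real]
  exact abs_profile_le _ _ _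

theorem continuous_kernel (c : Bool) (ζ : ℝ × ℕ) : Continuous (kernel c ζ) := by
  unfold kernel
  have := (contDiff_profile c ζ.2).continuous
  fun_prop

theorem integrable_mul_kernel (c : Bool) {f : ℝ × ℝ → ℂ} (hf : Integrable f μΩ) (ζ : ℝ × ℕ) :
    Integrable (fun z => f z * kernel c ζ z) μΩ :=
  hf.mul_bdd (c := √2) (continuous_kernel c ζ).aestronglyMeasurable
    (Eventually.of_forall fun z => norm_kernel_le c ζ z)

theorem norm_coeff_le (c : Bool) {f : ℝ × ℝ → ℂ} (hf : Integrable f μΩ) (ζ : ℝ × ℕ) :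
    ‖coeff c f ζ‖ ≤ √2 * ∫ z, ‖f z‖ ∂μΩ := by
  rw [← integral_const_mul]
  refine norm_integral_le_of_norm_le (hf.norm.const_mul _) (Eventually.of_forall fun z => ?_)
  rw [norm_mul, mul_comm]
  gcongr
  exact norm_kernel_le c ζ z

theorem μΩ_eq_prod : μΩ = (volume : Measure ℝ).prod (volume.restrict (Ioo (0 : ℝ) 1)) := by
  rw [μΩ, strip, Measure.volume_eq_prod, ← Measure.prod_restrict, Measure.restrict_univ]

/-- The vertical coefficients of a function on the strip. -/
def slice (c : Bool) (f : ℝ × ℝ → ℂ) (n : ℕ) (x : ℝ) : ℂ :=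
  ∫ y in Ioo (0 : ℝ) 1, f (x, y) * profile c n y

theorem integrable_mul_profile (c : Bool) {f : ℝ × ℝ → ℂ} (hf : Integrable f μΩ) (n : ℕ) :
    Integrable (fun z => f z * (profile c n z.2 : ℝ)) μΩ := by
  have := (contDiff_profile c n).continuous
  refine hf.mul_bdd (c := √2) ?_ (Eventually.of_forall fun z => ?_)
  · exact (Complex.continuous_ofReal.comp (this.comp continuous_snd)).aestronglyMeasurable
  · rw [Complex.norm_real]; exact abs_profile_le _ _ _

theorem integrable_slice (c : Bool) {f : ℝ × ℝ → ℂ} (hf : Integrable f μΩ) (n : ℕ) :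
    Integrable (slice c f n) := by
  have h := integrable_mul_profile c hf n
  rw [μΩ_eq_prod] at h
  exact h.integral_prod_left

/-- The kernel is a product, so Fubini splits the transform into a vertical series and a horizontal
Fourier integral. Parseval and Plancherel can then be used one after the other. -/
theorem coeff_eq_fourier (c : Bool) {f : ℝ × ℝ → ℂ} (hf : Integrable f μΩ) (ξ : ℝ) (n : ℕ) :
    coeff c f (ξ, n) = (𝓕 (slice c f n) : ℝ → ℂ) ξ := by
  have h := integrable_mul_kernel c hf (ξ, n)
  rw [coeff, Real.fourier_real_eq_integral_exp_smul]
  rw [μΩ_eq_prod] at h ⊢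
  rw [integral_prod _ h]
  congr 1; funext x
  rw [slice, smul_eq_mul, ← integral_const_mul]
  congr 1; funext y
  simp only [kernel]
  push_cast
  ring

theorem continuous_coeff (c : Bool) {f : ℝ × ℝ → ℂ} (hf : Integrable f μΩ) (n : ℕ) :
    Continuous fun ξ => coeff c f (ξ, n) := by
  simp_rw [coeff_eq_fourier c hf]
  exact VectorFourier.fourierIntegral_continuous Real.continuous_fourierChar
    (L := innerₗ ℝ) continuous_inner (integrable_slice c hf n)

theorem measurable_coeff (c : Bool) {f : ℝ × ℝ → ℂ} (hf : Integrable f μΩ) :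
    Measurable (coeff c f) :=
  measurable_from_prod_countable_left fun n => (continuous_coeff c hf n).measurable

theorem ae_memLp_slice {f : ℝ × ℝ → ℂ} (hf : MemLp f 2 μΩ) :
    ∀ᵐ x : ℝ, MemLp (fun y => f (x, y)) 2 (volume.restrict (Ioo 0 1)) := by
  have h1 := hf.1
  have h2 := (memLp_two_iff_integrable_sq_norm hf.1).1 hf
  rw [μΩ_eq_prod] at h1 h2
  filter_upwards [h1.prodMk_left, h2.prod_right_ae] with x hx1 hx2
  exact (memLp_two_iff_integrable_sq_norm hx1).2 hx2

theorem lintegral_sq_eq {f : ℝ × ℝ → ℂ} (hf : AEStronglyMeasurable f μΩ) :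
    ∫⁻ z, ‖f z‖ₑ ^ 2 ∂μΩ = ∫⁻ x, ∫⁻ y in Ioo (0 : ℝ) 1, ‖f (x, y)‖ₑ ^ 2 := by
  rw [μΩ_eq_prod] at hf ⊢
  exact lintegral_prod _ (hf.enorm.pow_const 2)

theorem lintegral_sq_ne_top {α : Type*} [MeasurableSpace α] {μ : Measure α} {f : α → ℂ}
    (hf : MemLp f 2 μ) : ∫⁻ z, ‖f z‖ₑ ^ 2 ∂μ ≠ ⊤ := by
  rw [← ofReal_integral_sq hf]; exact ENNReal.ofReal_ne_top

theorem memLp_two_of_lintegral_sq {α : Type*} [MeasurableSpace α] {μ : Measure α} {f : α → ℂ}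
    (hm : AEStronglyMeasurable f μ) (hf : ∫⁻ z, ‖f z‖ₑ ^ 2 ∂μ ≠ ⊤) : MemLp f 2 μ := by
  rw [memLp_two_iff_integrable_sq_norm hm]
  refine ⟨hm.norm.pow 2, ?_⟩
  rw [HasFiniteIntegral]
  refine lt_of_le_of_lt (le_of_eq ?_) (lt_top_iff_ne_top.2 hf)
  congr 1; funext z
  rw [enorm_pow, enorm_norm]

theorem memLp_slice (c : Bool) {f : ℝ × ℝ → ℂ} (h1 : Integrable f μΩ) (h2 : MemLp f 2 μΩ) (n : ℕ) :
    MemLp (slice c f n) 2 volume := by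
  refine memLp_two_of_lintegral_sq (integrable_slice c h1 n).aestronglyMeasurable
    (ne_top_of_le_ne_top (lintegral_sq_ne_top h2) ?_)
  rw [lintegral_sq_eq h2.1]
  refine lintegral_mono_ae ?_
  filter_upwards [ae_memLp_slice h2] with x hx
  exact (ENNReal.le_tsum n).trans (tsum_profile_le c hx)

/-- Plancherel in `x` for every fixed vertical mode, with the sum over the modes moved inside by
Tonelli. -/
theorem lintegral_coeff_sq_eq (c : Bool) {f : ℝ × ℝ → ℂ} (h1 : Integrable f μΩ)
    (h2 : MemLp f 2 μΩ) :
    ∫⁻ ζ, ‖coeff c f ζ‖ₑ ^ 2 ∂μF = ∫⁻ x, ∑' n, ‖slice c f n x‖ₑ ^ 2 := by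
  rw [lintegral_prod_symm _ ((measurable_coeff c h1).enorm.pow_const 2).aemeasurable,
    lintegral_count, lintegral_tsum fun n =>
      (integrable_slice c h1 n).aestronglyMeasurable.enorm.pow_const 2]
  congr 1; funext n
  rw [← lintegral_fourier_sq (integrable_slice c h1 n) (memLp_slice c h1 h2 n)]
  congr 1; funext ξ
  rw [coeff_eq_fourier c h1]

theorem lintegral_coeff_sq_le (c : Bool) {f : ℝ × ℝ → ℂ} (h1 : Integrable f μΩ)
    (h2 : MemLp f 2 μΩ) :
    ∫⁻ ζ, ‖coeff c f ζ‖ₑ ^ 2 ∂μF ≤ ∫⁻ z, ‖f z‖ₑ ^ 2 ∂μΩ := by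
  rw [lintegral_coeff_sq_eq c h1 h2, lintegral_sq_eq h2.1]
  refine lintegral_mono_ae ?_
  filter_upwards [ae_memLp_slice h2] with x hx
  exact tsum_profile_le c hx

theorem lintegral_coeff_sine_sq {f : ℝ × ℝ → ℂ} (h1 : Integrable f μΩ) (h2 : MemLp f 2 μΩ) :
    ∫⁻ ζ, ‖coeff false f ζ‖ₑ ^ 2 ∂μF = ∫⁻ z, ‖f z‖ₑ ^ 2 ∂μΩ := by
  rw [lintegral_coeff_sq_eq false h1 h2, lintegral_sq_eq h2.1]
  refine lintegral_congr_ae ?_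
  filter_upwards [ae_memLp_slice h2] with x hx
  exact tsum_sine hx

theorem memLp_coeff (c : Bool) {f : ℝ × ℝ → ℂ} (h1 : Integrable f μΩ) (h2 : MemLp f 2 μΩ) :
    MemLp (coeff c f) 2 μF :=
  memLp_two_of_lintegral_sq (measurable_coeff c h1).aestronglyMeasurable
    (ne_top_of_le_ne_top (lintegral_sq_ne_top h2) (lintegral_coeff_sq_le c h1 h2))

theorem ofReal_norm_sq_eq {α : Type*} [MeasurableSpace α] {μ : Measure α} (g : Lp ℂ 2 μ) :
    ENNReal.ofReal (‖g‖ ^ 2) = ∫⁻ x, ‖g x‖ₑ ^ 2 ∂μ := by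
  have := eLpNorm_nnreal_pow_eq_lintegral (f := g) (μ := μ) (p := 2) (by norm_num)
  rw [ENNReal.ofReal_pow (norm_nonneg _), Lp.norm_def, ENNReal.ofReal_toReal (Lp.eLpNorm_ne_top g)]
  simp only [NNReal.coe_ofNat, ENNReal.rpow_ofNat] at this
  exact this

theorem ofReal_norm_sq_toLp {α : Type*} [MeasurableSpace α] {μ : Measure α} {f : α → ℂ}
    (hf : MemLp f 2 μ) : ENNReal.ofReal (‖hf.toLp f‖ ^ 2) = ∫⁻ x, ‖f x‖ₑ ^ 2 ∂μ := by
  rw [ofReal_norm_sq_eq]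
  exact lintegral_congr_ae (by filter_upwards [hf.coeFn_toLp] with x hx; rw [hx])

/-- The integrable elements of `L²`. -/
def integrableL2 : Submodule ℂ (Lp ℂ 2 μΩ) where
  carrier := {f | Integrable f μΩ}
  add_mem' {f g} hf hg := (hf.add hg).congr (Lp.coeFn_add f g).symm
  zero_mem' := (integrable_zero _ _ _).congr (Lp.coeFn_zero ℂ 2 μΩ).symm
  smul_mem' a f hf := (hf.smul a).congr (Lp.coeFn_smul a f).symm

/-- Square integrable simple functions have support of finite measure, hence are integrable, and
they are dense. -/
theorem denseRange_integrableL2 : DenseRange integrableL2.subtype := by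
  have hd : Dense (Lp.simpleFunc ℂ 2 μΩ : Set (Lp ℂ 2 μΩ)) := Lp.simpleFunc.dense (by norm_num)
  have : Dense (integrableL2 : Set (Lp ℂ 2 μΩ)) := by
    refine hd.mono fun f hf => ?_
    have h1 := Lp.simpleFunc.toSimpleFunc_eq_toFun (⟨f, hf⟩ : Lp.simpleFunc ℂ 2 μΩ)
    have h2 := Lp.simpleFunc.memLp (⟨f, hf⟩ : Lp.simpleFunc ℂ 2 μΩ)
    rw [SimpleFunc.memLp_iff_integrable (by norm_num) (by norm_num)] at h2
    exact h2.congr h1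
  rw [Submodule.coe_subtype]
  exact this.denseRange_val

theorem coeff_congr (c : Bool) {f g : ℝ × ℝ → ℂ} (h : f =ᵐ[μΩ] g) : coeff c f = coeff c g := by
  funext ζ
  exact integral_congr_ae (by filter_upwards [h] with z hz; rw [hz])

/-- The transform on integrable elements of `L²`. -/
def preTransform (c : Bool) : integrableL2 →ₗ[ℂ] L2F where
  toFun f := (memLp_coeff c f.2 (Lp.memLp (f : Lp ℂ 2 μΩ))).toLp _
  map_add' f g := by
    rw [← MemLp.toLp_add, MemLp.toLp_eq_toLp_iff]
    refine Eventually.of_forall fun ζ => ?_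
    rw [Submodule.coe_add, coeff_congr c (Lp.coeFn_add (f : Lp ℂ 2 μΩ) g)]
    simp only [coeff, Pi.add_apply, add_mul]
    exact integral_add (integrable_mul_kernel c f.2 ζ) (integrable_mul_kernel c g.2 ζ)
  map_smul' a f := by
    rw [RingHom.id_apply, ← MemLp.toLp_const_smul, MemLp.toLp_eq_toLp_iff]
    refine Eventually.of_forall fun ζ => ?_
    rw [Submodule.coe_smul, coeff_congr c (Lp.coeFn_smul a (f : Lp ℂ 2 μΩ))]
    simp only [coeff, Pi.smul_apply, smul_eq_mul, mul_assoc]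
    exact integral_const_mul _ _

theorem norm_preTransform_le (c : Bool) (f : integrableL2) :
    ‖preTransform c f‖ ≤ 1 * ‖integrableL2.subtype f‖ := by
  have h := lintegral_coeff_sq_le c f.2 (Lp.memLp (f : Lp ℂ 2 μΩ))
  rw [← ofReal_norm_sq_toLp (memLp_coeff c f.2 (Lp.memLp (f : Lp ℂ 2 μΩ))),
    ← ofReal_norm_sq_eq] at h
  rw [ENNReal.ofReal_le_ofReal_iff (by positivity)] at h
  rw [one_mul]
  exact (pow_le_pow_iff_left₀ (norm_nonneg _) (norm_nonneg _) two_ne_zero).1 h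

/-- The Fourier transform of the strip on `L²`, in the basis of sines or cosines. -/
def transform (c : Bool) : Lp ℂ 2 μΩ →L[ℂ] L2F :=
  (preTransform c).extendOfNorm integrableL2.subtype

theorem transform_of_integrable (c : Bool) {f : ℝ × ℝ → ℂ} (h1 : Integrable f μΩ)
    (h2 : MemLp f 2 μΩ) : transform c (h2.toLp f) = (memLp_coeff c h1 h2).toLp _ := by
  have hm : h2.toLp f ∈ integrableL2 := h1.congr h2.coeFn_toLp.symm
  have := LinearMap.extendOfNorm_eq denseRange_integrableL2 ⟨1, norm_preTransform_le c⟩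
    ⟨h2.toLp f, hm⟩
  change transform c (h2.toLp f) = _ at this
  rw [this]
  refine (MemLp.toLp_eq_toLp_iff (memLp_coeff c hm (Lp.memLp (h2.toLp f))) _).2 (Eventually.of_forall fun ζ => ?_)
  rw [coeff_congr c h2.coeFn_toLp]

theorem norm_transform_le (c : Bool) (f : Lp ℂ 2 μΩ) : ‖transform c f‖ ≤ ‖f‖ := by
  have := LinearMap.norm_extendOfNorm_apply_le denseRange_integrableL2 1
    (norm_preTransform_le c) f
  rwa [one_mul] at this

/-- Sines are complete on `(0,1)`, so Plancherel holds on the dense subspace and persists under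
limits. The cosine transform is only a contraction. -/
theorem norm_transform_sine (f : Lp ℂ 2 μΩ) : ‖transform false f‖ = ‖f‖ := by
  refine denseRange_integrableL2.induction (P := fun f => ‖transform false f‖ = ‖f‖) ?_
    (isClosed_eq (by fun_prop) (by fun_prop)) f
  rintro _ ⟨f, rfl⟩
  have h := lintegral_coeff_sine_sq f.2 (Lp.memLp (f : Lp ℂ 2 μΩ))
  rw [← ofReal_norm_sq_toLp (memLp_coeff false f.2 (Lp.memLp (f : Lp ℂ 2 μΩ))),
    ← ofReal_norm_sq_eq, ← transform_of_integrable false f.2 (Lp.memLp (f : Lp ℂ 2 μΩ)), Lp.toLp_coeFn] at h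
  rw [ENNReal.ofReal_eq_ofReal_iff (by positivity) (by positivity)] at h
  exact (sq_eq_sq₀ (norm_nonneg _) (norm_nonneg _)).1 h

theorem inner_transform_sine (f g : Lp ℂ 2 μΩ) :
    inner ℂ (transform false f) (transform false g) = inner ℂ f g := by
  exact (LinearIsometry.mk (transform false).toLinearMap norm_transform_sine).inner_map_map f g

/-! ### Synthesis -/

/-- Real functions as complex functions. -/
def toComplex : L2Ω →L[ℝ] Lp ℂ 2 μΩ := Complex.ofRealCLM.compLpL 2 μΩ

theorem coeFn_toComplex (f : L2Ω) : toComplex f =ᵐ[μΩ] fun z => (f z : ℂ) :=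
  ContinuousLinearMap.coeFn_compLp _ _

/-- Real part of the inverse transform. -/
def synth (c : Bool) : L2F →L[ℝ] L2Ω :=
  (Complex.reCLM.compLpL 2 μΩ).comp
    ((ContinuousLinearMap.adjoint (transform c)).restrictScalars ℝ)

theorem coeFn_synth (c : Bool) (F : L2F) :
    synth c F =ᵐ[μΩ] fun z => (ContinuousLinearMap.adjoint (transform c) F z).re :=
  ContinuousLinearMap.coeFn_compLp _ _

theorem norm_adjoint_transform_le (c : Bool) (F : L2F) :
    ‖ContinuousLinearMap.adjoint (transform c) F‖ ≤ ‖F‖ := by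
  refine (ContinuousLinearMap.le_opNorm _ _).trans ?_
  rw [LinearIsometryEquiv.norm_map]
  refine mul_le_of_le_one_left (norm_nonneg _) ?_
  exact ContinuousLinearMap.opNorm_le_bound _ zero_le_one fun f => by
    rw [one_mul]; exact norm_transform_le c f

theorem norm_synth_le (c : Bool) (F : L2F) : ‖synth c F‖ ≤ ‖F‖ := by
  refine le_trans ?_ (norm_adjoint_transform_le c F)
  refine Lp.norm_le_norm_of_ae_le ?_
  filter_upwards [coeFn_synth c F] with z hz
  rw [hz]
  exact Complex.abs_re_le_norm _

/-- The adjoint of an isometry is a left inverse. This is Fourier inversion on the strip without any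
convergence of series, and it makes the sine coefficients determine the function. -/
theorem synth_transform (f : L2Ω) : synth false (transform false (toComplex f)) = f := by
  have h : ContinuousLinearMap.adjoint (transform false) (transform false (toComplex f)) =
      toComplex f := by
    refine ext_inner_left ℂ fun g => ?_
    rw [ContinuousLinearMap.adjoint_inner_right, inner_transform_sine]
  refine Lp.ext ?_
  filter_upwards [coeFn_synth false (transform false (toComplex f)), coeFn_toComplex f] with z h1 h2
  rw [h1, h, h2, Complex.ofReal_re]

/-- Duality moves the synthesis onto the test function, whose coefficients are honest integrals.
Derivatives, traces and uniform bounds of synthesised functions are all obtained from this pairing.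
-/
theorem integral_adjoint_mul (c : Bool) (F : L2F) {η : ℝ × ℝ → ℝ} (h1 : Integrable η μΩ)
    (h2 : MemLp η 2 μΩ) :
    ∫ z, synth c F z * η z ∂μΩ =
      (∫ ζ, (starRingEnd ℂ) (coeff c (fun z => (η z : ℂ)) ζ) * F ζ ∂μF).re := by
  have h1' : Integrable (fun z => (η z : ℂ)) μΩ := h1.ofReal
  have h2' : MemLp (fun z => (η z : ℂ)) 2 μΩ := h2.ofReal
  have e1 : inner ℂ (h2'.toLp _) (ContinuousLinearMap.adjoint (transform c) F) =
      inner ℂ (transform c (h2'.toLp _)) F := ContinuousLinearMap.adjoint_inner_right _ _ _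
  have e2 : inner ℂ (transform c (h2'.toLp _)) F =
      ∫ ζ, (starRingEnd ℂ) (coeff c (fun z => (η z : ℂ)) ζ) * F ζ ∂μF := by
    rw [transform_of_integrable c h1' h2', L2.inner_def]
    refine integral_congr_ae ?_
    filter_upwards [(memLp_coeff c h1' h2').coeFn_toLp] with ζ hζ
    rw [hζ]; simp [mul_comm]
  rw [← e2, ← e1, L2.inner_def]
  have hi := L2.integrable_inner (𝕜 := ℂ) (h2'.toLp _) (ContinuousLinearMap.adjoint (transform c) F)
  have e3 := Complex.reCLM.integral_comp_comm hi
  simp only [Complex.reCLM_apply] at e3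
  rw [← e3]
  refine integral_congr_ae ?_
  filter_upwards [coeFn_synth c F, h2'.coeFn_toLp] with z hz h2z
  rw [hz, h2z]
  simp

end

section

open Topology Complex

/-! ### Integration by parts against complex test functions -/

theorem integrable_mul_snd {f : ℝ × ℝ → ℂ} (hf : Integrable f μΩ) {s : ℝ → ℝ} (hs : Continuous s) :
    Integrable (fun z => f z * (s z.2 : ℝ)) μΩ := by
  obtain ⟨M, hM⟩ := (isCompact_Icc (a := (0 : ℝ)) (b := 1)).exists_bound_of_continuousOn
    hs.continuousOn
  refine hf.mul_bdd (c := M) (Complex.continuous_ofReal.comp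
    (hs.comp continuous_snd)).aestronglyMeasurable ?_
  filter_upwards [ae_mem_strip] with z hz
  rw [Complex.norm_real]
  exact hM _ (Ioo_subset_Icc_self hz)

theorem integral_re_im {F : ℝ × ℝ → ℂ} (hF : Integrable F μΩ) :
    (∫ z, F z ∂μΩ).re = ∫ z, (F z).re ∂μΩ ∧ (∫ z, F z ∂μΩ).im = ∫ z, (F z).im ∂μΩ :=
  ⟨(Complex.reCLM.integral_comp_comm hF).symm, (Complex.imCLM.integral_comp_comm hF).symm⟩

theorem hasDerivAt_re_im {h : ℝ → ℂ} (hh : ContDiff ℝ ∞ h) (x : ℝ) :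
    deriv (fun x => (h x).re) x = (deriv h x).re ∧ deriv (fun x => (h x).im) x = (deriv h x).im := by
  have hd := (hh.differentiable (by simp) x).hasDerivAt
  exact ⟨(Complex.reCLM.hasFDerivAt.comp_hasDerivAt x hd).deriv,
    (Complex.imCLM.hasFDerivAt.comp_hasDerivAt x hd).deriv⟩

theorem integrable_re_im {f : ℝ × ℝ → ℝ} {h : ℝ → ℂ}
    (h1 : Integrable (fun z => (f z : ℂ) * h z.1) μΩ) :
    Integrable (fun z => f z * (h z.1).re) μΩ ∧ Integrable (fun z => f z * (h z.1).im) μΩ := by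
  refine ⟨(h1.re).congr (Eventually.of_forall fun z => ?_),
    (h1.im).congr (Eventually.of_forall fun z => ?_)⟩ <;> simp

/-- Passage from real to complex horizontal factors in an integration by parts formula. -/
theorem integral_eq_neg_of_re_im {f g : ℝ × ℝ → ℝ} {h k : ℝ → ℂ} {s r : ℝ → ℝ}
    (hs : Continuous s) (hr : Continuous r)
    (h1 : Integrable (fun z => (f z : ℂ) * k z.1) μΩ)
    (h2 : Integrable (fun z => (g z : ℂ) * h z.1) μΩ)
    (hre : ∫ z, f z * ((k z.1).re * r z.2) ∂μΩ = - ∫ z, g z * ((h z.1).re * s z.2) ∂μΩ)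
    (him : ∫ z, f z * ((k z.1).im * r z.2) ∂μΩ = - ∫ z, g z * ((h z.1).im * s z.2) ∂μΩ) :
    ∫ z, (f z : ℂ) * (k z.1 * (r z.2 : ℝ)) ∂μΩ = - ∫ z, (g z : ℂ) * (h z.1 * (s z.2 : ℝ)) ∂μΩ := by
  have i1 := integral_re_im (integrable_mul_snd h1 hr)
  have i2 := integral_re_im (integrable_mul_snd h2 hs)
  simp only [← mul_assoc]
  apply Complex.ext
  · rw [Complex.neg_re, i1.1, i2.1]
    convert hre using 2 <;> [skip; congr 1] <;> (funext z; simp [mul_assoc])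
  · rw [Complex.neg_im, i1.2, i2.2]
    convert him using 2 <;> [skip; congr 1] <;> (funext z; simp [mul_assoc])

theorem IsWeakDeriv.integral_fst {f g : ℝ × ℝ → ℝ} {h : ℝ → ℂ} {s : ℝ → ℝ}
    (hw : IsWeakDeriv 1 0 f g) (hh : ContDiff ℝ ∞ h) (hs : ContDiff ℝ ∞ s)
    (h1 : Integrable (fun z => (f z : ℂ) * h z.1) μΩ)
    (h2 : Integrable (fun z => (f z : ℂ) * deriv h z.1) μΩ)
    (h3 : Integrable (fun z => (g z : ℂ) * h z.1) μΩ) :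
    ∫ z, (f z : ℂ) * (deriv h z.1 * (s z.2 : ℝ)) ∂μΩ =
      - ∫ z, (g z : ℂ) * (h z.1 * (s z.2 : ℝ)) ∂μΩ := by
  have real : ∀ k : ℝ → ℝ, ContDiff ℝ ∞ k → Integrable (fun z => f z * k z.1) μΩ →
      Integrable (fun z => f z * deriv k z.1) μΩ → Integrable (fun z => g z * k z.1) μΩ →
      ∫ z, f z * (deriv k z.1 * s z.2) ∂μΩ = - ∫ z, g z * (k z.1 * s z.2) ∂μΩ := by
    intro k hk i1 i2 i3
    have b : ∀ q : ℝ × ℝ → ℝ, Integrable q μΩ → Integrable (fun z => q z * s z.2) μΩ := by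
      intro q hq
      have := (integrable_mul_snd hq.ofReal hs.continuous).re
      refine this.congr (Eventually.of_forall fun z => ?_)
      simp
    have e := hw.integral_pd₁ (contDiff_prod_mul hk hs)
      ((b _ i1).congr (Eventually.of_forall fun z => by simp only; ring))
      ((b _ i2).congr (Eventually.of_forall fun z => by
        simp only
        rw [pd₁_prod (hk.differentiable (by simp)) (hs.differentiable (by simp))]; ring))
      ((b _ i3).congr (Eventually.of_forall fun z => by simp only; ring))
    rw [← e]
    congr 1; funext z
    rw [pd₁_prod (hk.differentiable (by simp)) (hs.differentiable (by simp))]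
  have d := hasDerivAt_re_im hh
  have i1 := integrable_re_im h1
  have i2 := integrable_re_im h2
  have i3 := integrable_re_im h3
  refine integral_eq_neg_of_re_im hs.continuous hs.continuous h2 h3 ?_ ?_
  · have := real (fun x => (h x).re) (Complex.reCLM.contDiff.comp hh) i1.1
      (by simpa only [(d _).1] using i2.1) i3.1
    simpa only [(d _).1] using this
  · have := real (fun x => (h x).im) (Complex.imCLM.contDiff.comp hh) i1.2
      (by simpa only [(d _).2] using i2.2) i3.2
    simpa only [(d _).2] using this

/-- The boundary term contains the product `f s`, so it is enough that one of the two factors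
vanishes on the boundary. -/
theorem IsWeakDeriv.integral_snd {f g : ℝ × ℝ → ℝ} {h : ℝ → ℂ} {s : ℝ → ℝ}
    (hw : IsWeakDeriv 0 1 f g) (hh : ContDiff ℝ ∞ h) (hs : ContDiff ℝ ∞ s)
    (hb : VanishesOnBoundary f ∨ (s 0 = 0 ∧ s 1 = 0))
    (h1 : Integrable (fun z => (f z : ℂ) * h z.1) μΩ)
    (h3 : Integrable (fun z => (g z : ℂ) * h z.1) μΩ) :
    ∫ z, (f z : ℂ) * (h z.1 * (deriv s z.2 : ℝ)) ∂μΩ =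
      - ∫ z, (g z : ℂ) * (h z.1 * (s z.2 : ℝ)) ∂μΩ := by
  have real : ∀ k : ℝ → ℝ, ContDiff ℝ ∞ k → Integrable (fun z => f z * k z.1) μΩ →
      Integrable (fun z => g z * k z.1) μΩ →
      ∫ z, f z * (k z.1 * deriv s z.2) ∂μΩ = - ∫ z, g z * (k z.1 * s z.2) ∂μΩ := by
    intro k hk i1 i3
    rcases hb with hb | hb
    · exact hw.integral_pd₂_of_vanishes hb hk hs i1 i3
    · exact hw.integral_pd₂ hk hs hb.1 hb.2 i1 i3
  have i1 := integrable_re_im h1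
  have i3 := integrable_re_im h3
  refine integral_eq_neg_of_re_im hs.continuous (hs.continuous_deriv (by simp)) h1 h3 ?_ ?_
  · exact real (fun x => (h x).re) (Complex.reCLM.contDiff.comp hh) i1.1 i3.1
  · exact real (fun x => (h x).im) (Complex.imCLM.contDiff.comp hh) i1.2 i3.2

/-! ### Coefficients of derivatives -/

/-- The horizontal wave number. -/
def waveX (ζ : ℝ × ℕ) : ℝ := 2 * Real.pi * ζ.1

theorem profile_sine_zero (n : ℕ) : profile false n 0 = 0 := by simp [profile]

theorem profile_sine_one (n : ℕ) : profile false n 1 = 0 := by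
  simp only [profile, waveY, Bool.false_eq_true, if_false, mul_one]
  have := Real.sin_nat_mul_pi (n + 1)
  push_cast at this
  rw [this, mul_zero]

theorem deriv_profile_sine (n : ℕ) (y : ℝ) :
    deriv (profile false n) y = waveY n * profile true n y := by
  have h1 : HasDerivAt (fun y => waveY n * y) (waveY n) y := by
    simpa using (hasDerivAt_id y).const_mul (waveY n)
  have := ((h1.sin).const_mul (√2)).deriv
  change deriv (fun y => √2 * Real.sin (waveY n * y)) y = waveY n * (√2 * Real.cos (waveY n * y))
  rw [this]; ring

theorem deriv_profile_cosine (n : ℕ) (y : ℝ) :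
    deriv (profile true n) y = -waveY n * profile false n y := by
  have h1 : HasDerivAt (fun y => waveY n * y) (waveY n) y := by
    simpa using (hasDerivAt_id y).const_mul (waveY n)
  have := ((h1.cos).const_mul (√2)).deriv
  change deriv (fun y => √2 * Real.cos (waveY n * y)) y = -waveY n * (√2 * Real.sin (waveY n * y))
  rw [this]; ring

/-- The horizontal factor of the kernel. -/
def kernelX (ξ : ℝ) (x : ℝ) : ℂ := cexp (((-2 * Real.pi * x * ξ : ℝ) : ℂ) * I)

theorem contDiff_kernelX (ξ : ℝ) : ContDiff ℝ ∞ (kernelX ξ) := by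
  unfold kernelX
  have : ContDiff ℝ ∞ fun x : ℝ => -2 * Real.pi * x * ξ := by fun_prop
  exact ((Complex.ofRealCLM.contDiff.comp this).mul contDiff_const).cexp

theorem deriv_kernelX (ζ : ℝ × ℕ) (x : ℝ) :
    deriv (kernelX ζ.1) x = -(I * waveX ζ) * kernelX ζ.1 x := by
  have h1 : HasDerivAt (fun x : ℝ => (((-2 * Real.pi * x * ζ.1 : ℝ) : ℂ) * I))
      (((-2 * Real.pi * ζ.1 : ℝ) : ℂ) * I) x := by
    have : HasDerivAt (fun x : ℝ => -2 * Real.pi * x * ζ.1) (-2 * Real.pi * ζ.1) x := by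
      simpa using ((hasDerivAt_id x).const_mul (-2 * Real.pi)).mul_const ζ.1
    exact (this.ofReal_comp).mul_const I
  have := h1.cexp.deriv
  unfold kernelX
  rw [this, waveX]
  push_cast
  ring

theorem integrable_mul_kernelX {f : ℝ × ℝ → ℝ} (hf : Integrable f μΩ) (ξ : ℝ) :
    Integrable (fun z => (f z : ℂ) * kernelX ξ z.1) μΩ := by
  refine hf.ofReal.mul_bdd (c := 1)
    ((contDiff_kernelX ξ).continuous.comp continuous_fst).aestronglyMeasurable
    (Eventually.of_forall fun z => ?_)
  rw [kernelX, Complex.norm_exp_ofReal_mul_I]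

/-- Coefficients of a real function. -/
def rcoeff (c : Bool) (f : ℝ × ℝ → ℝ) (ζ : ℝ × ℕ) : ℂ := coeff c (fun z => (f z : ℂ)) ζ

theorem rcoeff_eq (c : Bool) (f : ℝ × ℝ → ℝ) (ζ : ℝ × ℕ) :
    rcoeff c f ζ = ∫ z, (f z : ℂ) * (kernelX ζ.1 z.1 * (profile c ζ.2 z.2 : ℝ)) ∂μΩ := rfl

theorem rcoeff_deriv_fst (c : Bool) {f g : ℝ × ℝ → ℝ} (hf : Integrable f μΩ)
    (hg : Integrable g μΩ) (hw : IsWeakDeriv 1 0 f g) (ζ : ℝ × ℕ) :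
    rcoeff c g ζ = I * waveX ζ * rcoeff c f ζ := by
  have h1 := integrable_mul_kernelX hf ζ.1
  have e := hw.integral_fst (contDiff_kernelX ζ.1) (contDiff_profile c ζ.2) h1
    (by simp only [deriv_kernelX]
        exact (h1.const_mul (-(I * waveX ζ))).congr (Eventually.of_forall fun z => by
          simp only; ring)) (integrable_mul_kernelX hg ζ.1)
  rw [← rcoeff_eq] at e
  have e2 : rcoeff c g ζ = -∫ z, (f z : ℂ) * (deriv (kernelX ζ.1) z.1 * (profile c ζ.2 z.2 : ℝ)) ∂μΩ := by
    rw [e, neg_neg]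
  rw [e2, rcoeff_eq, ← integral_const_mul, ← integral_neg]
  congr 1; funext z
  rw [deriv_kernelX]; ring

/-- The sine itself kills the boundary term, so no trace condition on `f` is needed. -/
theorem rcoeff_sine_deriv_snd {f g : ℝ × ℝ → ℝ} (hf : Integrable f μΩ)
    (hg : Integrable g μΩ) (hw : IsWeakDeriv 0 1 f g) (ζ : ℝ × ℕ) :
    rcoeff false g ζ = -waveY ζ.2 * rcoeff true f ζ := by
  have e := hw.integral_snd (contDiff_kernelX ζ.1) (contDiff_profile false ζ.2)
    (Or.inr ⟨profile_sine_zero _, profile_sine_one _⟩) (integrable_mul_kernelX hf ζ.1)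
    (integrable_mul_kernelX hg ζ.1)
  rw [← rcoeff_eq] at e
  rw [← neg_eq_iff_eq_neg] at e
  rw [← e, rcoeff_eq, ← integral_const_mul, ← integral_neg]
  congr 1; funext z
  rw [deriv_profile_sine]; push_cast; ring

/-- The cosine does not vanish at the ends, and here the trace of `f` has to. This asymmetry is the
source of the parity conditions in `𝔇`. -/
theorem rcoeff_cosine_deriv_snd {f g : ℝ × ℝ → ℝ} (hf : Integrable f μΩ)
    (hg : Integrable g μΩ) (hw : IsWeakDeriv 0 1 f g) (hv : VanishesOnBoundary f) (ζ : ℝ × ℕ) :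
    rcoeff true g ζ = waveY ζ.2 * rcoeff false f ζ := by
  have e := hw.integral_snd (contDiff_kernelX ζ.1) (contDiff_profile true ζ.2)
    (Or.inl hv) (integrable_mul_kernelX hf ζ.1) (integrable_mul_kernelX hg ζ.1)
  rw [← rcoeff_eq] at e
  rw [← neg_eq_iff_eq_neg] at e
  rw [← e, rcoeff_eq, ← integral_const_mul, ← integral_neg]
  congr 1; funext z
  rw [deriv_profile_cosine]; push_cast; ring

/-! ### Smooth functions -/

/-- One factor is supported in the open strip, so both integrals extend to the plane, where there is
no boundary. The factor supported in the strip need not be specified, which serves both weak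
derivatives and traces. -/
theorem integral_mul_fderiv_comm {η θ : ℝ × ℝ → ℝ} (hη : ContDiff ℝ ∞ η) (hθ : ContDiff ℝ ∞ θ)
    (hc : HasCompactSupport η ∨ HasCompactSupport θ) (hs : tsupport η ⊆ strip ∨ tsupport θ ⊆ strip)
    (v : ℝ × ℝ) :
    ∫ z, η z * fderiv ℝ θ z v ∂μΩ = - ∫ z, fderiv ℝ η z v * θ z ∂μΩ := by
  have cη := (hη.fderiv_right (m := ∞) (by simp)).clm_apply (contDiff_const (c := v))
  have cθ := (hθ.fderiv_right (m := ∞) (by simp)).clm_apply (contDiff_const (c := v))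
  have zero_of : ∀ κ : ℝ × ℝ → ℝ, tsupport κ ⊆ strip → ∀ z, z ∉ strip →
      κ z = 0 ∧ fderiv ℝ κ z v = 0 := by
    intro κ h z hz
    have h1 : z ∉ tsupport κ := fun h' => hz (h h')
    refine ⟨image_eq_zero_of_notMem_tsupport h1, ?_⟩
    exact image_eq_zero_of_notMem_tsupport (f := fun x => fderiv ℝ κ x v)
      fun h' => h1 (tsupport_fderiv_apply_subset ℝ v h')
  rw [setIntegral_eq_integral_of_forall_compl_eq_zero, setIntegral_eq_integral_of_forall_compl_eq_zero]
  · have key : ∀ κ ρ : ℝ × ℝ → ℝ, Continuous κ → Continuous ρ →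
        (HasCompactSupport κ ∨ HasCompactSupport ρ) → Integrable fun z => κ z * ρ z := by
      intro κ ρ h1 h2 h3
      refine (h1.mul h2).integrable_of_hasCompactSupport ?_
      rcases h3 with h3 | h3
      · exact h3.mul_right
      · exact h3.mul_left
    refine integral_mul_fderiv_eq_neg_fderiv_mul_of_integrable (μ := volume) ?_ ?_ ?_
      (fun x _ => hη.differentiable (by simp) x) (fun x _ => hθ.differentiable (by simp) x)
    · exact key _ _ cη.continuous hθ.continuous (hc.imp (fun h => h.fderiv_apply ℝ v) id)
    · exact key _ _ hη.continuous cθ.continuous (hc.imp id (fun h => h.fderiv_apply ℝ v))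
    · exact key _ _ hη.continuous hθ.continuous hc
  · intro z hz
    rcases hs with hs | hs
    · rw [(zero_of _ hs z hz).2, zero_mul]
    · rw [(zero_of _ hs z hz).1, mul_zero]
  · intro z hz
    rcases hs with hs | hs
    · rw [(zero_of _ hs z hz).1, zero_mul]
    · rw [(zero_of _ hs z hz).2, mul_zero]

theorem integrable_of_compact {η : ℝ × ℝ → ℝ} (h : Continuous η) (hc : HasCompactSupport η) :
    Integrable η μΩ := h.integrable_of_hasCompactSupport hc

theorem memLp_of_compact {η : ℝ × ℝ → ℝ} (h : Continuous η) (hc : HasCompactSupport η) :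
    MemLp η 2 μΩ := h.memLp_of_hasCompactSupport hc

theorem isWeakDeriv_pd₁ {η : ℝ × ℝ → ℝ} (h : ContDiff ℝ ∞ η) : IsWeakDeriv 1 0 η (pd₁ η) := by
  refine ⟨locallyIntegrableOn_of_locallyIntegrable h.continuous.locallyIntegrable,
    locallyIntegrableOn_of_locallyIntegrable (contDiff_pd₁ h).continuous.locallyIntegrable,
    fun θ hθ => ?_⟩
  have := integral_mul_fderiv_comm h hθ.1 (Or.inr hθ.2.1) (Or.inr hθ.2.2) (1, 0)
  simpa using! this

theorem isWeakDeriv_pd₂ {η : ℝ × ℝ → ℝ} (h : ContDiff ℝ ∞ η) : IsWeakDeriv 0 1 η (pd₂ η) := by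
  refine ⟨locallyIntegrableOn_of_locallyIntegrable h.continuous.locallyIntegrable,
    locallyIntegrableOn_of_locallyIntegrable (contDiff_pd₂ h).continuous.locallyIntegrable,
    fun θ hθ => ?_⟩
  have := integral_mul_fderiv_comm h hθ.1 (Or.inr hθ.2.1) (Or.inr hθ.2.2) (0, 1)
  simpa using! this

theorem IsTest.vanishesOnBoundary {η : ℝ × ℝ → ℝ} (h : IsTest η) : VanishesOnBoundary η := by
  refine (vanishesOnBoundary_of (g := StripBoussinesq.pd₂ η) h.1.continuous.locallyIntegrable
    (contDiff_pd₂ h.1).continuous.locallyIntegrable fun θ hθ _ => ?_).2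
  exact integral_mul_fderiv_comm h.1 hθ (Or.inl h.2.1) (Or.inl h.2.2) (0, 1)

end

section

open Topology Complex

/-! ### Weak derivatives of synthesized functions -/

theorem integral_synth_mul (c : Bool) {F : ℝ × ℕ → ℂ} (hF : MemLp F 2 μF) {η : ℝ × ℝ → ℝ}
    (h1 : Integrable η μΩ) (h2 : MemLp η 2 μΩ) :
    ∫ z, synth c (hF.toLp F) z * η z ∂μΩ =
      (∫ ζ, (starRingEnd ℂ) (rcoeff c η ζ) * F ζ ∂μF).re := by
  rw [integral_adjoint_mul c _ h1 h2]
  congr 1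
  exact integral_congr_ae (by filter_upwards [hF.coeFn_toLp] with ζ hζ; rw [hζ]; rfl)

theorem locallyIntegrable_L2Ω (f : L2Ω) : LocallyIntegrable f μΩ :=
  (Lp.memLp f).locallyIntegrable (by norm_num)

/-- Differentiating the test function multiplies its coefficients by `ip`; conjugation in the
pairing provides the minus sign. -/
theorem isWeakDeriv_synth_fst (c : Bool) {F G : ℝ × ℕ → ℂ} (hF : MemLp F 2 μF)
    (hG : MemLp G 2 μF) (h : ∀ ζ, G ζ = I * waveX ζ * F ζ) :
    IsWeakDeriv 1 0 (synth c (hF.toLp F)) (synth c (hG.toLp G)) := by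
  refine ⟨locallyIntegrableOn_of_locallyIntegrable (locallyIntegrable_L2Ω _),
    locallyIntegrableOn_of_locallyIntegrable (locallyIntegrable_L2Ω _), fun η hη => ?_⟩
  have c0 := hη.1.continuous
  have c1 := (contDiff_pd₁ hη.1).continuous
  have s1 := hasCompactSupport_pd₁ hη.2.1
  simp only [Function.iterate_one, Function.iterate_zero, id, add_zero, pow_one, neg_mul, one_mul]
  rw [integral_synth_mul c hF (integrable_of_compact c1 s1) (memLp_of_compact c1 s1),
    integral_synth_mul c hG (integrable_of_compact c0 hη.2.1) (memLp_of_compact c0 hη.2.1),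
    ← Complex.neg_re, ← integral_neg]
  congr 2; funext ζ
  rw [rcoeff_deriv_fst c (integrable_of_compact c0 hη.2.1) (integrable_of_compact c1 s1)
    (isWeakDeriv_pd₁ hη.1), h, map_mul, map_mul, conj_I, conj_ofReal]
  ring

/-- The sine coefficients of `∂₂η` are computed without any condition on `η` at the boundary, so the
identity holds for all test functions of the trace and the trace of the series is zero. -/
theorem synth_sine_snd {F G : ℝ × ℕ → ℂ} (hF : MemLp F 2 μF)
    (hG : MemLp G 2 μF) (h : ∀ ζ, G ζ = waveY ζ.2 * F ζ) :
    IsWeakDeriv 0 1 (synth false (hF.toLp F)) (synth true (hG.toLp G)) ∧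
      VanishesOnBoundary (synth false (hF.toLp F)) := by
  refine vanishesOnBoundary_of (locallyIntegrable_L2Ω _) (locallyIntegrable_L2Ω _)
    fun η hη hc => ?_
  have c0 := hη.continuous
  have c1 := (contDiff_pd₂ hη).continuous
  have s1 := hasCompactSupport_pd₂ hc
  rw [integral_synth_mul false hF (integrable_of_compact c1 s1) (memLp_of_compact c1 s1),
    integral_synth_mul true hG (integrable_of_compact c0 hc) (memLp_of_compact c0 hc),
    ← Complex.neg_re, ← integral_neg]
  congr 2; funext ζ
  rw [rcoeff_sine_deriv_snd (integrable_of_compact c0 hc) (integrable_of_compact c1 s1)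
    (isWeakDeriv_pd₂ hη), h, map_mul, map_neg, conj_ofReal]
  ring

/-- Now the cosine coefficients of `∂₂η` are needed, and `η` must vanish on the boundary: a cosine
series has a derivative but no vanishing trace. -/
theorem isWeakDeriv_synth_cosine_snd {F G : ℝ × ℕ → ℂ} (hF : MemLp F 2 μF)
    (hG : MemLp G 2 μF) (h : ∀ ζ, G ζ = -waveY ζ.2 * F ζ) :
    IsWeakDeriv 0 1 (synth true (hF.toLp F)) (synth false (hG.toLp G)) := by
  refine ⟨locallyIntegrableOn_of_locallyIntegrable (locallyIntegrable_L2Ω _),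
    locallyIntegrableOn_of_locallyIntegrable (locallyIntegrable_L2Ω _), fun η hη => ?_⟩
  have c0 := hη.1.continuous
  have c1 := (contDiff_pd₂ hη.1).continuous
  have s1 := hasCompactSupport_pd₂ hη.2.1
  simp only [Function.iterate_one, Function.iterate_zero, id, zero_add, pow_one, neg_mul, one_mul]
  rw [integral_synth_mul true hF (integrable_of_compact c1 s1) (memLp_of_compact c1 s1),
    integral_synth_mul false hG (integrable_of_compact c0 hη.2.1) (memLp_of_compact c0 hη.2.1),
    ← Complex.neg_re, ← integral_neg]
  congr 2; funext ζ
  rw [rcoeff_cosine_deriv_snd (integrable_of_compact c0 hη.2.1) (integrable_of_compact c1 s1)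
    (isWeakDeriv_pd₂ hη.1) hη.vanishesOnBoundary, h, map_mul, conj_ofReal]
  ring

/-- The uniform norm of a synthesized function is controlled by the `L¹` norm of its transform. -/
theorem eLpNorm_top_synth_le (c : Bool) {F : ℝ × ℕ → ℂ} (hF : MemLp F 2 μF)
    (hi : Integrable F μF) :
    eLpNorm (synth c (hF.toLp F)) ⊤ μΩ ≤ ENNReal.ofReal (√2 * ∫ ζ, ‖F ζ‖ ∂μF) := by
  set f : L2Ω := synth c (hF.toLp F) with hf
  set M : ℝ := √2 * ∫ ζ, ‖F ζ‖ ∂μF with hM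
  -- Pairing with indicators bounds the averages of `f` over all sets of finite measure by `M`, and
  -- this forces `|f| ≤ M` almost everywhere.
  have hset : ∀ A, MeasurableSet A → μΩ A < ⊤ → |∫ z in A, f z ∂μΩ| ≤ M * (μΩ A).toReal := by
    intro A hA hAf
    set η : ℝ × ℝ → ℝ := A.indicator fun _ => 1 with hη
    have h1 : Integrable η μΩ := (integrable_indicator_iff hA).2 (integrableOn_const hAf.ne)
    have h2 : MemLp η 2 μΩ := memLp_indicator_const 2 hA 1 (Or.inr hAf.ne)
    have e1 : ∫ z in A, f z ∂μΩ = ∫ z, f z * η z ∂μΩ := by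
      rw [← integral_indicator hA]
      congr 1; funext z
      by_cases hz : z ∈ A <;> simp [hη, hz]
    have hn : ∫ z, ‖(η z : ℂ)‖ ∂μΩ = (μΩ A).toReal := by
      have : ∀ z, ‖(η z : ℂ)‖ = A.indicator (fun _ => (1 : ℝ)) z := by
        intro z
        by_cases hz : z ∈ A <;> simp [hη, hz]
      simp_rw [this]
      rw [integral_indicator hA]; simp [Measure.real]
    rw [e1, hf, integral_synth_mul c hF h1 h2]
    refine (Complex.abs_re_le_norm _).trans ?_
    have e2 : M * (μΩ A).toReal = ∫ ζ, √2 * (μΩ A).toReal * ‖F ζ‖ ∂μF := by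
      rw [integral_const_mul, hM]; ring
    rw [e2]
    refine norm_integral_le_of_norm_le (hi.norm.const_mul _) (Eventually.of_forall fun ζ => ?_)
    rw [norm_mul, RCLike.norm_conj]
    gcongr
    rw [← hn]
    exact norm_coeff_le c h1.ofReal ζ
  have hfi : ∀ A, MeasurableSet A → μΩ A < ⊤ → IntegrableOn f A μΩ := fun A _ hAf =>
    haveI : IsFiniteMeasure (μΩ.restrict A) := ⟨by simpa using hAf⟩
    ((Lp.memLp f).restrict A).integrable (by norm_num)
  have hc : ∀ A, μΩ A < ⊤ → IntegrableOn (fun _ : ℝ × ℝ => M) A μΩ := fun A hAf =>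
    integrableOn_const hAf.ne
  have up : 0 ≤ᵐ[μΩ] fun z => M - f z := by
    refine ae_nonneg_of_forall_setIntegral_nonneg_of_sigmaFinite
      (fun A hA hAf => (hc A hAf).sub (hfi A hA hAf)) fun A hA hAf => ?_
    rw [integral_sub (hc A hAf) (hfi A hA hAf), setIntegral_const, smul_eq_mul, Measure.real]
    have := (abs_le.1 (hset A hA hAf)).2
    linarith [mul_comm M (μΩ A).toReal]
  have lo : 0 ≤ᵐ[μΩ] fun z => M + f z := by
    refine ae_nonneg_of_forall_setIntegral_nonneg_of_sigmaFinite
      (fun A hA hAf => (hc A hAf).add (hfi A hA hAf)) fun A hA hAf => ?_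
    rw [integral_add (hc A hAf) (hfi A hA hAf), setIntegral_const, smul_eq_mul, Measure.real]
    have := (abs_le.1 (hset A hA hAf)).1
    linarith [mul_comm M (μΩ A).toReal]
  rw [eLpNorm_exponent_top]
  refine eLpNormEssSup_le_of_ae_bound ?_
  filter_upwards [up, lo] with z h1 h2
  simp only [Pi.zero_apply] at h1 h2
  rw [Real.norm_eq_abs, abs_le]
  constructor <;> linarith

/-- Norm of a synthesized function. -/
theorem eLpNorm_synth_le (c : Bool) {F : ℝ × ℕ → ℂ} (hF : MemLp F 2 μF) :
    eLpNorm (synth c (hF.toLp F)) 2 μΩ ≤ eLpNorm F 2 μF := by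
  have h := norm_synth_le c (hF.toLp F)
  rw [Lp.norm_def, Lp.norm_toLp] at h
  exact (ENNReal.toReal_le_toReal (Lp.eLpNorm_ne_top _) hF.2.ne).1 h

end

section

open Topology Complex FourierTransform SchwartzMap

/-! ### Transforms of weak derivatives in `L²` -/

theorem integral_cos_int_mul_pi {k : ℤ} (hk : k ≠ 0) :
    ∫ y in (0 : ℝ)..1, Real.cos (k * Real.pi * y) = 0 := by
  have h : (k : ℝ) * Real.pi ≠ 0 := mul_ne_zero (by exact_mod_cast hk) Real.pi_ne_zero
  rw [intervalIntegral.integral_comp_mul_left _ h]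
  simp [Real.sin_int_mul_pi]

theorem integral_profile_mul_profile (n m : ℕ) :
    ∫ y in Ioo (0 : ℝ) 1, profile false n y * profile false m y = if n = m then 1 else 0 := by
  have e : ∀ y : ℝ, profile false n y * profile false m y =
      Real.cos ((n - m : ℤ) * Real.pi * y) - Real.cos ((n + m + 2 : ℤ) * Real.pi * y) := by
    intro y
    simp only [profile, Bool.false_eq_true, if_false, waveY]
    have h2 : √2 * √2 = 2 := Real.mul_self_sqrt (by norm_num)
    push_cast
    have e1 : ((n : ℝ) - m) * Real.pi * y = (n + 1) * Real.pi * y - (m + 1) * Real.pi * y := by ring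
    have e2 : ((n : ℝ) + m + 2) * Real.pi * y = (n + 1) * Real.pi * y + (m + 1) * Real.pi * y := by
      ring
    rw [e1, e2, Real.cos_sub, Real.cos_add]
    linear_combination (Real.sin ((n + 1) * Real.pi * y) * Real.sin ((m + 1) * Real.pi * y)) * h2
  simp_rw [e]
  rw [← restrict_Ioc_eq_Ioo, ← intervalIntegral.integral_of_le zero_le_one,
    intervalIntegral.integral_sub
      (Continuous.intervalIntegrable (by fun_prop) _ _)
      (Continuous.intervalIntegrable (by fun_prop) _ _),
    integral_cos_int_mul_pi (k := n + m + 2) (by omega), sub_zero]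
  split_ifs with h
  · simp [h]
  · exact integral_cos_int_mul_pi (by omega)

theorem memLp_schwartz_fst (h : 𝓢(ℝ, ℂ)) (p : ℝ≥0∞) :
    MemLp (fun z : ℝ × ℝ => h z.1) p μΩ := by
  rw [μΩ_eq_prod]
  exact (h.memLp p volume).comp_fst _

theorem integrable_mul_schwartz {f : ℝ × ℝ → ℝ} (hf : MemLp f 2 μΩ) (h : 𝓢(ℝ, ℂ)) :
    Integrable (fun z => (f z : ℂ) * h z.1) μΩ :=
  (hf.ofReal (K := ℂ)).integrable_mul (memLp_schwartz_fst h 2)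

/-- Products of Schwartz functions and sines. -/
def wave (h : 𝓢(ℝ, ℂ)) (n : ℕ) (z : ℝ × ℝ) : ℂ := h z.1 * (profile false n z.2 : ℝ)

theorem memLp_wave (h : 𝓢(ℝ, ℂ)) (n : ℕ) {p : ℝ≥0∞} : MemLp (wave h n) p μΩ := by
  have hb : MemLp (fun z : ℝ × ℝ => ((profile false n z.2 : ℝ) : ℂ)) ⊤ μΩ := by
    refine memLp_top_of_bound ?_ (√2) (Eventually.of_forall fun z => ?_)
    · exact (Complex.continuous_ofReal.comp
        ((contDiff_profile false n).continuous.comp continuous_snd)).aestronglyMeasurable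
    · rw [Complex.norm_real]; exact abs_profile_le _ _ _
  exact hb.mul (memLp_schwartz_fst h p)

theorem coeff_wave (h : 𝓢(ℝ, ℂ)) (n : ℕ) (ξ : ℝ) (m : ℕ) :
    coeff false (wave h n) (ξ, m) = if n = m then 𝓕 (h : ℝ → ℂ) ξ else 0 := by
  have hi : Integrable (wave h n) μΩ := memLp_one_iff_integrable.1 (memLp_wave h n)
  rw [coeff_eq_fourier false hi]
  have e : slice false (wave h n) m = fun x => (if n = m then (1 : ℂ) else 0) * h x := by
    funext x
    have h1 : ∀ y, wave h n (x, y) * (profile false m y : ℝ) =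
        h x * ((profile false n y * profile false m y : ℝ) : ℂ) := fun y => by
      simp only [wave]; push_cast; ring
    simp only [slice, h1]
    have h2 := integral_ofReal (𝕜 := ℂ) (μ := volume.restrict (Ioo (0 : ℝ) 1))
      (f := fun y => profile false n y * profile false m y)
    rw [integral_profile_mul_profile] at h2
    rw [integral_const_mul]
    refine (congrArg (fun t => h x * t) h2).trans ?_
    split_ifs <;> simp
  rw [e]
  split_ifs with hnm
  · simp
  · simp only [zero_mul]
    rw [Real.fourier_real_eq_integral_exp_smul]
    simp

/-- Polarised Plancherel. For a merely square integrable `f` the coefficients are not given by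
integrals, and pairing with waves replaces evaluation at a frequency. -/
theorem integral_mul_wave (f : L2Ω) (h : 𝓢(ℝ, ℂ)) (n : ℕ) :
    ∫ z, (f z : ℂ) * (h z.1 * (profile false n z.2 : ℝ)) ∂μΩ =
      ∫ ξ, (starRingEnd ℂ) (transform false (toComplex f) (ξ, n)) * (𝓕 h) ξ := by
  have hm : MemLp (wave h n) 2 μΩ := memLp_wave h n
  have hi : Integrable (wave h n) μΩ := memLp_one_iff_integrable.1 (memLp_wave h n)
  have e1 := inner_transform_sine (toComplex f) (hm.toLp _)
  rw [transform_of_integrable false hi hm] at e1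
  have e2 : inner ℂ (toComplex f) (hm.toLp _) =
      ∫ z, (f z : ℂ) * (h z.1 * (profile false n z.2 : ℝ)) ∂μΩ := by
    rw [L2.inner_def]
    refine integral_congr_ae ?_
    filter_upwards [coeFn_toComplex f, hm.coeFn_toLp] with z h1 h2
    rw [h1, h2]
    simp [wave]; ring
  rw [← e2, ← e1, L2.inner_def]
  set U := transform false (toComplex f) with hU
  have h_integral : Integrable (fun ζ => (starRingEnd ℂ) (U ζ) * coeff false (wave h n) ζ) μF := by
    have := L2.integrable_inner (𝕜 := ℂ) U ((memLp_coeff false hi hm).toLp _)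
    refine this.congr ?_
    filter_upwards [(memLp_coeff false hi hm).coeFn_toLp] with ζ hζ
    rw [hζ]; simp [mul_comm]
  have e3 : ∫ ζ, inner ℂ (U ζ) (((memLp_coeff false hi hm).toLp (coeff false (wave h n))) ζ) ∂μF =
      ∫ ζ, (starRingEnd ℂ) (U ζ) * coeff false (wave h n) ζ ∂μF := by
    refine integral_congr_ae ?_
    filter_upwards [(memLp_coeff false hi hm).coeFn_toLp] with ζ hζ
    rw [hζ]; simp [mul_comm]
  rw [e3, integral_prod_symm _ h_integral]
  -- Orthonormality of the sines leaves only the `n`-th term of the sum.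
  rw [← setIntegral_eq_integral_of_forall_compl_eq_zero (s := {n})]
  · rw [integral_singleton]
    simp only [Measure.real, Measure.count_singleton, ENNReal.toReal_one, one_smul]
    congr 1; funext ξ
    rw [coeff_wave, if_pos rfl]; rfl
  · intro m hm'
    have : n ≠ m := fun h => hm' (by simp [h])
    simp [coeff_wave, this]

theorem ae_freq_of_forall {P : ℝ × ℕ → Prop} (h : ∀ n, ∀ᵐ ξ : ℝ, P (ξ, n)) : ∀ᵐ ζ ∂μF, P ζ := by
  rw [ae_iff]
  refine measure_mono_null (t := ⋃ n : ℕ, {ξ | ¬ P (ξ, n)} ×ˢ {n}) ?_ ?_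
  · intro ζ hζ
    exact mem_iUnion.2 ⟨ζ.2, hζ, rfl⟩
  · rw [measure_iUnion_null_iff]
    intro n
    rw [Measure.prod_prod, ae_iff.1 (h n), zero_mul]

theorem locallyIntegrable_freq_slice (F : L2F) (n : ℕ) :
    LocallyIntegrable (fun ξ => F (ξ, n)) := by
  have hm : ∀ n, AEStronglyMeasurable (fun ξ : ℝ => F (ξ, n)) volume := fun n =>
    ((Lp.stronglyMeasurable F).comp_measurable measurable_prodMk_right).aestronglyMeasurable
  have h := (memLp_two_iff_integrable_sq_norm (Lp.memLp F).1).1 (Lp.memLp F)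
  have h2 := Measure.ae_count_iff.1 h.prod_left_ae n
  exact ((memLp_two_iff_integrable_sq_norm (hm n)).2 h2).locallyIntegrable (by norm_num)

/-- Multipliers are detected by pairing with waves. -/
theorem ae_eq_mul_of_wave {f g : L2Ω} {m : ℝ × ℕ → ℂ} (hm : ∀ n, Continuous fun ξ => m (ξ, n))
    (h : ∀ (n : ℕ) (k : 𝓢(ℝ, ℂ)),
      ∫ ξ, (starRingEnd ℂ) (transform false (toComplex g) (ξ, n)) * (𝓕 k) ξ =
      ∫ ξ, (starRingEnd ℂ) (m (ξ, n) * transform false (toComplex f) (ξ, n)) * (𝓕 k) ξ) :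
    ∀ᵐ ζ ∂μF, transform false (toComplex g) ζ = m ζ * transform false (toComplex f) ζ := by
  refine ae_freq_of_forall fun n => ?_
  have l1 := locallyIntegrable_freq_slice (transform false (toComplex g)) n
  have l2 : LocallyIntegrable fun ξ => m (ξ, n) * transform false (toComplex f) (ξ, n) :=
    (locallyIntegrable_freq_slice (transform false (toComplex f)) n).continuous_mul (hm n)
  have conjLI : ∀ F : ℝ → ℂ, LocallyIntegrable F → LocallyIntegrable fun ξ => (starRingEnd ℂ) (F ξ) := by
    intro F hF x
    obtain ⟨s, hs, hi⟩ := hF x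
    exact ⟨s, hs, (Complex.conjLIE.toContinuousLinearEquiv.toContinuousLinearMap).integrable_comp hi⟩
  have key := ae_eq_of_integral_contDiff_smul_eq (conjLI _ l1) (conjLI _ l2) (fun g hg hgc => by
    have hg' : ContDiff ℝ ∞ (fun x => (g x : ℂ)) := Complex.ofRealCLM.contDiff.comp hg
    have hgc' : HasCompactSupport (fun x => (g x : ℂ)) :=
      hgc.comp_left (g := ((↑) : ℝ → ℂ)) Complex.ofReal_zero
    set G : 𝓢(ℝ, ℂ) := hgc'.toSchwartzMap hg' with hG
    -- Choosing `k` as an inverse transform makes `𝓕 k` an arbitrary smooth function of compact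
    -- support.
    have hGv : ∀ x, (𝓕 (𝓕⁻ G)) x = ((g x : ℝ) : ℂ) := fun x => by
      rw [FourierTransform.fourier_fourierInv_eq]; rfl
    have := h n (𝓕⁻ G)
    simp only [hGv] at this
    simpa only [Complex.real_smul, mul_comm] using this)
  filter_upwards [key] with ξ hξ
  exact (starRingEnd ℂ).injective hξ

theorem continuous_I_mul_waveX (n : ℕ) : Continuous fun ξ => (I * waveX (ξ, n) : ℂ) := by
  unfold waveX; fun_prop

/-- Integration by parts moves the derivative onto the Schwartz factor of the wave, where it becomes
multiplication by `2πiξ`. -/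
theorem transform_deriv_fst {f g : L2Ω} (h : IsWeakDeriv 1 0 f g) :
    ∀ᵐ ζ ∂μF, transform false (toComplex g) ζ =
      I * waveX ζ * transform false (toComplex f) ζ := by
  refine ae_eq_mul_of_wave (m := fun ζ => I * waveX ζ) continuous_I_mul_waveX fun n k => ?_
  have hk : ContDiff ℝ ∞ k := k.smooth ⊤
  set k' : 𝓢(ℝ, ℂ) := SchwartzMap.derivCLM ℂ ℂ k with hk'
  have hd : ∀ x, k' x = deriv k x := fun x => rfl
  have e := h.integral_fst hk (contDiff_profile false n)
    (integrable_mul_schwartz (Lp.memLp f) k) (integrable_mul_schwartz (Lp.memLp f) k')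
    (integrable_mul_schwartz (Lp.memLp g) k)
  simp only [← hd] at e
  rw [integral_mul_wave, integral_mul_wave] at e
  rw [eq_comm, neg_eq_iff_eq_neg] at e
  rw [e, ← integral_neg]
  congr 1; funext ξ
  have hF : (𝓕 k') ξ = (2 * Real.pi * I * ξ) * (𝓕 k) ξ := by
    have := congrFun (Real.fourier_deriv k.integrable k.differentiable k'.integrable) ξ
    exact this
  rw [hF, map_mul, map_mul, conj_I, conj_ofReal, waveX]
  push_cast
  ring

/-- Two integrations by parts, from sine to cosine and back. The sine removes the first boundary
term and the trace of `f` the second, so nothing is required of the trace of `∂₂f`. -/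
theorem transform_deriv_snd {f g : L2Ω} {f₁ : ℝ × ℝ → ℝ} (hf₁ : MemLp f₁ 2 μΩ)
    (h₁ : IsWeakDeriv 0 1 f f₁) (h₂ : IsWeakDeriv 0 1 f₁ g) (hv : VanishesOnBoundary f) :
    ∀ᵐ ζ ∂μF, transform false (toComplex g) ζ =
      -(waveY ζ.2 : ℂ) ^ 2 * transform false (toComplex f) ζ := by
  refine ae_eq_mul_of_wave (m := fun ζ => -(waveY ζ.2 : ℂ) ^ 2) (fun n => by
    simpa using continuous_const)
    fun n k => ?_
  have hk : ContDiff ℝ ∞ k := k.smooth ⊤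
  have e1 := h₂.integral_snd hk (contDiff_profile false n)
    (Or.inr ⟨profile_sine_zero n, profile_sine_one n⟩)
    (integrable_mul_schwartz hf₁ k) (integrable_mul_schwartz (Lp.memLp g) k)
  have e2 := h₁.integral_snd hk (contDiff_profile true n) (Or.inl hv)
    (integrable_mul_schwartz (Lp.memLp f) k) (integrable_mul_schwartz hf₁ k)
  simp only [deriv_profile_sine] at e1
  simp only [deriv_profile_cosine] at e2
  have e3 : ∫ z, (f₁ z : ℂ) * (k z.1 * ((waveY n * profile true n z.2 : ℝ) : ℂ)) ∂μΩ =
      waveY n * ∫ z, (f₁ z : ℂ) * (k z.1 * (profile true n z.2 : ℝ)) ∂μΩ := by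
    rw [← integral_const_mul]; congr 1; funext z; push_cast; ring
  have e4 : ∫ z, (f z : ℂ) * (k z.1 * ((-waveY n * profile false n z.2 : ℝ) : ℂ)) ∂μΩ =
      -waveY n * ∫ z, (f z : ℂ) * (k z.1 * (profile false n z.2 : ℝ)) ∂μΩ := by
    rw [← integral_const_mul]; congr 1; funext z; push_cast; ring
  rw [e3] at e1
  rw [e4] at e2
  rw [integral_mul_wave] at e1 e2
  have e5 : ∫ ξ, (starRingEnd ℂ) (-(waveY n : ℂ) ^ 2 * transform false (toComplex f) (ξ, n)) *
      (𝓕 k) ξ = -(waveY n : ℂ) ^ 2 *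
        ∫ ξ, (starRingEnd ℂ) (transform false (toComplex f) (ξ, n)) * (𝓕 k) ξ := by
    rw [← integral_const_mul]; congr 1; funext ξ
    rw [map_mul, map_neg, map_pow, conj_ofReal]; ring
  simp only [] at e5 ⊢
  rw [e5]
  linear_combination e1 - (waveY n : ℂ) * e2

end

section

open Topology

/-! ### The mode equations -/

/-- Solutions of the system `q' = -νlq + pφ`, `φ' = -(p/l)q` of a single mode. -/
structure IsModeSolution (ν p l : ℝ) (q φ : ℝ → ℝ) : Prop where
  deriv_fst : ∀ t, HasDerivAt q (-(ν * l) * q t + p * φ t) t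
  deriv_φ : ∀ t, HasDerivAt φ (-(p / l) * q t) t

/-- The slow decay constant. -/
def slowConst (ν : ℝ) : ℝ := min (1 / (2 * ν)) (min (ν / 4) (1 / 2))

theorem slowConst_pos {ν : ℝ} (hν : 0 < ν) : 0 < slowConst ν := by
  unfold slowConst; positivity

/-- The three conditions under which the cross term is a perturbation: the first two let the
dissipation of `q` absorb the terms in `q²` that it creates, the third keeps the modified energy
comparable to the energy. -/
theorem slowConst_le {ν : ℝ} (hν : 0 < ν) :
    slowConst ν * ν ^ 2 ≤ ν / 2 ∧ slowConst ν ≤ ν / 4 ∧ slowConst ν ≤ 1 / 2 := by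
  refine ⟨?_, (min_le_right _ _).trans (min_le_left _ _), (min_le_right _ _).trans (min_le_right _ _)⟩
  calc slowConst ν * ν ^ 2 ≤ 1 / (2 * ν) * ν ^ 2 := by
        gcongr; exact min_le_left _ _
    _ = ν / 2 := by field_simp

/-- The slow decay rate of a mode. -/
def slowRate (ν p l : ℝ) : ℝ := slowConst ν / 4 * (p ^ 2 / l ^ 2)

theorem monotone_barrier {D D' : ℝ → ℝ} (hD : ∀ t, HasDerivAt D (D' t) t) (h : ∀ t, 0 ≤ t → 0 ≤ D' t)
    {t : ℝ} (ht : 0 ≤ t) : D 0 ≤ D t := by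
  have : MonotoneOn D (Ici 0) := by
    refine monotoneOn_of_deriv_nonneg (convex_Ici 0)
      (fun t _ => (hD t).continuousAt.continuousWithinAt)
      (fun t _ => (hD t).differentiableAt.differentiableWithinAt) fun t ht => ?_
    rw [(hD t).deriv]
    rw [interior_Ici] at ht
    exact h t (le_of_lt ht)
  exact this (by simp) ht ht

/-- Differentiate `exp(at) q` and compare with the primitive `U` of the bound for the forcing. The
condition `2b ≤ a` gives `a - b ≥ a/2`, whence the factors `2/a`. Two exponentials are allowed
because the equation for `q'` has a forcing with a fast and a slow part. -/
theorem duhamel_bound {a b₁ b₂ B₁ B₂ : ℝ} {q g : ℝ → ℝ} (ha : 0 < a) (h1 : 2 * b₁ ≤ a)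
    (h2 : 2 * b₂ ≤ a) (hB₁ : 0 ≤ B₁) (hB₂ : 0 ≤ B₂)
    (hq : ∀ t, HasDerivAt q (-a * q t + g t) t)
    (hg : ∀ t, 0 ≤ t → |g t| ≤ B₁ * Real.exp (-b₁ * t) + B₂ * Real.exp (-b₂ * t))
    {t : ℝ} (ht : 0 ≤ t) :
    |q t| ≤ Real.exp (-a * t) * |q 0| + 2 * B₁ / a * Real.exp (-b₁ * t) +
      2 * B₂ / a * Real.exp (-b₂ * t) := by
  set U : ℝ → ℝ := fun t => |q 0| + 2 * B₁ / a * Real.exp ((a - b₁) * t) +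
    2 * B₂ / a * Real.exp ((a - b₂) * t) with hU
  have dexp : ∀ c t : ℝ, HasDerivAt (fun t => Real.exp (c * t)) (c * Real.exp (c * t)) t := by
    intro c t
    have := ((hasDerivAt_id t).const_mul c).exp
    simpa [mul_comm] using this
  have dU : ∀ t, HasDerivAt U (2 * B₁ / a * ((a - b₁) * Real.exp ((a - b₁) * t)) +
      2 * B₂ / a * ((a - b₂) * Real.exp ((a - b₂) * t))) t := fun t =>
    (((dexp (a - b₁) t).const_mul (2 * B₁ / a)).const_add _).add
      ((dexp (a - b₂) t).const_mul (2 * B₂ / a))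
  have du : ∀ t, HasDerivAt (fun t => Real.exp (a * t) * q t) (Real.exp (a * t) * g t) t := by
    intro t
    exact ((dexp a t).mul (hq t)).congr_deriv (by ring)
  have hUb : ∀ t, 0 ≤ t → |Real.exp (a * t) * g t| ≤
      2 * B₁ / a * ((a - b₁) * Real.exp ((a - b₁) * t)) +
      2 * B₂ / a * ((a - b₂) * Real.exp ((a - b₂) * t)) := by
    intro t ht
    rw [abs_mul, abs_of_pos (Real.exp_pos _)]
    refine (mul_le_mul_of_nonneg_left (hg t ht) (Real.exp_pos _).le).trans ?_
    have key : ∀ b B : ℝ, 2 * b ≤ a → 0 ≤ B → Real.exp (a * t) * (B * Real.exp (-b * t)) ≤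
        2 * B / a * ((a - b) * Real.exp ((a - b) * t)) := by
      intro b B hb hB
      have e : Real.exp (a * t) * Real.exp (-b * t) = Real.exp ((a - b) * t) := by
        rw [← Real.exp_add]; congr 1; ring
      have : Real.exp (a * t) * (B * Real.exp (-b * t)) = B * Real.exp ((a - b) * t) := by
        rw [← e]; ring
      rw [this]
      have h3 : B ≤ 2 * B / a * (a - b) := by
        rw [div_mul_eq_mul_div, le_div_iff₀ ha]
        nlinarith
      calc B * Real.exp ((a - b) * t) ≤ 2 * B / a * (a - b) * Real.exp ((a - b) * t) := by gcongr
        _ = _ := by ring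
    rw [mul_add]
    exact add_le_add (key _ _ h1 hB₁) (key _ _ h2 hB₂)
  have p1 := monotone_barrier (fun t => (dU t).sub (du t))
    (fun t ht => by have := (abs_le.1 (hUb t ht)).2; linarith) ht
  have p2 := monotone_barrier (fun t => (dU t).add (du t))
    (fun t ht => by have := (abs_le.1 (hUb t ht)).1; linarith) ht
  have q1 : 0 ≤ 2 * B₁ / a := by positivity
  have q2 : 0 ≤ 2 * B₂ / a := by positivity
  simp only [hU, Pi.sub_apply, Pi.add_apply, mul_zero, Real.exp_zero, one_mul, mul_one] at p1 p2
  have hle : |Real.exp (a * t) * q t| ≤ U t := by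
    rw [abs_le]
    constructor
    · have := neg_abs_le (q 0)
      simp only [hU]; linarith
    · have := le_abs_self (q 0)
      simp only [hU]; linarith
  rw [abs_mul, abs_of_pos (Real.exp_pos _)] at hle
  have e0 : Real.exp (-a * t) * Real.exp (a * t) = 1 := by
    rw [← Real.exp_add]; simp
  have e1 : ∀ b, Real.exp (-a * t) * Real.exp ((a - b) * t) = Real.exp (-b * t) := by
    intro b; rw [← Real.exp_add]; congr 1; ring
  calc |q t| = Real.exp (-a * t) * (Real.exp (a * t) * |q t|) := by
        rw [← mul_assoc, e0, one_mul]
    _ ≤ Real.exp (-a * t) * U t := by gcongr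
    _ = Real.exp (-a * t) * |q 0| + 2 * B₁ / a * (Real.exp (-a * t) * Real.exp ((a - b₁) * t)) +
      2 * B₂ / a * (Real.exp (-a * t) * Real.exp ((a - b₂) * t)) := by simp only [hU]; ring
    _ = _ := by rw [e1, e1]

/-! ### Hypocoercive decay of a single mode -/

section mode

variable {ν p l : ℝ} {q φ : ℝ → ℝ}

theorem slowRate_le (hν : 0 < ν) (hl : 1 ≤ l) (hp : p ^ 2 ≤ l) :
    0 ≤ slowRate ν p l ∧ 2 * slowRate ν p l ≤ ν * l ∧ p ^ 2 / l ^ 2 ≤ 1 := by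
  have h0 : (0 : ℝ) < l := by linarith
  have hs : p ^ 2 / l ^ 2 ≤ 1 := by
    rw [div_le_one (by positivity)]; nlinarith
  have hs0 : 0 ≤ p ^ 2 / l ^ 2 := by positivity
  obtain ⟨-, h2, -⟩ := slowConst_le hν
  have h3 := slowConst_pos hν
  refine ⟨by unfold slowRate; positivity, ?_, hs⟩
  unfold slowRate
  nlinarith

-- Hypocoercivity. The derivative of `E = q²/l + φ²` is `-2νq²`, since the coupling is skew, and
-- does not see `φ`. Subtracting `2κ(p/l²)qφ` adds `-2κσφ²` with `σ = p²/l²`, together with errors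
-- that the dissipation of `q` absorbs for small `κ`. The result is `F' ≤ -(κσ/2)F`.
set_option maxHeartbeats 1000000 in
theorem IsModeSolution.lyapunov (h : IsModeSolution ν p l q φ) (hν : 0 < ν) (hl : 1 ≤ l)
    (hp : p ^ 2 ≤ l) {K : ℝ} (hK0 : 0 ≤ K) (hK : q 0 ^ 2 / l + φ 0 ^ 2 ≤ K ^ 2) {t : ℝ}
    (ht : 0 ≤ t) : |φ t| ≤ 2 * K * Real.exp (-slowRate ν p l * t) := by
  have h0 : (0 : ℝ) < l := by linarith
  obtain ⟨k1, k2, k3⟩ := slowConst_le hν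
  have kpos := slowConst_pos hν
  set κ := slowConst ν with hκ
  set σ := p ^ 2 / l ^ 2 with hσ
  have hσ1 : σ ≤ 1 := (slowRate_le hν hl hp).2.2
  have hσ0 : 0 ≤ σ := by positivity
  set E : ℝ → ℝ := fun t => q t ^ 2 / l + φ t ^ 2 with hE
  set F : ℝ → ℝ := fun t => q t ^ 2 / l + φ t ^ 2 - 2 * κ * (p / l ^ 2) * (q t * φ t) with hF
  have cross : ∀ t, |2 * κ * (p / l ^ 2) * (q t * φ t)| ≤ κ * E t := by
    intro t
    have e1 : 2 * κ * (p / l ^ 2) * (q t * φ t) = κ * (2 * (p / l ^ 2 * q t) * φ t) := by ring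
    rw [e1, abs_mul, abs_of_pos kpos]
    gcongr
    have e2 : (p / l ^ 2 * q t) ^ 2 ≤ q t ^ 2 / l := by
      have : (p / l ^ 2 * q t) ^ 2 = σ * (q t ^ 2 / l ^ 2) := by
        simp only [hσ]; field_simp
      rw [this]
      calc σ * (q t ^ 2 / l ^ 2) ≤ 1 * (q t ^ 2 / l ^ 2) := by gcongr
        _ ≤ q t ^ 2 / l := by
          rw [one_mul]; gcongr
          nlinarith
    rw [abs_le]
    simp only [hE]
    constructor <;> nlinarith [sq_nonneg (p / l ^ 2 * q t + φ t), sq_nonneg (p / l ^ 2 * q t - φ t)]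
  have hE0 : ∀ t, 0 ≤ E t := fun t => by simp only [hE]; positivity
  -- The bound `κ ≤ 1/2` keeps the cross term below half of the energy.
  have hFE : ∀ t, F t ≤ 3 / 2 * E t ∧ E t ≤ 2 * F t := by
    intro t
    have h1 := abs_le.1 (cross t)
    have h2 : κ * E t ≤ 1 / 2 * E t := by have := hE0 t; gcongr
    have e : F t = E t - 2 * κ * (p / l ^ 2) * (q t * φ t) := rfl
    constructor <;> linarith
  have dF : ∀ t, HasDerivAt F (2 * q t * (-(ν * l) * q t + p * φ t) / l +
      2 * φ t * (-(p / l) * q t) - 2 * κ * (p / l ^ 2) *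
        ((-(ν * l) * q t + p * φ t) * φ t + q t * (-(p / l) * q t))) t := by
    intro t
    have d1 := ((h.deriv_fst t).pow 2).div_const l
    have d2 := (h.deriv_φ t).pow 2
    have d3 := ((h.deriv_fst t).mul (h.deriv_φ t)).const_mul (2 * κ * (p / l ^ 2))
    refine ((d1.add d2).sub d3).congr_deriv ?_
    simp only [Nat.cast_ofNat, Nat.add_one_sub_one, pow_one]
  have ineq : ∀ t, 2 * q t * (-(ν * l) * q t + p * φ t) / l +
      2 * φ t * (-(p / l) * q t) - 2 * κ * (p / l ^ 2) *
        ((-(ν * l) * q t + p * φ t) * φ t + q t * (-(p / l) * q t)) ≤ -(κ / 2 * σ) * F t := by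
    intro t
    have e : 2 * q t * (-(ν * l) * q t + p * φ t) / l +
      2 * φ t * (-(p / l) * q t) - 2 * κ * (p / l ^ 2) *
        ((-(ν * l) * q t + p * φ t) * φ t + q t * (-(p / l) * q t)) =
        -2 * ν * q t ^ 2 + κ * (2 * (ν * q t) * (p / l * φ t)) - 2 * κ * σ * φ t ^ 2 +
          2 * κ * (σ / l) * q t ^ 2 := by
      simp only [hσ]; field_simp; ring
    rw [e]
    -- Young's inequality, weighted so that the part in `φ²` uses up only half of the gain `2κσφ²`.
    have y : 2 * (ν * q t) * (p / l * φ t) ≤ ν ^ 2 * q t ^ 2 + σ * φ t ^ 2 := by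
      have : σ = (p / l) ^ 2 := by simp only [hσ]; field_simp
      rw [this]; nlinarith [sq_nonneg (ν * q t - p / l * φ t)]
    have y2 := mul_le_mul_of_nonneg_left y kpos.le
    have sl : σ / l ≤ 1 := (div_le_self hσ0 hl).trans hσ1
    have w0 : 0 ≤ q t ^ 2 := sq_nonneg _
    have w1 : κ * (σ / l) * q t ^ 2 ≤ ν / 4 * q t ^ 2 := by
      have : κ * (σ / l) ≤ κ * 1 := by gcongr
      gcongr; linarith
    have w2 : κ * ν ^ 2 * q t ^ 2 ≤ ν / 2 * q t ^ 2 := by gcongr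
    have w3 : κ * σ * E t = κ * (σ / l) * q t ^ 2 + κ * σ * φ t ^ 2 := by
      simp only [hE]; field_simp
    have w4 : κ / 2 * σ * F t ≤ κ * σ * E t := by
      have := (hFE t).1
      have hE0' := hE0 t
      calc κ / 2 * σ * F t ≤ κ / 2 * σ * (3 / 2 * E t) := by gcongr
        _ = 3 / 4 * (κ * σ * E t) := by ring
        _ ≤ 1 * (κ * σ * E t) := by gcongr; norm_num
        _ = _ := one_mul _
    have w5 : 0 ≤ κ * ν ^ 2 := by positivity
    nlinarith
  have dG : ∀ t, HasDerivAt (fun t => -(Real.exp (κ / 2 * σ * t) * F t)) _ t := fun t => by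
    have d1 := ((hasDerivAt_id t).const_mul (κ / 2 * σ)).exp
    exact (d1.mul (dF t)).neg
  have mono := monotone_barrier dG (fun t _ => by
    have := mul_le_mul_of_nonneg_left (ineq t) (Real.exp_pos (κ / 2 * σ * t)).le
    simp only [id, mul_one]
    linarith) ht
  simp only [mul_zero, Real.exp_zero, one_mul, neg_le_neg_iff] at mono
  have hF0 : F 0 ≤ 3 / 2 * K ^ 2 := (hFE 0).1.trans (by gcongr)
  have hEt : Real.exp (κ / 2 * σ * t) * φ t ^ 2 ≤ 3 * K ^ 2 := by
    have h1 : φ t ^ 2 ≤ E t := by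
      simp only [hE]
      have : 0 ≤ q t ^ 2 / l := by positivity
      linarith
    have h2 := (hFE t).2
    calc Real.exp (κ / 2 * σ * t) * φ t ^ 2 ≤ Real.exp (κ / 2 * σ * t) * (2 * F t) := by
          gcongr; linarith
      _ = 2 * (Real.exp (κ / 2 * σ * t) * F t) := by ring
      _ ≤ 3 * K ^ 2 := by linarith
  -- `F` decays at rate `κσ/2` and controls `φ²`, so `φ` decays at half that rate.
  have hr : slowRate ν p l = κ / 4 * σ := rfl
  refine abs_le_of_sq_le_sq ?_ (by positivity)
  have e2 : Real.exp (-slowRate ν p l * t) ^ 2 * Real.exp (κ / 2 * σ * t) = 1 := by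
    rw [← Real.exp_nat_mul, ← Real.exp_add, hr]
    convert Real.exp_zero using 2
    push_cast; ring
  have hx := sq_nonneg (Real.exp (-slowRate ν p l * t))
  calc φ t ^ 2 = Real.exp (-slowRate ν p l * t) ^ 2 * (Real.exp (κ / 2 * σ * t) * φ t ^ 2) := by
        rw [← mul_assoc, e2, one_mul]
    _ ≤ Real.exp (-slowRate ν p l * t) ^ 2 * (3 * K ^ 2) := by gcongr
    _ ≤ (2 * K * Real.exp (-slowRate ν p l * t)) ^ 2 := by nlinarith [sq_nonneg K, mul_nonneg hx (sq_nonneg K)]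

/-- Duhamel with forcing `pφ`. Strong damping makes `q` follow `φ`, so its slow part is smaller by
`|p|/(νl)`. The first exponential of `duhamel_bound` is not needed and is switched off. -/
theorem IsModeSolution.bound_fst (h : IsModeSolution ν p l q φ) (hν : 0 < ν) (hl : 1 ≤ l)
    (hp : p ^ 2 ≤ l) {K : ℝ} (hK0 : 0 ≤ K) (hK : q 0 ^ 2 / l + φ 0 ^ 2 ≤ K ^ 2) {t : ℝ}
    (ht : 0 ≤ t) : |q t| ≤ Real.exp (-(ν * l) * t) * |q 0| +
      4 * |p| * K / (ν * l) * Real.exp (-slowRate ν p l * t) := by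
  have h0 : (0 : ℝ) < l := by linarith
  obtain ⟨-, s2, -⟩ := slowRate_le hν hl hp
  have := duhamel_bound (b₁ := 0) (B₁ := 0) (b₂ := slowRate ν p l) (B₂ := 2 * |p| * K)
    (mul_pos hν h0) (by simp; positivity) s2 le_rfl (by positivity) h.deriv_fst (fun t ht => by
      rw [abs_mul]
      have := mul_le_mul_of_nonneg_left (h.lyapunov hν hl hp hK0 hK ht) (abs_nonneg p)
      linarith) ht
  refine this.trans (le_of_eq ?_)
  ring

/-- The derivative solves the same damped equation with forcing `pφ' = -(p²/l)q`. Inserting the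
bound for `q` gives its slow part two more factors `p`. -/
theorem IsModeSolution.bound_deriv_fst (h : IsModeSolution ν p l q φ) (hν : 0 < ν) (hl : 1 ≤ l)
    (hp : p ^ 2 ≤ l) {K : ℝ} (hK0 : 0 ≤ K) (hK : q 0 ^ 2 / l + φ 0 ^ 2 ≤ K ^ 2) {t : ℝ}
    (ht : 0 ≤ t) : |-(ν * l) * q t + p * φ t| ≤
      Real.exp (-(ν * l) * t) * |-(ν * l) * q 0 + p * φ 0| +
      2 * (p ^ 2 / l * |q 0|) / (ν * l) * Real.exp (-(ν * l / 2) * t) +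
      8 * |p| ^ 3 * K / (ν ^ 2 * l ^ 3) * Real.exp (-slowRate ν p l * t) := by
  have h0 : (0 : ℝ) < l := by linarith
  obtain ⟨-, s2, -⟩ := slowRate_le hν hl hp
  have hd : ∀ t, HasDerivAt (fun t => -(ν * l) * q t + p * φ t)
      (-(ν * l) * (-(ν * l) * q t + p * φ t) + p * (-(p / l) * q t)) t := fun t =>
    ((h.deriv_fst t).const_mul _).add ((h.deriv_φ t).const_mul _)
  -- The fast part of the forcing decays at the damping rate itself, which is resonant; it is
  -- weakened to half that rate, the largest that `duhamel_bound` admits.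
  have := duhamel_bound (b₁ := ν * l / 2) (B₁ := p ^ 2 / l * |q 0|) (b₂ := slowRate ν p l)
    (B₂ := p ^ 2 / l * (4 * |p| * K / (ν * l)))
    (mul_pos hν h0) (by linarith) s2 (by positivity) (by positivity) hd (fun t ht => by
      have e : p * (-(p / l) * q t) = -(p ^ 2 / l * q t) := by ring
      rw [e, abs_neg, abs_mul, abs_of_nonneg (by positivity : 0 ≤ p ^ 2 / l)]
      have b := h.bound_fst hν hl hp hK0 hK ht
      have ex : Real.exp (-(ν * l) * t) ≤ Real.exp (-(ν * l / 2) * t) := by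
        apply Real.exp_le_exp.2
        have : 0 ≤ ν * l * t := by positivity
        linarith
      calc p ^ 2 / l * |q t| ≤ p ^ 2 / l * (Real.exp (-(ν * l / 2) * t) * |q 0| +
            4 * |p| * K / (ν * l) * Real.exp (-slowRate ν p l * t)) := by
            refine mul_le_mul_of_nonneg_left (b.trans ?_) (by positivity)
            gcongr
        _ = _ := by ring) ht
  refine this.trans (le_of_eq ?_)
  congr 1
  have : |p| ^ 3 = p ^ 2 * |p| := by rw [pow_succ, sq_abs]
  rw [this]
  field_simp
  ring

end mode

/-! ### The propagator of a mode -/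

/-- The generator of the mode equations. -/
def modeGen (ν p l : ℝ) : ℝ × ℝ →L[ℝ] ℝ × ℝ :=
  (-(ν * l)) • (ContinuousLinearMap.inl ℝ ℝ ℝ).comp (ContinuousLinearMap.fst ℝ ℝ ℝ) +
    p • (ContinuousLinearMap.inl ℝ ℝ ℝ).comp (ContinuousLinearMap.snd ℝ ℝ ℝ) +
    (-(p / l)) • (ContinuousLinearMap.inr ℝ ℝ ℝ).comp (ContinuousLinearMap.fst ℝ ℝ ℝ)

/-- The propagator of the mode equations. -/
def modeProp (ν p l t : ℝ) : ℝ × ℝ →L[ℝ] ℝ × ℝ := NormedSpace.exp (t • modeGen ν p l)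

theorem modeProp_zero (ν p l : ℝ) (v : ℝ × ℝ) : modeProp ν p l 0 v = v := by
  simp [modeProp]

theorem isModeSolution_modeProp (ν p l : ℝ) (v : ℝ × ℝ) :
    IsModeSolution ν p l (fun t => (modeProp ν p l t v).1) (fun t => (modeProp ν p l t v).2) := by
  have key : ∀ t, HasDerivAt (fun t => modeProp ν p l t v)
      (modeGen ν p l (modeProp ν p l t v)) t := by
    intro t
    have := hasDerivAt_exp_smul_const' (𝕂 := ℝ) (modeGen ν p l) t
    have h2 := this.clm_apply (hasDerivAt_const t v)
    simpa using! h2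
  constructor
  · intro t
    have := (ContinuousLinearMap.fst ℝ ℝ ℝ).hasFDerivAt.comp_hasDerivAt t (key t)
    refine this.congr_deriv ?_
    simp [modeGen]
  · intro t
    have := (ContinuousLinearMap.snd ℝ ℝ ℝ).hasFDerivAt.comp_hasDerivAt t (key t)
    refine this.congr_deriv ?_
    simp [modeGen]

/-- The exponential is continuous in the matrix, so no case distinction on the eigenvalues is needed
to see that the propagator is measurable in the frequency. -/
theorem continuous_modeProp {X : Type*} [TopologicalSpace X] {p l : X → ℝ} (ν t : ℝ)
    (hp : Continuous p) (hl : Continuous l) (h0 : ∀ x, l x ≠ 0) (v : ℝ × ℝ) :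
    Continuous fun x => modeProp ν (p x) (l x) t v := by
  have hg : Continuous fun x => modeGen ν (p x) (l x) := by
    unfold modeGen
    have := hp.div hl h0
    fun_prop
  have h2 : Continuous fun x => modeProp ν (p x) (l x) t := by
    unfold modeProp
    let _ : NormedAlgebra ℚ (ℝ × ℝ →L[ℝ] ℝ × ℝ) := NormedAlgebra.restrictScalars ℚ ℝ _
    exact (NormedSpace.exp_continuous).comp (hg.const_smul t)
  exact h2.clm_apply continuous_const

end

section

open Topology

/-! ### Integrals over the frequencies -/

/-- The length of the wave vector. -/
def freq (ζ : ℝ × ℕ) : ℝ := √(waveX ζ ^ 2 + waveY ζ.2 ^ 2)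

theorem one_le_waveY (n : ℕ) : 1 ≤ waveY n := by
  unfold waveY
  have := Real.pi_gt_three
  have h : (0 : ℝ) ≤ n := n.cast_nonneg
  nlinarith

theorem freq_sq (ζ : ℝ × ℕ) : freq ζ ^ 2 = waveX ζ ^ 2 + waveY ζ.2 ^ 2 :=
  Real.sq_sqrt (by positivity)

theorem abs_waveX_le_freq (ζ : ℝ × ℕ) : |waveX ζ| ≤ freq ζ :=
  Real.abs_le_sqrt (by nlinarith [sq_nonneg (waveY ζ.2)])

theorem waveY_le_freq (ζ : ℝ × ℕ) : waveY ζ.2 ≤ freq ζ :=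
  Real.le_sqrt_of_sq_le (by nlinarith [sq_nonneg (waveX ζ)])

theorem one_le_freq (ζ : ℝ × ℕ) : 1 ≤ freq ζ := (one_le_waveY _).trans (waveY_le_freq ζ)

theorem freq_pos (ζ : ℝ × ℕ) : 0 < freq ζ := one_pos.trans_le (one_le_freq ζ)

theorem one_le_freq_sq (ζ : ℝ × ℕ) : 1 ≤ freq ζ ^ 2 := one_le_pow₀ (one_le_freq ζ)

theorem waveX_sq_le (ζ : ℝ × ℕ) : waveX ζ ^ 2 ≤ freq ζ ^ 2 := by
  rw [freq_sq]; nlinarith [sq_nonneg (waveY ζ.2)]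

theorem continuous_waveX : Continuous waveX := by
  unfold waveX; fun_prop

theorem continuous_freq : Continuous freq := by
  unfold freq
  have h1 := continuous_waveX
  have h2 : Continuous fun ζ : ℝ × ℕ => waveY ζ.2 :=
    (continuous_of_discreteTopology (f := waveY)).comp continuous_snd
  fun_prop

/-- The decay rate of the slow part of a mode. -/
def rate (ν : ℝ) (ζ : ℝ × ℕ) : ℝ := slowRate ν (waveX ζ) (freq ζ ^ 2)

theorem rate_nonneg {ν : ℝ} (hν : 0 < ν) (ζ : ℝ × ℕ) : 0 ≤ rate ν ζ :=
  (slowRate_le hν (one_le_freq_sq ζ) (waveX_sq_le ζ)).1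

theorem rate_le_one {ν : ℝ} (hν : 0 < ν) (ζ : ℝ × ℕ) : rate ν ζ ≤ 1 := by
  have h1 := (slowRate_le hν (one_le_freq_sq ζ) (waveX_sq_le ζ)).2.2
  have h2 := (slowConst_le hν).2.2
  have h3 := slowConst_pos hν
  unfold rate slowRate
  have h4 : 0 ≤ waveX ζ ^ 2 / (freq ζ ^ 2) ^ 2 := by positivity
  nlinarith

theorem continuous_rate (ν : ℝ) : Continuous (rate ν) := by
  unfold rate slowRate
  have h1 := continuous_waveX
  have h2 := continuous_freq
  refine continuous_const.mul ((h1.pow 2).div ((h2.pow 2).pow 2) fun ζ => ?_)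
  have := freq_pos ζ
  positivity

theorem one_le_bracket (t : ℝ) : 1 ≤ bracket t := le_max_left _ _

theorem bracket_pos (t : ℝ) : 0 < bracket t := one_pos.trans_le (one_le_bracket t)

/-- The slow rate never exceeds one, so replacing `t` by `max 1 t` costs at most a factor `e`; small
and large times can then be treated together. -/
theorem exp_rate_le {ν : ℝ} (hν : 0 < ν) (ζ : ℝ × ℕ) {t : ℝ} (ht : 0 ≤ t) :
    Real.exp (-rate ν ζ * t) ≤ Real.exp 1 * Real.exp (-rate ν ζ * bracket t) := by
  rw [← Real.exp_add]
  apply Real.exp_le_exp.2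
  have h1 := rate_nonneg hν ζ
  have h2 := rate_le_one hν ζ
  have h3 : bracket t ≤ 1 + t := max_le (by linarith) (by linarith)
  nlinarith

/-- The Gaussian absorbs every power. The additional factor `1 + s²` is kept in order to leave an
integrable weight behind. -/
theorem pow_mul_exp_neg_le (j : ℕ) {c : ℝ} (hc : 0 < c) {s : ℝ} (hs : 0 ≤ s) :
    s ^ j * (1 + s ^ 2) * Real.exp (-(c * s ^ 2)) ≤
      (j + 1).factorial * Real.exp c / c ^ (j + 1) := by
  have h1 : (c * (1 + s ^ 2)) ^ (j + 1) / (j + 1).factorial ≤ Real.exp (c * (1 + s ^ 2)) :=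
    Real.pow_div_factorial_le_exp _ (by positivity) _
  have h2 : s ^ j * (1 + s ^ 2) ≤ (1 + s ^ 2) ^ (j + 1) := by
    rw [pow_succ]
    refine mul_le_mul_of_nonneg_right (pow_le_pow_left₀ hs ?_ j) (by positivity)
    nlinarith [sq_nonneg (s - 1)]
  have h3 : (1 + s ^ 2) ^ (j + 1) ≤ (j + 1).factorial * Real.exp (c * (1 + s ^ 2)) / c ^ (j + 1) := by
    rw [le_div_iff₀ (by positivity)]
    rw [div_le_iff₀ (by positivity), mul_pow] at h1
    linarith
  calc s ^ j * (1 + s ^ 2) * Real.exp (-(c * s ^ 2))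
      ≤ (j + 1).factorial * Real.exp (c * (1 + s ^ 2)) / c ^ (j + 1) * Real.exp (-(c * s ^ 2)) := by
        gcongr; exact h2.trans h3
    _ = (j + 1).factorial * (Real.exp (c * (1 + s ^ 2)) * Real.exp (-(c * s ^ 2))) / c ^ (j + 1) := by
        ring
    _ = _ := by rw [← Real.exp_add]; congr 3; ring

theorem summable_waveY : Summable fun n => (waveY n ^ 2)⁻¹ := by
  have h : Summable fun n : ℕ => (((n + 1 : ℕ) : ℝ) ^ 2)⁻¹ :=
    (summable_nat_add_iff 1 (f := fun n : ℕ => ((n : ℝ) ^ 2)⁻¹)).2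
      (Real.summable_nat_pow_inv.2 (by norm_num))
  refine h.of_nonneg_of_le (fun n => by positivity) fun n => ?_
  apply inv_anti₀ (by positivity)
  unfold waveY
  push_cast
  have := Real.pi_gt_three
  have h0 : (0 : ℝ) ≤ n := n.cast_nonneg
  gcongr
  nlinarith

/-- The mass of the model weight at unit time. -/
def freqMass : ℝ := ∑' n, (waveY n ^ 2)⁻¹

theorem freqMass_nonneg : 0 ≤ freqMass := tsum_nonneg fun n => by positivity

/-- Scaling in `ξ` produces `1/S`. With `S = √⟨t⟩` this is the half power of time gained by
integrating over a one-dimensional frequency. -/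
theorem lintegral_model {S : ℝ} (hS : 0 < S) :
    ∫⁻ ζ, ENNReal.ofReal ((1 + (S * waveX ζ) ^ 2)⁻¹ * (waveY ζ.2 ^ 2)⁻¹) ∂μF =
      ENNReal.ofReal (freqMass / (2 * S)) := by
  have e : ∀ ζ : ℝ × ℕ, ENNReal.ofReal ((1 + (S * waveX ζ) ^ 2)⁻¹ * (waveY ζ.2 ^ 2)⁻¹) =
      ENNReal.ofReal ((1 + (2 * Real.pi * S * ζ.1) ^ 2)⁻¹) * ENNReal.ofReal ((waveY ζ.2 ^ 2)⁻¹) := by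
    intro ζ
    rw [← ENNReal.ofReal_mul (by positivity)]
    congr 4; unfold waveX; ring
  have hπ := Real.pi_pos
  simp_rw [e]
  unfold μF
  rw [lintegral_prod_mul (f := fun ξ : ℝ => ENNReal.ofReal ((1 + (2 * Real.pi * S * ξ) ^ 2)⁻¹))
    (g := fun n : ℕ => ENNReal.ofReal ((waveY n ^ 2)⁻¹)) (by fun_prop)
    (measurable_from_top.aemeasurable), lintegral_count]
  rw [← ENNReal.ofReal_tsum_of_nonneg (fun n => by positivity) summable_waveY]
  have hi : Integrable fun ξ : ℝ => (1 + (2 * Real.pi * S * ξ) ^ 2)⁻¹ :=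
    integrable_inv_one_add_sq.comp_mul_left' (by positivity)
  rw [← ofReal_integral_eq_lintegral_ofReal hi (Eventually.of_forall fun ξ => by positivity)]
  have := Measure.integral_comp_mul_left (fun x : ℝ => (1 + x ^ 2)⁻¹) (2 * Real.pi * S)
  rw [this, integral_univ_inv_one_add_sq, ← ENNReal.ofReal_mul (by positivity)]
  congr 1
  rw [abs_of_pos (by positivity), smul_eq_mul]
  unfold freqMass
  field_simp

/-- In the variable `s = √⟨t⟩ |p|/λ²` the slow exponential is Gaussian. Each factor `|p|` equals
`sλ²/√⟨t⟩`, and the integral gives one more `1/√⟨t⟩`. Of the `2j + 6` powers of `λ`, `2j` pay for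
the factors `|p|`, four for the passage from `1 + s²` to `1 + (√⟨t⟩p)²`, and two for the sum over
`n`. -/
theorem exists_slow_bound {ν : ℝ} (hν : 0 < ν) (j : ℕ) : ∃ C : ℝ, 0 ≤ C ∧ ∀ t, 0 ≤ t →
    ∫⁻ ζ, ENNReal.ofReal (|waveX ζ| ^ j * (freq ζ ^ (2 * j + 6))⁻¹ * Real.exp (-rate ν ζ * t)) ∂μF ≤
      ENNReal.ofReal (C * bracket t ^ (-((j + 1) / 2 : ℝ))) := by
  set c := slowConst ν / 4 with hcdef
  have hc : 0 < c := by have := slowConst_pos hν; positivity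
  set C₀ := Real.exp 1 * ((j + 1).factorial * Real.exp c / c ^ (j + 1)) with hC₀
  have hC₀' : 0 ≤ C₀ := by positivity
  refine ⟨C₀ * freqMass / 2, by have := freqMass_nonneg; positivity, fun t ht => ?_⟩
  set S := √(bracket t) with hS
  have hS0 : 0 < S := Real.sqrt_pos.2 (bracket_pos t)
  have hS2 : S ^ 2 = bracket t := Real.sq_sqrt (bracket_pos t).le
  have hpt : ∀ ζ, |waveX ζ| ^ j * (freq ζ ^ (2 * j + 6))⁻¹ * Real.exp (-rate ν ζ * t) ≤
      C₀ * (S ^ j)⁻¹ * ((1 + (S * waveX ζ) ^ 2)⁻¹ * (waveY ζ.2 ^ 2)⁻¹) := by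
    intro ζ
    have hl := freq_pos ζ
    have hl1 := one_le_freq ζ
    have hk0 : 0 < waveY ζ.2 := one_pos.trans_le (one_le_waveY _)
    set s := S * |waveX ζ| / freq ζ ^ 2 with hs
    have hs0 : 0 ≤ s := by positivity
    have h1 := exp_rate_le hν ζ ht
    have h2 : rate ν ζ * bracket t = c * s ^ 2 := by
      rw [← hS2, hs, div_pow, mul_pow, sq_abs]
      unfold rate slowRate
      ring
    have h3 := pow_mul_exp_neg_le j hc hs0
    rw [neg_mul, neg_mul, h2] at h1
    have h4 : 1 + (S * waveX ζ) ^ 2 ≤ freq ζ ^ 4 * (1 + s ^ 2) := by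
      have : freq ζ ^ 4 * (1 + s ^ 2) = freq ζ ^ 4 + (S * waveX ζ) ^ 2 := by
        rw [hs, div_pow, mul_pow, sq_abs]; field_simp
      rw [this]
      have := one_le_pow₀ hl1 (n := 4)
      linarith
    have h5 : waveY ζ.2 ^ 2 ≤ freq ζ ^ 2 := by
      have := waveY_le_freq ζ
      gcongr
    have h6 : |waveX ζ| ^ j = s ^ j * freq ζ ^ (2 * j) * (S ^ j)⁻¹ := by
      rw [hs, div_pow, mul_pow, pow_mul]; field_simp
    rw [← mul_inv, ← div_eq_mul_inv, ← div_eq_mul_inv, ← div_eq_mul_inv]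
    rw [div_mul_eq_mul_div, div_le_div_iff₀ (by positivity) (by positivity)]
    rw [h6]
    calc s ^ j * freq ζ ^ (2 * j) * (S ^ j)⁻¹ * Real.exp (-rate ν ζ * t) *
          ((1 + (S * waveX ζ) ^ 2) * waveY ζ.2 ^ 2)
        ≤ s ^ j * freq ζ ^ (2 * j) * (S ^ j)⁻¹ * (Real.exp 1 * Real.exp (-(c * s ^ 2))) *
          ((freq ζ ^ 4 * (1 + s ^ 2)) * freq ζ ^ 2) := by
          gcongr
          rw [neg_mul]; exact h1
      _ = Real.exp 1 * (s ^ j * (1 + s ^ 2) * Real.exp (-(c * s ^ 2))) * (S ^ j)⁻¹ *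
          freq ζ ^ (2 * j + 6) := by ring
      _ ≤ Real.exp 1 * ((j + 1).factorial * Real.exp c / c ^ (j + 1)) * (S ^ j)⁻¹ *
          freq ζ ^ (2 * j + 6) := by gcongr
      _ = C₀ / S ^ j * freq ζ ^ (2 * j + 6) := by rw [hC₀]; ring
  calc ∫⁻ ζ, ENNReal.ofReal (|waveX ζ| ^ j * (freq ζ ^ (2 * j + 6))⁻¹ *
        Real.exp (-rate ν ζ * t)) ∂μF
      ≤ ∫⁻ ζ, ENNReal.ofReal (C₀ * (S ^ j)⁻¹) *
          ENNReal.ofReal ((1 + (S * waveX ζ) ^ 2)⁻¹ * (waveY ζ.2 ^ 2)⁻¹) ∂μF := by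
        refine lintegral_mono fun ζ => ?_
        rw [← ENNReal.ofReal_mul (by positivity)]
        exact ENNReal.ofReal_le_ofReal (hpt ζ)
    _ = ENNReal.ofReal (C₀ * (S ^ j)⁻¹) * ENNReal.ofReal (freqMass / (2 * S)) := by
        rw [lintegral_const_mul' _ _ ENNReal.ofReal_ne_top, lintegral_model hS0]
    _ = ENNReal.ofReal (C₀ * freqMass / 2 * bracket t ^ (-((j + 1) / 2 : ℝ))) := by
        rw [← ENNReal.ofReal_mul (by positivity)]
        congr 1
        have : bracket t ^ (-((j + 1) / 2 : ℝ)) = (S ^ (j + 1))⁻¹ := by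
          rw [Real.rpow_neg (bracket_pos t).le, ← hS2, ← Real.rpow_natCast S 2, ← Real.rpow_mul hS0.le,
            ← Real.rpow_natCast S (j + 1)]
          congr 2; push_cast; ring
        rw [this, pow_succ]
        field_simp
    _ ≤ _ := le_rfl

/-- Since `λ ≥ 1` the fast part decays uniformly in the frequency. The power `5/2` is the largest
that will be needed; the proof goes through the cube, and `6` is `3!`. -/
theorem exists_exp_le_bracket {ν : ℝ} (hν : 0 < ν) : ∃ C : ℝ, 0 ≤ C ∧ ∀ t, 0 ≤ t → ∀ ζ,
    Real.exp (-(ν * freq ζ ^ 2 * t)) ≤ C * bracket t ^ (-(5 / 2) : ℝ) := by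
  refine ⟨1 + 6 / ν ^ 3, by positivity, fun t ht ζ => ?_⟩
  have hT := bracket_pos t
  have h1 : Real.exp (-(ν * freq ζ ^ 2 * t)) ≤ Real.exp (-(ν * t)) := by
    apply Real.exp_le_exp.2
    have := one_le_freq_sq ζ
    have h : 0 ≤ ν * t := by positivity
    nlinarith
  refine h1.trans ?_
  have h2 : (bracket t ^ 3)⁻¹ ≤ bracket t ^ (-(5 / 2) : ℝ) := by
    rw [← Real.rpow_natCast, ← Real.rpow_neg hT.le]
    apply Real.rpow_le_rpow_of_exponent_le (one_le_bracket t)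
    norm_num
  refine le_trans ?_ (mul_le_mul_of_nonneg_left h2 (by positivity))
  rw [← div_eq_mul_inv, le_div_iff₀ (by positivity)]
  rcases le_total t 1 with h | h
  · have e : bracket t = 1 := max_eq_left h
    have h3 : Real.exp (-(ν * t)) ≤ 1 := Real.exp_le_one_iff.2 (by have : 0 ≤ ν * t := by positivity
                                                                   linarith)
    have h4 : 0 ≤ 6 / ν ^ 3 := by positivity
    rw [e]; linarith
  · have e : bracket t = t := max_eq_right h
    rw [e]
    have h3 := Real.pow_div_factorial_le_exp (x := ν * t) (by positivity) 3
    rw [div_le_iff₀ (by positivity)] at h3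
    have h4 : Real.exp (-(ν * t)) * Real.exp (ν * t) = 1 := by rw [← Real.exp_add]; simp
    have h5 : t ^ 3 ≤ 6 / ν ^ 3 * Real.exp (ν * t) := by
      rw [div_mul_eq_mul_div, le_div_iff₀ (by positivity)]
      have : (Nat.factorial 3 : ℝ) = 6 := by norm_num [Nat.factorial]
      rw [this, mul_pow] at h3
      linarith
    calc Real.exp (-(ν * t)) * t ^ 3 ≤ Real.exp (-(ν * t)) * (6 / ν ^ 3 * Real.exp (ν * t)) := by gcongr
      _ = 6 / ν ^ 3 * (Real.exp (-(ν * t)) * Real.exp (ν * t)) := by ring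
      _ ≤ 1 + 6 / ν ^ 3 := by rw [h4]; linarith

theorem lintegral_freq_le : ∫⁻ ζ, ENNReal.ofReal ((freq ζ ^ 4)⁻¹) ∂μF ≤
    ENNReal.ofReal (freqMass / 2) := by
  have h := lintegral_model one_pos
  rw [mul_one] at h
  rw [← h]
  refine lintegral_mono fun ζ => ENNReal.ofReal_le_ofReal ?_
  rw [← mul_inv]
  have hk := one_le_waveY ζ.2
  have hk0 : 0 < waveY ζ.2 := by linarith
  apply inv_anti₀ (by positivity)
  have : freq ζ ^ 4 = (waveX ζ ^ 2 + waveY ζ.2 ^ 2) ^ 2 := by rw [← freq_sq]; ring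
  rw [this]
  have h1 : 1 ≤ waveY ζ.2 ^ 2 := one_le_pow₀ hk
  nlinarith [sq_nonneg (waveX ζ)]

end

section

open Topology Complex

/-! ### Weighted bounds on the frequency side -/

theorem eLpNorm_two_sq {α E : Type*} [MeasurableSpace α] {μ : Measure α} [NormedAddCommGroup E]
    (f : α → E) : eLpNorm f 2 μ ^ 2 = ∫⁻ z, ‖f z‖ₑ ^ 2 ∂μ := by
  have := eLpNorm_nnreal_pow_eq_lintegral (μ := μ) (f := f) (p := 2) (by norm_num)
  simpa only [NNReal.coe_ofNat, ENNReal.coe_ofNat, ENNReal.rpow_ofNat] using this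

theorem eLpNorm_two_le {α E : Type*} [MeasurableSpace α] {μ : Measure α} [NormedAddCommGroup E]
    {f : α → E} {x : ℝ≥0∞} (h : ∫⁻ z, ‖f z‖ₑ ^ 2 ∂μ ≤ x ^ 2) : eLpNorm f 2 μ ≤ x := by
  rw [← eLpNorm_two_sq] at h
  exact (ENNReal.pow_le_pow_left_iff (by norm_num)).1 h

/-- The fast part of the decay of a mode. -/
def fastWeight (ν t : ℝ) (ζ : ℝ × ℕ) : ℝ := (freq ζ ^ 2)⁻¹ * Real.exp (-(ν * freq ζ ^ 2 / 2) * t)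

/-- The slow part of the decay of a mode. -/
def slowWeight (ν : ℝ) (i : ℕ) (t : ℝ) (ζ : ℝ × ℕ) : ℝ :=
  |waveX ζ| ^ i * (freq ζ ^ (2 * i + 3))⁻¹ * Real.exp (-rate ν ζ / 2 * t)

theorem fastWeight_nonneg (ν t : ℝ) (ζ : ℝ × ℕ) : 0 ≤ fastWeight ν t ζ := by
  unfold fastWeight; positivity

theorem slowWeight_nonneg (ν : ℝ) (i : ℕ) (t : ℝ) (ζ : ℝ × ℕ) : 0 ≤ slowWeight ν i t ζ := by
  have := freq_pos ζ
  unfold slowWeight; positivity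

theorem bracket_rpow_le (t : ℝ) {a b : ℝ} (h : a ≤ b) : bracket t ^ a ≤ bracket t ^ b :=
  Real.rpow_le_rpow_of_exponent_le (one_le_bracket t) h

/-- After squaring, the fast weight is `λ⁻⁴` times an exponential and the slow weight is the
integrand of `exists_slow_bound` with `j = 2i`. The square root halves the rate `(2i+1)/2`. -/
theorem exists_decay_two {ν : ℝ} (hν : 0 < ν) {i : ℕ} (hi : i ≤ 2) : ∃ C : ℝ, 0 ≤ C ∧
    ∀ t, 0 ≤ t → ∀ N, 0 ≤ N → ∀ F : ℝ × ℕ → ℂ,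
      (∀ ζ, ‖F ζ‖ ≤ N * (fastWeight ν t ζ + slowWeight ν i t ζ)) →
      eLpNorm F 2 μF ≤ ENNReal.ofReal (C * bracket t ^ (-((2 * i + 1) / 4 : ℝ)) * N) := by
  obtain ⟨C₁, hC₁, h₁⟩ := exists_slow_bound hν (2 * i)
  obtain ⟨C₂, hC₂, h₂⟩ := exists_exp_le_bracket hν
  have hM := freqMass_nonneg
  set D := 2 * (C₂ * (freqMass / 2) + C₁) with hD
  have hD0 : 0 ≤ D := by positivity
  refine ⟨√D, by positivity, fun t ht N hN F hF => eLpNorm_two_le ?_⟩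
  have hT := bracket_pos t
  set T := bracket t with hTdef
  have e2 : (T ^ (-((2 * i + 1) / 4 : ℝ))) ^ 2 = T ^ (-((2 * i + 1) / 2 : ℝ)) := by
    rw [← Real.rpow_natCast, ← Real.rpow_mul hT.le]; congr 1; push_cast; ring
  have h₁' := h₁ t ht
  push_cast at h₁'
  have hpt : ∀ ζ, ‖F ζ‖ₑ ^ 2 ≤ ENNReal.ofReal (2 * N ^ 2) *
      (ENNReal.ofReal (C₂ * T ^ (-((2 * i + 1) / 2 : ℝ))) * ENNReal.ofReal ((freq ζ ^ 4)⁻¹) +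
        ENNReal.ofReal (|waveX ζ| ^ (2 * i) * (freq ζ ^ (2 * (2 * i) + 6))⁻¹ *
          Real.exp (-rate ν ζ * t))) := by
    intro ζ
    have hl := freq_pos ζ
    rw [← ofReal_norm, ← ENNReal.ofReal_pow (norm_nonneg _),
      ← ENNReal.ofReal_mul (by positivity), ← ENNReal.ofReal_add (by positivity) (by positivity),
      ← ENNReal.ofReal_mul (by positivity)]
    apply ENNReal.ofReal_le_ofReal
    have f0 := fastWeight_nonneg ν t ζ
    have s0 := slowWeight_nonneg ν i t ζ
    have ef : fastWeight ν t ζ ^ 2 ≤ C₂ * T ^ (-((2 * i + 1) / 2 : ℝ)) * (freq ζ ^ 4)⁻¹ := by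
      have : fastWeight ν t ζ ^ 2 = Real.exp (-(ν * freq ζ ^ 2 * t)) * (freq ζ ^ 4)⁻¹ := by
        unfold fastWeight
        rw [mul_pow, ← Real.exp_nat_mul, mul_comm]
        congr 1
        · congr 1; push_cast; ring
        · rw [inv_pow]; ring
      rw [this]
      refine mul_le_mul_of_nonneg_right ((h₂ t ht ζ).trans ?_) (by positivity)
      refine mul_le_mul_of_nonneg_left (bracket_rpow_le t ?_) hC₂
      -- The power `5/2` for the fast part covers the rate `(2i+1)/2` exactly up to `i = 2`.
      have : (i : ℝ) ≤ 2 := by exact_mod_cast hi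
      linarith
    have es : slowWeight ν i t ζ ^ 2 = |waveX ζ| ^ (2 * i) * (freq ζ ^ (2 * (2 * i) + 6))⁻¹ *
          Real.exp (-rate ν ζ * t) := by
      unfold slowWeight
      rw [mul_pow, mul_pow, ← Real.exp_nat_mul, inv_pow, ← pow_mul, ← pow_mul]
      congr 2
      · congr 1; ring
      · congr 2; ring
      · push_cast; ring
    rw [← es]
    calc ‖F ζ‖ ^ 2 ≤ (N * (fastWeight ν t ζ + slowWeight ν i t ζ)) ^ 2 := by
          gcongr; exact hF ζ
      _ = N ^ 2 * (fastWeight ν t ζ + slowWeight ν i t ζ) ^ 2 := by ring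
      _ ≤ N ^ 2 * (2 * (fastWeight ν t ζ ^ 2 + slowWeight ν i t ζ ^ 2)) := by
          gcongr; nlinarith [sq_nonneg (fastWeight ν t ζ - slowWeight ν i t ζ)]
      _ ≤ N ^ 2 * (2 * (C₂ * T ^ (-((2 * i + 1) / 2 : ℝ)) * (freq ζ ^ 4)⁻¹ +
            slowWeight ν i t ζ ^ 2)) := by gcongr
      _ = _ := by ring
  refine (lintegral_mono hpt).trans ?_
  rw [lintegral_const_mul' _ _ ENNReal.ofReal_ne_top, lintegral_add_left
    ((by have := continuous_freq; fun_prop : Measurable fun ζ => ENNReal.ofReal ((freq ζ ^ 4)⁻¹)).const_mul _),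
    lintegral_const_mul' _ _ ENNReal.ofReal_ne_top]
  calc _ ≤ ENNReal.ofReal (2 * N ^ 2) * (ENNReal.ofReal (C₂ * T ^ (-((2 * i + 1) / 2 : ℝ))) *
        ENNReal.ofReal (freqMass / 2) + ENNReal.ofReal (C₁ * T ^ (-((2 * i + 1) / 2 : ℝ)))) := by
        gcongr
        exact lintegral_freq_le
    _ = ENNReal.ofReal (√D * T ^ (-((2 * i + 1) / 4 : ℝ)) * N) ^ 2 := by
        rw [← ENNReal.ofReal_mul (by positivity), ← ENNReal.ofReal_add (by positivity) (by positivity),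
          ← ENNReal.ofReal_mul (by positivity), ← ENNReal.ofReal_pow (by positivity)]
        congr 1
        rw [mul_pow, mul_pow, Real.sq_sqrt hD0, e2, hD]
        ring

/-- Without squaring, a single factor `|p|` already yields the rate one: this is `exists_slow_bound`
with `j = 1`. -/
theorem exists_decay_one {ν : ℝ} (hν : 0 < ν) : ∃ C : ℝ, 0 ≤ C ∧
    ∀ t, 0 ≤ t → ∀ N, 0 ≤ N → ∀ F : ℝ × ℕ → ℂ,
      (∀ ζ, ‖F ζ‖ ≤ N * ((freq ζ ^ 4)⁻¹ * Real.exp (-(ν * freq ζ ^ 2 * t)) +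
        |waveX ζ| * (freq ζ ^ 8)⁻¹ * Real.exp (-rate ν ζ * t))) →
      ∫⁻ ζ, ‖F ζ‖ₑ ∂μF ≤ ENNReal.ofReal (C * bracket t ^ (-1 : ℝ) * N) := by
  obtain ⟨C₁, hC₁, h₁⟩ := exists_slow_bound hν 1
  obtain ⟨C₂, hC₂, h₂⟩ := exists_exp_le_bracket hν
  have hM := freqMass_nonneg
  refine ⟨C₂ * (freqMass / 2) + C₁, by positivity, fun t ht N hN F hF => ?_⟩
  have hT := bracket_pos t
  set T := bracket t with hTdef
  have h₁' := h₁ t ht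
  have e1 : (-(((1 : ℕ) : ℝ) + 1) / 2 : ℝ) = -1 := by norm_num
  rw [← neg_div, e1] at h₁'
  simp only [pow_one, mul_one, Nat.reduceAdd] at h₁'
  have hpt : ∀ ζ, ‖F ζ‖ₑ ≤ ENNReal.ofReal N *
      (ENNReal.ofReal (C₂ * T ^ (-1 : ℝ)) * ENNReal.ofReal ((freq ζ ^ 4)⁻¹) +
        ENNReal.ofReal (|waveX ζ| * (freq ζ ^ 8)⁻¹ * Real.exp (-rate ν ζ * t))) := by
    intro ζ
    have hl := freq_pos ζ
    rw [← ofReal_norm,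
      ← ENNReal.ofReal_mul (by positivity), ← ENNReal.ofReal_add (by positivity) (by positivity),
      ← ENNReal.ofReal_mul (by positivity)]
    apply ENNReal.ofReal_le_ofReal
    refine (hF ζ).trans ?_
    have : Real.exp (-(ν * freq ζ ^ 2 * t)) ≤ C₂ * T ^ (-1 : ℝ) :=
      (h₂ t ht ζ).trans (mul_le_mul_of_nonneg_left (bracket_rpow_le t (by norm_num)) hC₂)
    rw [mul_comm (C₂ * T ^ (-1 : ℝ))]
    gcongr
  refine (lintegral_mono hpt).trans ?_
  rw [lintegral_const_mul' _ _ ENNReal.ofReal_ne_top, lintegral_add_left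
    ((by have := continuous_freq; fun_prop : Measurable fun ζ => ENNReal.ofReal ((freq ζ ^ 4)⁻¹)).const_mul _),
    lintegral_const_mul' _ _ ENNReal.ofReal_ne_top]
  calc _ ≤ ENNReal.ofReal N * (ENNReal.ofReal (C₂ * T ^ (-1 : ℝ)) *
        ENNReal.ofReal (freqMass / 2) + ENNReal.ofReal (C₁ * T ^ (-1 : ℝ))) := by
        gcongr
        exact lintegral_freq_le
    _ = _ := by
        rw [← ENNReal.ofReal_mul (by positivity), ← ENNReal.ofReal_add (by positivity) (by positivity),
          ← ENNReal.ofReal_mul (by positivity)]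
        congr 1
        ring

/-! ### Decay of the coefficients of the data -/

theorem derivNorm_eq {a b : ℕ} {p : ℝ≥0∞} {f g : ℝ × ℝ → ℝ} (h : IsWeakDeriv a b f g) :
    derivNorm a b p f = eLpNorm g p μΩ :=
  le_antisymm (iInf₂_le g h) (le_iInf₂ fun _ h' => (eLpNorm_congr_ae (h.unique h')).le)

theorem derivNorm_le_wNorm {a b m : ℕ} (hm : a + b = m) (p : ℝ≥0∞) (f : ℝ × ℝ → ℝ) :
    derivNorm a b p f ≤ wNorm m p f :=
  (Finset.single_le_sum (f := fun α : ℕ × ℕ => derivNorm α.1 α.2 p f) (fun _ _ => zero_le)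
    (Finset.HasAntidiagonal.mem_antidiagonal.2 hm : (a, b) ∈ _)).trans le_self_add

theorem MemW.wNorm_ne_top {m : ℕ} {p : ℝ≥0∞} {f : ℝ × ℝ → ℝ} (h : MemW m p f) :
    wNorm m p f ≠ ⊤ := by
  refine ENNReal.add_ne_top.2 ⟨ENNReal.sum_ne_top.2 fun α hα => ?_, h.1.eLpNorm_ne_top⟩
  obtain ⟨g, hg, hg'⟩ := h.2 α.1 α.2 (Finset.HasAntidiagonal.mem_antidiagonal.1 hα).le
  rw [derivNorm_eq hg]
  exact hg'.eLpNorm_ne_top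

theorem rcoeff_congr (c : Bool) {f g : ℝ × ℝ → ℝ} (h : f =ᵐ[μΩ] g) (ζ : ℝ × ℕ) :
    rcoeff c f ζ = rcoeff c g ζ := by
  unfold rcoeff coeff
  refine integral_congr_ae ?_
  filter_upwards [h] with z hz
  rw [hz]

theorem IsWeakDeriv.ae_eq_zero_order {f g : ℝ × ℝ → ℝ} (h : IsWeakDeriv 0 0 f g) : g =ᵐ[μΩ] f :=
  h.unique (IsWeakDeriv.refl h.1)

theorem norm_rcoeff_le (c : Bool) {f : ℝ × ℝ → ℝ} (hf : MemLp f 1 μΩ) (ζ : ℝ × ℕ) :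
    ‖rcoeff c f ζ‖ ≤ √2 * (eLpNorm f 1 μΩ).toReal := by
  have hi := memLp_one_iff_integrable.1 hf
  refine (norm_coeff_le c hi.ofReal ζ).trans (le_of_eq ?_)
  congr 1
  refine (integral_congr_ae (Eventually.of_forall fun z => norm_real (f z))).trans ?_
  rw [integral_norm_eq_lintegral_enorm hi.1, eLpNorm_one_eq_lintegral_enorm]

theorem MemW.rcoeff_fst {m : ℕ} {f : ℝ × ℝ → ℝ} (h : MemW m 1 f) (c : Bool) (ζ : ℝ × ℕ) :
    ∀ a ≤ m, ∀ g, IsWeakDeriv a 0 f g → rcoeff c g ζ = (I * waveX ζ) ^ a * rcoeff c f ζ := by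
  intro a
  induction a with
  | zero => intro _ g hg; rw [rcoeff_congr c hg.ae_eq_zero_order]; simp
  | succ a ih =>
    intro ha g hg
    obtain ⟨k, hk, hk1⟩ := h.2 a 0 (by omega)
    have hg1 := h.memLp (by omega) hg
    rw [rcoeff_deriv_fst c (memLp_one_iff_integrable.1 hk1) (memLp_one_iff_integrable.1 hg1)
      (hk.of_add (c := 1) (d := 0) hg), ih (by omega) k hk]
    ring

/-- Every vertical derivative exchanges sines and cosines. The passage from even to odd order pairs
with a cosine and uses the vanishing trace of an even derivative; the passage from odd to even order
needs nothing. -/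
theorem MemD.norm_rcoeff_snd {m : ℕ} {f : ℝ × ℝ → ℝ} (h : MemD m 1 f) (ζ : ℝ × ℕ) :
    ∀ b ≤ m, ∀ g, IsWeakDeriv 0 b f g →
      ‖rcoeff (decide (Odd b)) g ζ‖ = waveY ζ.2 ^ b * ‖rcoeff false f ζ‖ := by
  have hk0 : 0 < waveY ζ.2 := one_pos.trans_le (one_le_waveY _)
  intro b
  induction b with
  | zero => intro _ g hg; rw [rcoeff_congr _ hg.ae_eq_zero_order]; simp
  | succ b ih =>
    intro hb g hg
    obtain ⟨k, hk, hk1⟩ := h.1.2 0 b (by omega)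
    have hg1 := h.1.memLp (by omega) hg
    have hi := memLp_one_iff_integrable.1 hk1
    have hi' := memLp_one_iff_integrable.1 hg1
    have hd : IsWeakDeriv 0 1 k g := hk.of_add (c := 0) (d := 1) hg
    have ih' := ih (by omega) k hk
    rcases Nat.even_or_odd b with he | ho
    · obtain ⟨k', hk', hv⟩ := h.2 b (by omega) he
      have e : decide (Odd (b + 1)) = true := by simp [he.add_one]
      have e' : decide (Odd b) = false := by simp [Nat.not_odd_iff_even.2 he]
      rw [e] at *
      rw [e'] at ih'
      rw [rcoeff_cosine_deriv_snd hi hi' hd (hv.congr (hk'.unique hk)), norm_mul, ih', norm_real,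
        Real.norm_of_nonneg hk0.le]
      ring
    · have e : decide (Odd (b + 1)) = false := by simp [Nat.not_odd_iff_even.2 ho.add_one]
      have e' : decide (Odd b) = true := by simp [ho]
      rw [e] at *
      rw [e'] at ih'
      rw [rcoeff_sine_deriv_snd hi hi' hd, norm_mul, ih', norm_neg, norm_real,
        Real.norm_of_nonneg hk0.le]
      ring

theorem freq_pow_le (ζ : ℝ × ℕ) (m : ℕ) :
    freq ζ ^ m ≤ 2 ^ m * (|waveX ζ| ^ m + waveY ζ.2 ^ m) := by
  have hk0 : 0 < waveY ζ.2 := one_pos.trans_le (one_le_waveY _)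
  have h1 : freq ζ ≤ |waveX ζ| + waveY ζ.2 := by
    apply Real.sqrt_le_iff.2 ⟨by positivity, ?_⟩
    rw [add_sq, sq_abs]
    have : 0 ≤ 2 * |waveX ζ| * waveY ζ.2 := by positivity
    linarith
  calc freq ζ ^ m ≤ (|waveX ζ| + waveY ζ.2) ^ m := by
        have := freq_pos ζ
        gcongr
    _ ≤ (2 * max |waveX ζ| (waveY ζ.2)) ^ m := by
        gcongr
        have := le_max_left |waveX ζ| (waveY ζ.2)
        have := le_max_right |waveX ζ| (waveY ζ.2)
        linarith
    _ = 2 ^ m * max |waveX ζ| (waveY ζ.2) ^ m := mul_pow _ _ _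
    _ ≤ _ := by
        gcongr
        rcases max_choice |waveX ζ| (waveY ζ.2) with h | h <;> rw [h]
        · have : 0 ≤ waveY ζ.2 ^ m := by positivity
          linarith
        · have : 0 ≤ |waveX ζ| ^ m := by positivity
          linarith

/-- The pure derivatives `∂₁^m` and `∂₂^m` control `λ^m`, and the coefficients of an integrable
function are bounded by its `L¹` norm. Only top-order norms enter. -/
theorem MemD.freq_pow_mul_le {m : ℕ} {f : ℝ × ℝ → ℝ} (h : MemD m 1 f) (ζ : ℝ × ℕ) :
    freq ζ ^ m * ‖rcoeff false f ζ‖ ≤ 2 ^ m * (2 * √2) * (wNorm m 1 f).toReal := by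
  obtain ⟨g₁, hg₁, m₁⟩ := h.1.2 m 0 (by omega)
  obtain ⟨g₂, hg₂, m₂⟩ := h.1.2 0 m (by omega)
  have b₁ := norm_rcoeff_le false m₁ ζ
  have b₂ := norm_rcoeff_le (decide (Odd m)) m₂ ζ
  rw [h.1.rcoeff_fst false ζ m le_rfl g₁ hg₁, norm_mul, norm_pow, norm_mul, norm_I, one_mul,
    norm_real, Real.norm_eq_abs] at b₁
  rw [h.norm_rcoeff_snd ζ m le_rfl g₂ hg₂] at b₂
  have c₁ : (eLpNorm g₁ 1 μΩ).toReal ≤ (wNorm m 1 f).toReal :=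
    ENNReal.toReal_mono h.1.wNorm_ne_top (derivNorm_eq (p := 1) hg₁ ▸ derivNorm_le_wNorm (by omega) 1 f)
  have c₂ : (eLpNorm g₂ 1 μΩ).toReal ≤ (wNorm m 1 f).toReal :=
    ENNReal.toReal_mono h.1.wNorm_ne_top (derivNorm_eq (p := 1) hg₂ ▸ derivNorm_le_wNorm (by omega) 1 f)
  calc freq ζ ^ m * ‖rcoeff false f ζ‖
      ≤ 2 ^ m * (|waveX ζ| ^ m + waveY ζ.2 ^ m) * ‖rcoeff false f ζ‖ := by
        gcongr; exact freq_pow_le ζ m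
    _ = 2 ^ m * (|waveX ζ| ^ m * ‖rcoeff false f ζ‖ + waveY ζ.2 ^ m * ‖rcoeff false f ζ‖) := by ring
    _ ≤ 2 ^ m * (√2 * (wNorm m 1 f).toReal + √2 * (wNorm m 1 f).toReal) := by
        have d₁ := b₁.trans (mul_le_mul_of_nonneg_left c₁ (Real.sqrt_nonneg 2))
        have d₂ := b₂.trans (mul_le_mul_of_nonneg_left c₂ (Real.sqrt_nonneg 2))
        exact mul_le_mul_of_nonneg_left (add_le_add d₁ d₂) (by positivity)
    _ = _ := by ring

theorem eLpNorm_rcoeff_sine {f : ℝ × ℝ → ℝ} (h1 : MemLp f 1 μΩ) (h2 : MemLp f 2 μΩ) :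
    eLpNorm (rcoeff false f) 2 μF = eLpNorm f 2 μΩ := by
  have h := lintegral_coeff_sine_sq (memLp_one_iff_integrable.1 h1).ofReal h2.ofReal
  rw [← eLpNorm_two_sq, ← eLpNorm_two_sq] at h
  have h' := le_antisymm ((ENNReal.pow_le_pow_left_iff two_ne_zero).1 h.le)
    ((ENNReal.pow_le_pow_left_iff two_ne_zero).1 h.ge)
  refine Eq.trans ?_ (h'.trans ?_)
  · rfl
  · exact eLpNorm_congr_norm_ae (Eventually.of_forall fun z => norm_real _)

theorem exists_memLp_two_of_vanishes : ∃ C : NNReal, ∀ f g₁ g₂ : ℝ × ℝ → ℝ, MemLp f 1 μΩ →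
    MemLp g₁ 1 μΩ → MemLp g₂ 1 μΩ → IsWeakDeriv 1 0 f g₁ → IsWeakDeriv 0 1 f g₂ →
    VanishesOnBoundary f →
    MemLp f 2 μΩ ∧ eLpNorm (rcoeff false f) 2 μF ≤ C * (eLpNorm g₁ 1 μΩ + eLpNorm g₂ 1 μΩ) := by
  obtain ⟨C, hC⟩ := exists_sobolev_strip
  refine ⟨C, fun f g₁ g₂ hf h₁ h₂ d₁ d₂ hv => ?_⟩
  have hle := hC f g₁ g₂ hf h₁ h₂ d₁ d₂ hv
  have hm : MemLp f 2 μΩ := ⟨hf.1, hle.trans_lt (ENNReal.mul_lt_top ENNReal.coe_lt_top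
    (ENNReal.add_lt_top.2 ⟨h₁.2, h₂.2⟩))⟩
  exact ⟨hm, (eLpNorm_rcoeff_sine hf hm).trans_le hle⟩

/-- The data are assumed only in `L¹`-based spaces; the Sobolev embedding places them in `L²`, where
the solution starts. -/
theorem MemD.memLp_two {m : ℕ} {f : ℝ × ℝ → ℝ} (hm : 1 ≤ m) (h : MemD m 1 f) : MemLp f 2 μΩ := by
  obtain ⟨C, hC⟩ := exists_memLp_two_of_vanishes
  obtain ⟨g₁, hg₁, m₁⟩ := h.1.2 1 0 (by omega)
  obtain ⟨g₂, hg₂, m₂⟩ := h.1.2 0 1 (by omega)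
  obtain ⟨k, hk, hv⟩ := h.2 0 (by omega) (by simp)
  exact (hC f g₁ g₂ h.1.1 m₁ m₂ hg₁ hg₂ (hv.congr hk.ae_eq_zero_order)).1

theorem MemLp.locallyIntegrable_one {f : ℝ × ℝ → ℝ} (h : MemLp f 1 μΩ) : LocallyIntegrable f μΩ :=
  (memLp_one_iff_integrable.1 h).locallyIntegrable

/-- Tangential derivatives of functions vanishing on the boundary vanish there. -/
theorem MemD.vanishes_fst {m : ℕ} {f : ℝ × ℝ → ℝ} (h : MemD m 1 f) :
    ∀ a < m, ∀ g, IsWeakDeriv a 0 f g → VanishesOnBoundary g := by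
  intro a
  induction a with
  | zero =>
    intro hm g hg
    obtain ⟨k, hk, hv⟩ := h.2 0 hm (by simp)
    exact hv.congr (hk.unique hg)
  | succ a ih =>
    intro ha g hg
    obtain ⟨k, hk, hk1⟩ := h.1.2 a 0 (by omega)
    obtain ⟨r, hr, hr1⟩ := h.1.2 a 1 (by omega)
    obtain ⟨s, hs, hs1⟩ := h.1.2 (a + 1) 1 (by omega)
    exact (ih (by omega) k hk).deriv_fst (hk.of_add (c := 1) (d := 0) hg)
      (hk.of_add (c := 0) (d := 1) hr) (hr.of_add (c := 1) (d := 0) hs)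
      (MemLp.locallyIntegrable_one hk1) (MemLp.locallyIntegrable_one (h.1.memLp (by omega) hg))
      (MemLp.locallyIntegrable_one hr1) (MemLp.locallyIntegrable_one hs1)

/-- Boundedness of `λ⁵` times the coefficient would leave `λ⁻¹`, which is not square integrable on
the two-dimensional frequency space. Instead `∂₁⁴f` and `∂₂⁴f`, which both vanish on the boundary,
are put into `L²` by the embedding of `W^{1,1}`. -/
theorem exists_eLpNorm_freq_pow_four : ∃ C : ℝ, 0 ≤ C ∧ ∀ f, MemD 5 1 f →
    eLpNorm (fun ζ => ((freq ζ ^ 4 : ℝ) : ℂ) * rcoeff false f ζ) 2 μF ≤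
      ENNReal.ofReal (C * (wNorm 5 1 f).toReal) := by
  obtain ⟨C, hC⟩ := exists_memLp_two_of_vanishes
  refine ⟨2 ^ 4 * (4 * C), by positivity, fun f h => ?_⟩
  obtain ⟨f₁, hf₁, m₁⟩ := h.1.2 4 0 (by omega)
  obtain ⟨f₂, hf₂, m₂⟩ := h.1.2 0 4 (by omega)
  obtain ⟨a, ha, ma⟩ := h.1.2 5 0 (by omega)
  obtain ⟨b, hb, mb⟩ := h.1.2 4 1 (by omega)
  obtain ⟨c, hc, mc⟩ := h.1.2 1 4 (by omega)
  obtain ⟨d, hd, md⟩ := h.1.2 0 5 (by omega)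
  obtain ⟨f₂', hf₂', hv₂⟩ := h.2 4 (by omega) (by decide)
  have b₁ := (hC f₁ a b m₁ ma mb (hf₁.of_add (c := 1) (d := 0) ha) (hf₁.of_add (c := 0) (d := 1) hb)
    (h.vanishes_fst 4 (by omega) _ hf₁)).2
  have b₂ := (hC f₂ c d m₂ mc md (hf₂.of_add (c := 1) (d := 0) hc) (hf₂.of_add (c := 0) (d := 1) hd)
    (hv₂.congr (hf₂'.unique hf₂))).2
  have wa : eLpNorm a 1 μΩ ≤ wNorm 5 1 f := derivNorm_eq (p := 1) ha ▸ derivNorm_le_wNorm (by omega) 1 f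
  have wb : eLpNorm b 1 μΩ ≤ wNorm 5 1 f := derivNorm_eq (p := 1) hb ▸ derivNorm_le_wNorm (by omega) 1 f
  have wc : eLpNorm c 1 μΩ ≤ wNorm 5 1 f := derivNorm_eq (p := 1) hc ▸ derivNorm_le_wNorm (by omega) 1 f
  have wd : eLpNorm d 1 μΩ ≤ wNorm 5 1 f := derivNorm_eq (p := 1) hd ▸ derivNorm_le_wNorm (by omega) 1 f
  have e₁ : ∀ ζ, ‖rcoeff false f₁ ζ‖ = |waveX ζ| ^ 4 * ‖rcoeff false f ζ‖ := fun ζ => by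
    rw [h.1.rcoeff_fst false ζ 4 (by omega) f₁ hf₁, norm_mul, norm_pow, norm_mul, norm_I, one_mul,
      norm_real, Real.norm_eq_abs]
  have e₂ : ∀ ζ, ‖rcoeff false f₂ ζ‖ = waveY ζ.2 ^ 4 * ‖rcoeff false f ζ‖ := fun ζ => by
    have := h.norm_rcoeff_snd ζ 4 (by omega) f₂ hf₂
    rwa [show decide (Odd 4) = false by decide] at this
  set G : ℝ × ℕ → ℝ := fun ζ => 2 ^ 4 * (‖rcoeff false f₁ ζ‖ + ‖rcoeff false f₂ ζ‖) with hG
  have s1 : AEStronglyMeasurable (rcoeff false f₁) μF :=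
    (measurable_coeff false (memLp_one_iff_integrable.1 m₁).ofReal).aestronglyMeasurable
  have s2 : AEStronglyMeasurable (rcoeff false f₂) μF :=
    (measurable_coeff false (memLp_one_iff_integrable.1 m₂).ofReal).aestronglyMeasurable
  calc eLpNorm (fun ζ => ((freq ζ ^ 4 : ℝ) : ℂ) * rcoeff false f ζ) 2 μF
      ≤ eLpNorm G 2 μF := by
        refine eLpNorm_mono_real fun ζ => ?_
        rw [norm_mul, norm_real, Real.norm_of_nonneg (by have := freq_pos ζ; positivity), hG]
        simp only [e₁, e₂]
        rw [← add_mul, ← mul_assoc]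
        gcongr
        exact freq_pow_le ζ 4
    _ ≤ ENNReal.ofReal (2 ^ 4) * (eLpNorm (rcoeff false f₁) 2 μF + eLpNorm (rcoeff false f₂) 2 μF) := by
        have : G = (2 ^ 4 : ℝ) • ((fun ζ => ‖rcoeff false f₁ ζ‖) + fun ζ => ‖rcoeff false f₂ ζ‖) := rfl
        rw [this, eLpNorm_const_smul, ← ofReal_norm, Real.norm_of_nonneg (by positivity)]
        gcongr
        refine (eLpNorm_add_le s1.norm s2.norm (by norm_num)).trans ?_
        rw [eLpNorm_norm, eLpNorm_norm]
    _ ≤ ENNReal.ofReal (2 ^ 4) * (C * (wNorm 5 1 f + wNorm 5 1 f) + C * (wNorm 5 1 f + wNorm 5 1 f)) := by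
        gcongr
        · exact b₁.trans (by gcongr)
        · exact b₂.trans (by gcongr)
    _ = _ := by
        rw [ENNReal.ofReal_mul (by positivity), ENNReal.ofReal_toReal h.1.wNorm_ne_top,
          ENNReal.ofReal_mul (by positivity), ENNReal.ofReal_mul (by positivity), ENNReal.ofReal_coe_nnreal]
        rw [show ENNReal.ofReal 4 = 4 by norm_num]
        ring

end

section

open Topology Complex

/-! ### Differentiating curves in `L²` under a dominated derivative -/

section curve

variable {α : Type*} {F F' : ℝ → α → ℂ} {G : α → ℝ}

theorem norm_sub_le_of_dominated (hd : ∀ ζ t, HasDerivAt (fun t => F t ζ) (F' t ζ) t)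
    (hb : ∀ t, 0 ≤ t → ∀ ζ, ‖F' t ζ‖ ≤ G ζ) {s t : ℝ} (hs : 0 ≤ s) (ht : 0 ≤ t) (ζ : α) :
    ‖F s ζ - F t ζ‖ ≤ |s - t| * G ζ := by
  rw [mul_comm, ← Real.norm_eq_abs]
  exact (convex_Ici (0 : ℝ)).norm_image_sub_le_of_norm_hasDerivWithin_le
    (fun x _ => (hd ζ x).hasDerivWithinAt) (fun x hx => hb x hx ζ) ht hs

variable [MeasurableSpace α] {μ : Measure α} {Φ : ℝ → Lp ℂ 2 μ}

/-- The mean value inequality makes the curve Lipschitz with constant the `L²` norm of the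
dominating function. -/
theorem continuousOn_curve (hd : ∀ ζ t, HasDerivAt (fun t => F t ζ) (F' t ζ) t)
    (hb : ∀ t, 0 ≤ t → ∀ ζ, ‖F' t ζ‖ ≤ G ζ) (hG : MemLp G 2 μ)
    (hΦ : ∀ t, 0 ≤ t → Φ t =ᵐ[μ] F t) : ContinuousOn Φ (Ici 0) := by
  refine (LipschitzOnWith.of_dist_le_mul (K := ‖hG.toLp G‖.toNNReal) fun s hs t ht => ?_).continuousOn
  rw [Real.coe_toNNReal _ (norm_nonneg _), dist_eq_norm, Real.dist_eq, mul_comm]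
  refine Lp.norm_le_mul_norm_of_ae_le_mul ?_
  filter_upwards [hΦ s hs, hΦ t ht, Lp.coeFn_sub (Φ s) (Φ t), hG.coeFn_toLp] with ζ h1 h2 h3 h4
  rw [h3, h4, Pi.sub_apply, h1, h2]
  refine (norm_sub_le_of_dominated hd hb hs ht ζ).trans ?_
  gcongr
  exact Real.le_norm_self _

/-- The remainders of the difference quotients tend to zero pointwise and are bounded by `2G`;
dominated convergence for their squares gives convergence in `L²`. The domination holds only for
nonnegative times, which still fill a neighbourhood of `t > 0`. -/
theorem hasDerivAt_curve (hm : ∀ t, Measurable (F t)) (hm' : ∀ t, Measurable (F' t))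
    (hd : ∀ ζ t, HasDerivAt (fun t => F t ζ) (F' t ζ) t)
    (hb : ∀ t, 0 ≤ t → ∀ ζ, ‖F' t ζ‖ ≤ G ζ) (hG : MemLp G 2 μ)
    (hΦ : ∀ t, 0 ≤ t → Φ t =ᵐ[μ] F t) {t : ℝ} (ht : 0 < t) {Ψ : Lp ℂ 2 μ} (hΨ : Ψ =ᵐ[μ] F' t) :
    HasDerivAt Φ Ψ t := by
  rw [hasDerivAt_iff_tendsto]
  set R : ℝ → Lp ℂ 2 μ := fun s => ‖s - t‖⁻¹ • (Φ s - Φ t - (s - t) • Ψ) with hR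
  set r : ℝ → α → ℂ := fun s ζ => ‖s - t‖⁻¹ • (F s ζ - F t ζ - (s - t) • F' t ζ) with hr
  have hRr : ∀ s, 0 ≤ s → R s =ᵐ[μ] r s := by
    intro s hs
    filter_upwards [hΦ s hs, hΦ t ht.le, hΨ, Lp.coeFn_smul ‖s - t‖⁻¹ (Φ s - Φ t - (s - t) • Ψ),
      Lp.coeFn_sub (Φ s - Φ t) ((s - t) • Ψ), Lp.coeFn_sub (Φ s) (Φ t), Lp.coeFn_smul (s - t) Ψ]
      with ζ h1 h2 h3 h4 h5 h6 h7
    simp only [hR, hr]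
    rw [h4, Pi.smul_apply, h5, Pi.sub_apply, h6, h7, Pi.sub_apply, Pi.smul_apply, h1, h2, h3]
  have hev : ∀ᶠ s in 𝓝 t, 0 ≤ s := (lt_mem_nhds ht).mono fun s hs => le_of_lt hs
  have hbound : ∀ s, 0 ≤ s → ∀ ζ, ‖r s ζ‖ ≤ 2 * G ζ := by
    intro s hs ζ
    have hG0 : 0 ≤ G ζ := (norm_nonneg _).trans (hb t ht.le ζ)
    simp only [hr]
    rw [norm_smul, norm_inv, norm_norm]
    rcases eq_or_ne s t with h | h
    · simp [h, hG0]
    have hpos : 0 < ‖s - t‖ := norm_pos_iff.2 (sub_ne_zero.2 h)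
    rw [inv_mul_le_iff₀ hpos]
    calc ‖F s ζ - F t ζ - (s - t) • F' t ζ‖ ≤ ‖F s ζ - F t ζ‖ + ‖(s - t) • F' t ζ‖ := norm_sub_le _ _
      _ ≤ |s - t| * G ζ + |s - t| * G ζ := by
          refine add_le_add (norm_sub_le_of_dominated hd hb hs ht.le ζ) ?_
          rw [norm_smul, Real.norm_eq_abs]
          exact mul_le_mul_of_nonneg_left (hb t ht.le ζ) (abs_nonneg _)
      _ = ‖s - t‖ * (2 * G ζ) := by rw [Real.norm_eq_abs]; ring
  have hlim : Tendsto (fun s => ∫⁻ ζ, ‖r s ζ‖ₑ ^ 2 ∂μ) (𝓝 t) (𝓝 0) := by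
    have := tendsto_lintegral_filter_of_dominated_convergence (μ := μ) (l := 𝓝 t)
      (F := fun s ζ => ‖r s ζ‖ₑ ^ 2) (f := fun _ => 0) (fun ζ => ‖2 * G ζ‖ₑ ^ 2)
      (Eventually.of_forall fun s => by
        have h1 := hm s
        have h2 := hm t
        have h3 := hm' t
        simp only [hr]
        fun_prop)
      (hev.mono fun s hs => Eventually.of_forall fun ζ => by
        have : ‖r s ζ‖ₑ ≤ ‖2 * G ζ‖ₑ :=
          enorm_le_iff_norm_le.2 ((hbound s hs ζ).trans (Real.le_norm_self _))
        gcongr)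
      (by
        have := (hG.const_mul 2).eLpNorm_ne_top
        rw [← eLpNorm_two_sq]
        exact ENNReal.pow_ne_top this)
      (Eventually.of_forall fun ζ => by
        have h1 := hasDerivAt_iff_tendsto.1 (hd ζ t)
        have h2 : Tendsto (fun s => ‖r s ζ‖) (𝓝 t) (𝓝 0) := by
          refine h1.congr fun s => ?_
          simp only [hr]
          rw [norm_smul, norm_inv, norm_norm]
        have h3 : Tendsto (fun s => ENNReal.ofReal ‖r s ζ‖ ^ 2) (𝓝 t) (𝓝 (ENNReal.ofReal 0 ^ 2)) :=
          (ENNReal.continuous_pow 2).continuousAt.tendsto.comp (ENNReal.tendsto_ofReal h2)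
        simpa using h3)
    simpa using this
  have hnorm : ∀ s, 0 ≤ s → ENNReal.ofReal ‖R s‖ ^ 2 = ∫⁻ ζ, ‖r s ζ‖ₑ ^ 2 ∂μ := by
    intro s hs
    rw [← ENNReal.ofReal_pow (norm_nonneg _), ofReal_norm_sq_eq]
    refine lintegral_congr_ae ?_
    filter_upwards [hRr s hs] with ζ hζ
    rw [hζ]
  have h1 : Tendsto (fun s => ENNReal.ofReal (‖R s‖ ^ 2)) (𝓝 t) (𝓝 0) := by
    refine hlim.congr' (hev.mono fun s hs => ?_)
    rw [← hnorm s hs, ← ENNReal.ofReal_pow (norm_nonneg _)]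
  have h2 : Tendsto (fun s => ‖R s‖ ^ 2) (𝓝 t) (𝓝 0) := by
    have := (ENNReal.tendsto_toReal ENNReal.zero_ne_top).comp h1
    simpa [Function.comp_def] using this
  have h3 : Tendsto (fun s => √(‖R s‖ ^ 2)) (𝓝 t) (𝓝 0) := by
    have := (Real.continuous_sqrt.tendsto 0).comp h2
    rwa [Real.sqrt_zero] at this
  refine h3.congr fun s => ?_
  rw [Real.sqrt_sq (norm_nonneg _)]
  simp only [hR]
  rw [norm_smul, norm_inv, norm_norm]

end curve

/-! ### The solution on the frequency side -/

/-- The propagator of the mode `ζ`. -/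
def prop (ν : ℝ) (ζ : ℝ × ℕ) (t : ℝ) (v : ℝ × ℝ) : ℝ × ℝ :=
  modeProp ν (waveX ζ) (freq ζ ^ 2) t v

/-- The coefficients of the vorticity. -/
def solW (ν : ℝ) (A B : ℝ × ℕ → ℂ) (t : ℝ) (ζ : ℝ × ℕ) : ℂ :=
  (prop ν ζ t (1, 0)).1 * A ζ + I * (prop ν ζ t (0, 1)).1 * B ζ

/-- The coefficients of the perturbation of the temperature. -/
def solΦ (ν : ℝ) (A B : ℝ × ℕ → ℂ) (t : ℝ) (ζ : ℝ × ℕ) : ℂ :=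
  -I * (prop ν ζ t (1, 0)).2 * A ζ + (prop ν ζ t (0, 1)).2 * B ζ

/-- The time derivative of `solW`. -/
def solW' (ν : ℝ) (A B : ℝ × ℕ → ℂ) (t : ℝ) (ζ : ℝ × ℕ) : ℂ :=
  -(ν * freq ζ ^ 2) * solW ν A B t ζ + I * waveX ζ * solΦ ν A B t ζ

/-- The time derivative of `solΦ`. -/
def solΦ' (ν : ℝ) (A B : ℝ × ℕ → ℂ) (t : ℝ) (ζ : ℝ × ℕ) : ℂ :=
  I * waveX ζ * ((freq ζ ^ 2 : ℝ) : ℂ)⁻¹ * solW ν A B t ζ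

/-! ### Bounds for the modes of the solution -/

section sol

variable {ν : ℝ} {A B : ℝ × ℕ → ℂ}

theorem solW_zero (ν : ℝ) (A B : ℝ × ℕ → ℂ) : solW ν A B 0 = A := by
  ext ζ; simp [solW, prop, modeProp_zero]

theorem solΦ_zero (ν : ℝ) (A B : ℝ × ℕ → ℂ) : solΦ ν A B 0 = B := by
  ext ζ; simp [solΦ, prop, modeProp_zero]

theorem isModeSolution_prop (ν : ℝ) (ζ : ℝ × ℕ) (v : ℝ × ℝ) :
    IsModeSolution ν (waveX ζ) (freq ζ ^ 2) (fun t => (prop ν ζ t v).1)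
      (fun t => (prop ν ζ t v).2) :=
  isModeSolution_modeProp _ _ _ _

/-- The pair of `solW` and `i` times `solΦ` solves the real mode system with initial value `(A,
iB)`; the factors `i` in the definitions undo this substitution. -/
theorem hasDerivAt_solW (ν : ℝ) (A B : ℝ × ℕ → ℂ) (ζ : ℝ × ℕ) (t : ℝ) :
    HasDerivAt (fun t => solW ν A B t ζ) (solW' ν A B t ζ) t := by
  have h1 := ((isModeSolution_prop ν ζ (1, 0)).deriv_fst t).ofReal_comp
  have h2 := ((isModeSolution_prop ν ζ (0, 1)).deriv_fst t).ofReal_comp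
  refine ((h1.mul_const (A ζ)).add ((h2.const_mul I).mul_const (B ζ))).congr_deriv ?_
  simp only [solW', solW, solΦ]
  push_cast
  linear_combination (waveX ζ * ((prop ν ζ t (1, 0)).2 : ℂ) * A ζ) * I_sq

theorem hasDerivAt_solΦ (ν : ℝ) (A B : ℝ × ℕ → ℂ) (ζ : ℝ × ℕ) (t : ℝ) :
    HasDerivAt (fun t => solΦ ν A B t ζ) (solΦ' ν A B t ζ) t := by
  have h1 := ((isModeSolution_prop ν ζ (1, 0)).deriv_φ t).ofReal_comp
  have h2 := ((isModeSolution_prop ν ζ (0, 1)).deriv_φ t).ofReal_comp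
  refine (((h1.const_mul (-I)).mul_const (A ζ)).add (h2.mul_const (B ζ))).congr_deriv ?_
  simp only [solΦ', solW, div_eq_mul_inv]
  push_cast
  linear_combination (-(waveX ζ * ((freq ζ : ℂ) ^ 2)⁻¹ * ((prop ν ζ t (0, 1)).1 : ℂ) * B ζ)) * I_sq

theorem measurable_prop (ν t : ℝ) (v : ℝ × ℝ) : Measurable fun ζ => prop ν ζ t v :=
  (continuous_modeProp ν t continuous_waveX (continuous_freq.pow 2)
    (fun ζ => (pow_pos (freq_pos ζ) 2).ne') v).measurable

theorem measurable_solW (hA : Measurable A) (hB : Measurable B) (t : ℝ) :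
    Measurable (solW ν A B t) := by
  have h1 := (measurable_prop ν t (1, 0)).fst
  have h2 := (measurable_prop ν t (0, 1)).fst
  unfold solW
  fun_prop

theorem measurable_solΦ (hA : Measurable A) (hB : Measurable B) (t : ℝ) :
    Measurable (solΦ ν A B t) := by
  have h1 := (measurable_prop ν t (1, 0)).snd
  have h2 := (measurable_prop ν t (0, 1)).snd
  unfold solΦ
  fun_prop

theorem measurable_solW' (hA : Measurable A) (hB : Measurable B) (t : ℝ) :
    Measurable (solW' ν A B t) := by
  have h1 := measurable_solW (ν := ν) hA hB t
  have h2 := measurable_solΦ (ν := ν) hA hB t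
  have h3 := continuous_freq.measurable
  have h4 := continuous_waveX.measurable
  unfold solW'
  fun_prop

theorem measurable_solΦ' (hA : Measurable A) (hB : Measurable B) (t : ℝ) :
    Measurable (solΦ' ν A B t) := by
  have h1 := measurable_solW (ν := ν) hA hB t
  have h3 := continuous_freq.measurable
  have h4 := continuous_waveX.measurable
  unfold solΦ'
  fun_prop

/-- The size of the data that drives the slow part of a mode. -/
def slowData (A B : ℝ × ℕ → ℂ) (ζ : ℝ × ℕ) : ℝ := (freq ζ)⁻¹ * ‖A ζ‖ + ‖B ζ‖

theorem slowData_nonneg (A B : ℝ × ℕ → ℂ) (ζ : ℝ × ℕ) : 0 ≤ slowData A B ζ := by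
  have := freq_pos ζ
  unfold slowData; positivity

theorem slowData_le (A B : ℝ × ℕ → ℂ) (ζ : ℝ × ℕ) : slowData A B ζ ≤ ‖A ζ‖ + ‖B ζ‖ := by
  unfold slowData
  have := inv_le_one_of_one_le₀ (one_le_freq ζ)
  have := mul_le_mul_of_nonneg_right this (norm_nonneg (A ζ))
  linarith

/-- The energy weights vorticity by `λ⁻¹`, so a unit of vorticity has energy `λ⁻²` while a unit of
`φ` has energy one. This is the reason for `slowData`. -/
theorem freq_data_fst (ζ : ℝ × ℕ) : (prop ν ζ 0 (1, 0)).1 ^ 2 / freq ζ ^ 2 +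
    (prop ν ζ 0 (1, 0)).2 ^ 2 ≤ (freq ζ)⁻¹ ^ 2 := by
  simp [prop, modeProp_zero]

theorem freq_data_snd (ζ : ℝ × ℕ) : (prop ν ζ 0 (0, 1)).1 ^ 2 / freq ζ ^ 2 +
    (prop ν ζ 0 (0, 1)).2 ^ 2 ≤ 1 ^ 2 := by
  simp [prop, modeProp_zero]

theorem norm_solW_le (hν : 0 < ν) (A B : ℝ × ℕ → ℂ) {t : ℝ} (ht : 0 ≤ t) (ζ : ℝ × ℕ) :
    ‖solW ν A B t ζ‖ ≤ Real.exp (-(ν * freq ζ ^ 2 * t)) * ‖A ζ‖ +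
      4 / ν * (|waveX ζ| * (freq ζ ^ 2)⁻¹) * Real.exp (-rate ν ζ * t) * slowData A B ζ := by
  have hl := freq_pos ζ
  have h1 := (isModeSolution_prop ν ζ (1, 0)).bound_fst hν (one_le_freq_sq ζ) (waveX_sq_le ζ)
    (inv_nonneg.2 hl.le) (freq_data_fst ζ) ht
  have h2 := (isModeSolution_prop ν ζ (0, 1)).bound_fst hν (one_le_freq_sq ζ) (waveX_sq_le ζ)
    zero_le_one (freq_data_snd ζ) ht
  have z1 : (prop ν ζ 0 (1, 0)).1 = 1 := by simp [prop, modeProp_zero]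
  have z2 : (prop ν ζ 0 (0, 1)).1 = 0 := by simp [prop, modeProp_zero]
  simp only [z1, z2, abs_one, abs_zero, mul_one, mul_zero, zero_add] at h1 h2
  unfold solW
  refine (norm_add_le _ _).trans ?_
  rw [norm_mul, norm_mul, norm_mul, norm_I, one_mul, norm_real, norm_real, Real.norm_eq_abs,
    Real.norm_eq_abs]
  refine (add_le_add (mul_le_mul_of_nonneg_right h1 (norm_nonneg _))
    (mul_le_mul_of_nonneg_right h2 (norm_nonneg _))).trans (le_of_eq ?_)
  unfold slowData rate
  rw [neg_mul (ν * freq ζ ^ 2)]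
  field_simp
  ring

theorem norm_solΦ_le (hν : 0 < ν) (A B : ℝ × ℕ → ℂ) {t : ℝ} (ht : 0 ≤ t) (ζ : ℝ × ℕ) :
    ‖solΦ ν A B t ζ‖ ≤ 2 * (‖A ζ‖ + ‖B ζ‖) := by
  have hl := freq_pos ζ
  have h1 := (isModeSolution_prop ν ζ (1, 0)).lyapunov hν (one_le_freq_sq ζ) (waveX_sq_le ζ)
    (inv_nonneg.2 hl.le) (freq_data_fst ζ) ht
  have h2 := (isModeSolution_prop ν ζ (0, 1)).lyapunov hν (one_le_freq_sq ζ) (waveX_sq_le ζ)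
    zero_le_one (freq_data_snd ζ) ht
  have he : Real.exp (-slowRate ν (waveX ζ) (freq ζ ^ 2) * t) ≤ 1 := by
    apply Real.exp_le_one_iff.2
    have := mul_nonneg (rate_nonneg hν ζ) ht
    unfold rate at this
    linarith
  have hi := inv_le_one_of_one_le₀ (one_le_freq ζ)
  have k1 : |(prop ν ζ t (1, 0)).2| ≤ 2 := h1.trans (by
    have : 2 * (freq ζ)⁻¹ * Real.exp (-slowRate ν (waveX ζ) (freq ζ ^ 2) * t) ≤ 2 * 1 * 1 := by gcongr
    linarith)
  have k2 : |(prop ν ζ t (0, 1)).2| ≤ 2 := h2.trans (by linarith)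
  unfold solΦ
  refine (norm_add_le _ _).trans ?_
  rw [norm_mul, norm_mul, norm_mul, norm_neg, norm_I, one_mul, norm_real, norm_real,
    Real.norm_eq_abs, Real.norm_eq_abs, mul_add]
  gcongr

theorem abs_waveX_mul_inv_le (ζ : ℝ × ℕ) : |waveX ζ| * (freq ζ ^ 2)⁻¹ ≤ 1 := by
  have hl := freq_pos ζ
  rw [← div_eq_mul_inv, div_le_one (by positivity)]
  have := abs_waveX_le_freq ζ
  have := one_le_freq ζ
  nlinarith

/-- All decay is given up in exchange for a bound uniform in time. Together with the similar bounds
below, this provides the domination in `hasDerivAt_curve` and `continuousOn_curve`. -/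
theorem norm_solW_le_crude (hν : 0 < ν) (A B : ℝ × ℕ → ℂ) {t : ℝ} (ht : 0 ≤ t) (ζ : ℝ × ℕ) :
    ‖solW ν A B t ζ‖ ≤ (1 + 4 / ν) * (‖A ζ‖ + ‖B ζ‖) := by
  refine (norm_solW_le hν A B ht ζ).trans ?_
  have hl := freq_pos ζ
  have he : Real.exp (-rate ν ζ * t) ≤ 1 := by
    apply Real.exp_le_one_iff.2
    have := mul_nonneg (rate_nonneg hν ζ) ht
    linarith
  have he' : Real.exp (-(ν * freq ζ ^ 2 * t)) ≤ 1 := by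
    apply Real.exp_le_one_iff.2
    have : 0 ≤ ν * freq ζ ^ 2 * t := by positivity
    linarith
  have h1 := slowData_le A B ζ
  have h0 := slowData_nonneg A B ζ
  have h2 := abs_waveX_mul_inv_le ζ
  calc _ ≤ 1 * ‖A ζ‖ + 4 / ν * 1 * 1 * (‖A ζ‖ + ‖B ζ‖) := by gcongr
    _ ≤ _ := by have := norm_nonneg (B ζ); linarith

theorem norm_solW'_le_crude (hν : 0 < ν) (A B : ℝ × ℕ → ℂ) {t : ℝ} (ht : 0 ≤ t) (ζ : ℝ × ℕ) :
    ‖solW' ν A B t ζ‖ ≤ (ν + 6) * (freq ζ ^ 2 * (‖A ζ‖ + ‖B ζ‖)) := by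
  have hl := freq_pos ζ
  have h1 := norm_solW_le_crude hν A B ht ζ
  have h2 := norm_solΦ_le hν A B ht ζ
  have h3 : |waveX ζ| ≤ freq ζ ^ 2 := by
    have := abs_waveX_mul_inv_le ζ
    rwa [← div_eq_mul_inv, div_le_one (by positivity)] at this
  unfold solW'
  refine (norm_add_le _ _).trans ?_
  have e : ‖-((ν : ℂ) * (freq ζ : ℂ) ^ 2)‖ = ν * freq ζ ^ 2 := by
    rw [norm_neg, norm_mul, norm_pow, norm_real, norm_real, Real.norm_of_nonneg hν.le,
      Real.norm_of_nonneg hl.le]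
  rw [norm_mul, norm_mul, norm_mul, e, norm_I, one_mul, norm_real, Real.norm_eq_abs]
  calc _ ≤ ν * freq ζ ^ 2 * ((1 + 4 / ν) * (‖A ζ‖ + ‖B ζ‖)) +
        freq ζ ^ 2 * (2 * (‖A ζ‖ + ‖B ζ‖)) := by gcongr
    _ = _ := by field_simp; ring

theorem norm_solΦ'_le_crude (hν : 0 < ν) (A B : ℝ × ℕ → ℂ) {t : ℝ} (ht : 0 ≤ t) (ζ : ℝ × ℕ) :
    ‖solΦ' ν A B t ζ‖ ≤ (1 + 4 / ν) * (freq ζ ^ 2 * (‖A ζ‖ + ‖B ζ‖)) := by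
  have hl := freq_pos ζ
  have h1 := norm_solW_le_crude hν A B ht ζ
  have h2 := abs_waveX_mul_inv_le ζ
  have h3 := one_le_freq_sq ζ
  unfold solΦ'
  rw [norm_mul, norm_mul, norm_mul, norm_I, one_mul, norm_real, Real.norm_eq_abs, norm_inv,
    norm_real, Real.norm_of_nonneg (by positivity : 0 ≤ freq ζ ^ 2)]
  calc _ ≤ 1 * ((1 + 4 / ν) * (1 * (‖A ζ‖ + ‖B ζ‖))) := by
        rw [one_mul (‖A ζ‖ + ‖B ζ‖)]; gcongr
    _ ≤ _ := by rw [one_mul]; gcongr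

/-- The bound for the derivative of a mode, applied to the two fundamental solutions. The initial
slope is `-νλ²` for vorticity data and `p` for `φ` data, which explains the two terms of the fast
part. -/
theorem norm_solW'_le (hν : 0 < ν) (A B : ℝ × ℕ → ℂ) {t : ℝ} (ht : 0 ≤ t) (ζ : ℝ × ℕ) :
    ‖solW' ν A B t ζ‖ ≤ Real.exp (-(ν * freq ζ ^ 2 / 2) * t) *
      ((ν + 2 / ν) * freq ζ ^ 2 * ‖A ζ‖ + |waveX ζ| * ‖B ζ‖) +
      8 / ν ^ 2 * (|waveX ζ| ^ 3 * (freq ζ ^ 6)⁻¹) * Real.exp (-rate ν ζ * t) * slowData A B ζ := by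
  have hl := freq_pos ζ
  have h1 := (isModeSolution_prop ν ζ (1, 0)).bound_deriv_fst hν (one_le_freq_sq ζ) (waveX_sq_le ζ)
    (inv_nonneg.2 hl.le) (freq_data_fst ζ) ht
  have h2 := (isModeSolution_prop ν ζ (0, 1)).bound_deriv_fst hν (one_le_freq_sq ζ) (waveX_sq_le ζ)
    zero_le_one (freq_data_snd ζ) ht
  have z1 : (prop ν ζ 0 (1, 0)).1 = 1 := by simp [prop, modeProp_zero]
  have z2 : (prop ν ζ 0 (0, 1)).1 = 0 := by simp [prop, modeProp_zero]
  have z3 : (prop ν ζ 0 (1, 0)).2 = 0 := by simp [prop, modeProp_zero]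
  have z4 : (prop ν ζ 0 (0, 1)).2 = 1 := by simp [prop, modeProp_zero]
  simp only [z1, z2, z3, z4, abs_one, abs_zero, mul_one, mul_zero, zero_add, add_zero, zero_div,
    zero_mul, abs_neg, abs_of_pos (by positivity : 0 < ν * freq ζ ^ 2)] at h1 h2
  have hex : Real.exp (-(ν * freq ζ ^ 2) * t) ≤ Real.exp (-(ν * freq ζ ^ 2 / 2) * t) := by
    apply Real.exp_le_exp.2
    have : 0 ≤ ν * freq ζ ^ 2 * t := by positivity
    linarith
  have hp : 2 * (waveX ζ ^ 2 / freq ζ ^ 2) / (ν * freq ζ ^ 2) ≤ 2 / ν * freq ζ ^ 2 := by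
    have a1 : waveX ζ ^ 2 / freq ζ ^ 2 ≤ 1 := (div_le_one (by positivity)).2 (waveX_sq_le ζ)
    have a2 := one_le_freq_sq ζ
    calc 2 * (waveX ζ ^ 2 / freq ζ ^ 2) / (ν * freq ζ ^ 2) ≤ 2 * 1 / (ν * 1) := by gcongr
      _ = 2 / ν * 1 := by ring
      _ ≤ _ := by gcongr
  have e : solW' ν A B t ζ = ((-(ν * freq ζ ^ 2) * (prop ν ζ t (1, 0)).1 +
      waveX ζ * (prop ν ζ t (1, 0)).2 : ℝ) : ℂ) * A ζ + I * ((-(ν * freq ζ ^ 2) *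
        (prop ν ζ t (0, 1)).1 + waveX ζ * (prop ν ζ t (0, 1)).2 : ℝ) : ℂ) * B ζ := by
    simp only [solW', solW, solΦ]
    push_cast
    linear_combination (-(waveX ζ * ((prop ν ζ t (1, 0)).2 : ℂ) * A ζ)) * I_sq
  rw [e]
  refine (norm_add_le _ _).trans ?_
  rw [norm_mul, norm_mul, norm_mul, norm_I, one_mul, norm_real, norm_real, Real.norm_eq_abs,
    Real.norm_eq_abs]
  have h1' := h1.trans (add_le_add_left (add_le_add
    (mul_le_mul_of_nonneg_right hex (by positivity : 0 ≤ ν * freq ζ ^ 2))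
    (mul_le_mul_of_nonneg_right hp (Real.exp_pos _).le)) _)
  have h2' := h2.trans (add_le_add_left (mul_le_mul_of_nonneg_right hex (abs_nonneg _)) _)
  refine (add_le_add (mul_le_mul_of_nonneg_right h1' (norm_nonneg _))
    (mul_le_mul_of_nonneg_right h2' (norm_nonneg _))).trans (le_of_eq ?_)
  unfold slowData rate
  field_simp
  ring

end sol

end

section

open Topology Complex

/-! ### Functions with prescribed coefficients -/

open Classical in
/-- The class of `F` in `L²`, and `0` if `F` is not square integrable. -/
def toL2 (F : ℝ × ℕ → ℂ) : L2F := if h : MemLp F 2 μF then h.toLp F else 0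

theorem toL2_eq {F : ℝ × ℕ → ℂ} (h : MemLp F 2 μF) : toL2 F = h.toLp F := dif_pos h

theorem coeFn_toL2 {F : ℝ × ℕ → ℂ} (h : MemLp F 2 μF) : toL2 F =ᵐ[μF] F := by
  rw [toL2_eq h]; exact h.coeFn_toLp

/-- The function on the strip with sine or cosine coefficients `F`. -/
def series (c : Bool) (F : ℝ × ℕ → ℂ) : L2Ω := synth c (toL2 F)

theorem series_add (c : Bool) {F G : ℝ × ℕ → ℂ} (hF : MemLp F 2 μF) (hG : MemLp G 2 μF) :
    series c (F + G) = series c F + series c G := by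
  unfold series
  rw [toL2_eq hF, toL2_eq hG, toL2_eq (hF.add hG), MemLp.toLp_add, map_add]

theorem series_smul (c : Bool) (r : ℝ) {F : ℝ × ℕ → ℂ} (hF : MemLp F 2 μF) :
    series c (r • F) = r • series c F := by
  unfold series
  rw [toL2_eq hF, toL2_eq (hF.const_smul r), MemLp.toLp_const_smul, map_smul]

theorem eLpNorm_series_le (c : Bool) {F : ℝ × ℕ → ℂ} (hF : MemLp F 2 μF) :
    eLpNorm (series c F) 2 μΩ ≤ eLpNorm F 2 μF := by
  unfold series; rw [toL2_eq hF]; exact eLpNorm_synth_le c hF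

theorem memLp_mult {F m : ℝ × ℕ → ℂ} (hF : Measurable F) (hm : Measurable m)
    (h2 : MemLp (fun ζ => ((freq ζ ^ 2 : ℝ) : ℂ) * F ζ) 2 μF) (hb : ∀ ζ, ‖m ζ‖ ≤ freq ζ ^ 2) :
    MemLp (fun ζ => m ζ * F ζ) 2 μF := by
  refine h2.of_le (hm.mul hF).aestronglyMeasurable (Eventually.of_forall fun ζ => ?_)
  rw [norm_mul, norm_mul, norm_real, Real.norm_of_nonneg (by positivity : 0 ≤ freq ζ ^ 2)]
  exact mul_le_mul_of_nonneg_right (hb ζ) (norm_nonneg _)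

theorem eLpNorm_mult_le {F m : ℝ × ℕ → ℂ} (hb : ∀ ζ, ‖m ζ‖ ≤ freq ζ ^ 2) :
    eLpNorm (fun ζ => m ζ * F ζ) 2 μF ≤
      eLpNorm (fun ζ => ((freq ζ ^ 2 : ℝ) : ℂ) * F ζ) 2 μF := by
  refine eLpNorm_mono fun ζ => ?_
  rw [norm_mul, norm_mul, norm_real, Real.norm_of_nonneg (by positivity : 0 ≤ freq ζ ^ 2)]
  exact mul_le_mul_of_nonneg_right (hb ζ) (norm_nonneg _)

theorem measurable_waveX : Measurable waveX := continuous_waveX.measurable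

theorem measurable_waveY : Measurable fun ζ : ℝ × ℕ => waveY ζ.2 :=
  (measurable_from_top (f := waveY)).comp measurable_snd

theorem waveY_pos (n : ℕ) : 0 < waveY n := one_pos.trans_le (one_le_waveY n)

theorem norm_waveX_le (ζ : ℝ × ℕ) : ‖I * (waveX ζ : ℂ)‖ ≤ freq ζ := by
  rw [norm_mul, norm_I, one_mul, norm_real, Real.norm_eq_abs]; exact abs_waveX_le_freq ζ

theorem norm_waveY_le (ζ : ℝ × ℕ) : ‖(waveY ζ.2 : ℂ)‖ ≤ freq ζ := by
  rw [norm_real, Real.norm_of_nonneg (waveY_pos _).le]; exact waveY_le_freq ζ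

theorem le_freq_sq {x : ℝ} {ζ : ℝ × ℕ} (h : x ≤ freq ζ) : x ≤ freq ζ ^ 2 := by
  have := one_le_freq ζ
  nlinarith

theorem mul_le_freq_sq {x y : ℝ} {ζ : ℝ × ℕ} (hy : 0 ≤ y) (hx' : x ≤ freq ζ)
    (hy' : y ≤ freq ζ) : x * y ≤ freq ζ ^ 2 := by
  rw [sq]; exact mul_le_mul hx' hy' hy (freq_pos ζ).le

/-- The derivatives up to order two of a sine series. -/
structure SineDerivs (F : ℝ × ℕ → ℂ) : Prop where
  memLp : MemLp F 2 μF
  vanishes : VanishesOnBoundary (series false F)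
  d₁ : IsWeakDeriv 1 0 (series false F) (series false fun ζ => I * waveX ζ * F ζ)
  d₂ : IsWeakDeriv 0 1 (series false F) (series true fun ζ => waveY ζ.2 * F ζ)
  d₁₁ : IsWeakDeriv 1 0 (series false fun ζ => I * waveX ζ * F ζ)
    (series false fun ζ => (I * waveX ζ * (I * waveX ζ)) * F ζ)
  d₁₂ : IsWeakDeriv 0 1 (series false fun ζ => I * waveX ζ * F ζ)
    (series true fun ζ => (waveY ζ.2 * (I * waveX ζ)) * F ζ)
  d₂₁ : IsWeakDeriv 1 0 (series true fun ζ => waveY ζ.2 * F ζ)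
    (series true fun ζ => (waveY ζ.2 * (I * waveX ζ)) * F ζ)
  d₂₂ : IsWeakDeriv 0 1 (series true fun ζ => waveY ζ.2 * F ζ)
    (series false fun ζ => (-waveY ζ.2 * waveY ζ.2) * F ζ)
  m₁ : MemLp (fun ζ => I * waveX ζ * F ζ) 2 μF
  m₂ : MemLp (fun ζ => waveY ζ.2 * F ζ) 2 μF
  m₁₁ : MemLp (fun ζ => (I * waveX ζ * (I * waveX ζ)) * F ζ) 2 μF
  m₁₂ : MemLp (fun ζ => (waveY ζ.2 * (I * waveX ζ)) * F ζ) 2 μF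
  m₂₂ : MemLp (fun ζ => (-waveY ζ.2 * waveY ζ.2) * F ζ) 2 μF

/-- All multipliers of derivatives up to order two are bounded by `λ²` because `λ ≥ 1`. Vertical
derivatives alternate between sine and cosine series. -/
theorem sineDerivs {F : ℝ × ℕ → ℂ} (hF : Measurable F)
    (h2 : MemLp (fun ζ => ((freq ζ ^ 2 : ℝ) : ℂ) * F ζ) 2 μF) : SineDerivs F := by
  have hx := measurable_waveX
  have hy := measurable_waveY
  have m0 : MemLp F 2 μF := by
    simpa using memLp_mult hF (m := fun _ => 1) measurable_const h2
      (fun ζ => by simpa using one_le_freq_sq ζ)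
  have m1 := memLp_mult hF (m := fun ζ => I * waveX ζ) (by fun_prop) h2 (fun ζ => le_freq_sq (norm_waveX_le ζ))
  have m2 := memLp_mult hF (m := fun ζ => (waveY ζ.2 : ℂ)) (by fun_prop) h2
    (fun ζ => le_freq_sq (norm_waveY_le ζ))
  have m11 := memLp_mult hF (m := fun ζ => I * waveX ζ * (I * waveX ζ)) (by fun_prop) h2
    (fun ζ => by rw [norm_mul]; exact mul_le_freq_sq (norm_nonneg _) (norm_waveX_le ζ) (norm_waveX_le ζ))
  have m12 := memLp_mult hF (m := fun ζ => waveY ζ.2 * (I * waveX ζ)) (by fun_prop) h2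
    (fun ζ => by rw [norm_mul]; exact mul_le_freq_sq (norm_nonneg _) (norm_waveY_le ζ) (norm_waveX_le ζ))
  have m22 := memLp_mult hF (m := fun ζ => -waveY ζ.2 * waveY ζ.2) (by fun_prop) h2
    (fun ζ => by
      rw [norm_mul, norm_neg]; exact mul_le_freq_sq (norm_nonneg _) (norm_waveY_le ζ) (norm_waveY_le ζ))
  refine ⟨m0, ?_, ?_, ?_, ?_, ?_, ?_, ?_, m1, m2, m11, m12, m22⟩
  all_goals unfold series
  · rw [toL2_eq m0]; exact (synth_sine_snd m0 m2 fun _ => rfl).2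
  · rw [toL2_eq m0, toL2_eq m1]; exact isWeakDeriv_synth_fst _ m0 m1 fun _ => rfl
  · rw [toL2_eq m0, toL2_eq m2]; exact (synth_sine_snd m0 m2 fun _ => rfl).1
  · rw [toL2_eq m1, toL2_eq m11]; exact isWeakDeriv_synth_fst _ m1 m11 fun _ => by ring
  · rw [toL2_eq m1, toL2_eq m12]; exact (synth_sine_snd m1 m12 fun _ => by ring).1
  · rw [toL2_eq m2, toL2_eq m12]; exact isWeakDeriv_synth_fst _ m2 m12 fun _ => by ring
  · rw [toL2_eq m2, toL2_eq m22]; exact isWeakDeriv_synth_cosine_snd m2 m22 fun _ => by ring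

theorem SineDerivs.memW {F : ℝ × ℕ → ℂ} (h : SineDerivs F) : MemW 2 2 (series false F) := by
  refine ⟨Lp.memLp _, fun a b hab => ?_⟩
  have : (a = 0 ∧ b = 0) ∨ (a = 1 ∧ b = 0) ∨ (a = 0 ∧ b = 1) ∨ (a = 2 ∧ b = 0) ∨ (a = 1 ∧ b = 1) ∨
      (a = 0 ∧ b = 2) := by omega
  rcases this with ⟨rfl, rfl⟩ | ⟨rfl, rfl⟩ | ⟨rfl, rfl⟩ | ⟨rfl, rfl⟩ | ⟨rfl, rfl⟩ | ⟨rfl, rfl⟩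
  · exact ⟨_, IsWeakDeriv.refl h.d₁.1, Lp.memLp _⟩
  · exact ⟨_, h.d₁, Lp.memLp _⟩
  · exact ⟨_, h.d₂, Lp.memLp _⟩
  · exact ⟨_, h.d₁.trans h.d₁₁, Lp.memLp _⟩
  · exact ⟨_, h.d₁.trans h.d₁₂, Lp.memLp _⟩
  · exact ⟨_, h.d₂.trans h.d₂₂, Lp.memLp _⟩

theorem SineDerivs.isLaplacian {F : ℝ × ℕ → ℂ} (h : SineDerivs F) {u : L2Ω}
    (hu : u = series false fun ζ => -((freq ζ ^ 2 : ℝ) : ℂ) * F ζ) :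
    IsLaplacian (series false F) u := by
  refine ⟨_, _, h.d₁.trans h.d₁₁, h.d₂.trans h.d₂₂, ?_⟩
  have e : (fun ζ => -((freq ζ ^ 2 : ℝ) : ℂ) * F ζ) = (fun ζ => (I * waveX ζ * (I * waveX ζ)) * F ζ) +
      fun ζ => (-waveY ζ.2 * waveY ζ.2) * F ζ := by
    ext ζ
    rw [Pi.add_apply, freq_sq]
    push_cast
    linear_combination (-(waveX ζ : ℂ) ^ 2 * F ζ) * I_sq
  rw [hu, e, series_add false h.m₁₁ h.m₂₂]
  exact Lp.coeFn_add _ _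

section norms

variable {F : ℝ × ℕ → ℂ}

theorem eLpNorm_series_mult_le (c : Bool) {m : ℝ × ℕ → ℂ} (hm : MemLp (fun ζ => m ζ * F ζ) 2 μF)
    (hb : ∀ ζ, ‖m ζ‖ ≤ freq ζ ^ 2) : eLpNorm (series c fun ζ => m ζ * F ζ) 2 μΩ ≤
      eLpNorm (fun ζ => ((freq ζ ^ 2 : ℝ) : ℂ) * F ζ) 2 μF :=
  (eLpNorm_series_le c hm).trans (eLpNorm_mult_le hb)

theorem SineDerivs.norm_bounds (h : SineDerivs F) {x : ℝ≥0∞}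
    (hx : eLpNorm (fun ζ => ((freq ζ ^ 2 : ℝ) : ℂ) * F ζ) 2 μF ≤ x) :
    eLpNorm (series false F) 2 μΩ ≤ x ∧
    eLpNorm (series false fun ζ => I * waveX ζ * F ζ) 2 μΩ ≤ x ∧
    eLpNorm (series true fun ζ => waveY ζ.2 * F ζ) 2 μΩ ≤ x ∧
    eLpNorm (series false fun ζ => (I * waveX ζ * (I * waveX ζ)) * F ζ) 2 μΩ ≤ x ∧
    eLpNorm (series true fun ζ => (waveY ζ.2 * (I * waveX ζ)) * F ζ) 2 μΩ ≤ x ∧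
    eLpNorm (series false fun ζ => (-waveY ζ.2 * waveY ζ.2) * F ζ) 2 μΩ ≤ x := by
  refine ⟨?_, ?_, ?_, ?_, ?_, ?_⟩
  · have := eLpNorm_series_mult_le false (F := F) (m := fun _ => 1) (by simpa using h.memLp)
      (fun ζ => by simpa using one_le_freq_sq ζ)
    simp only [one_mul] at this
    exact this.trans hx
  · exact (eLpNorm_series_mult_le _ h.m₁ fun ζ => le_freq_sq (norm_waveX_le ζ)).trans hx
  · exact (eLpNorm_series_mult_le _ h.m₂ fun ζ => le_freq_sq (norm_waveY_le ζ)).trans hx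
  · refine (eLpNorm_series_mult_le _ h.m₁₁ fun ζ => ?_).trans hx
    rw [norm_mul]; exact mul_le_freq_sq (norm_nonneg _) (norm_waveX_le ζ) (norm_waveX_le ζ)
  · refine (eLpNorm_series_mult_le _ h.m₁₂ fun ζ => ?_).trans hx
    rw [norm_mul]; exact mul_le_freq_sq (norm_nonneg _) (norm_waveY_le ζ) (norm_waveX_le ζ)
  · refine (eLpNorm_series_mult_le _ h.m₂₂ fun ζ => ?_).trans hx
    rw [norm_mul, norm_neg]; exact mul_le_freq_sq (norm_nonneg _) (norm_waveY_le ζ) (norm_waveY_le ζ)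

theorem wNorm_one (p : ℝ≥0∞) (f : ℝ × ℝ → ℝ) :
    wNorm 1 p f = derivNorm 0 1 p f + derivNorm 1 0 p f + eLpNorm f p μΩ := by
  unfold wNorm
  rw [Finset.Nat.sum_antidiagonal_eq_sum_range_succ_mk]
  simp [Finset.sum_range_succ]

theorem wNorm_two (p : ℝ≥0∞) (f : ℝ × ℝ → ℝ) :
    wNorm 2 p f = derivNorm 0 2 p f + derivNorm 1 1 p f + derivNorm 2 0 p f + eLpNorm f p μΩ := by
  unfold wNorm
  rw [Finset.Nat.sum_antidiagonal_eq_sum_range_succ_mk]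
  simp [Finset.sum_range_succ]

theorem SineDerivs.wNorm_two_le (h : SineDerivs F) {x : ℝ≥0∞}
    (hx : eLpNorm (fun ζ => ((freq ζ ^ 2 : ℝ) : ℂ) * F ζ) 2 μF ≤ x) :
    wNorm 2 2 (series false F) ≤ 4 * x := by
  obtain ⟨b0, b1, b2, b11, b12, b22⟩ := h.norm_bounds hx
  rw [wNorm_two, derivNorm_eq (h.d₁.trans h.d₁₁), derivNorm_eq (h.d₁.trans h.d₁₂),
    derivNorm_eq (h.d₂.trans h.d₂₂)]
  calc _ ≤ x + x + x + x := by gcongr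
    _ = 4 * x := by ring

theorem SineDerivs.wNorm_gradient_le (h : SineDerivs F) {x : ℝ≥0∞}
    (hx : eLpNorm (fun ζ => ((freq ζ ^ 2 : ℝ) : ℂ) * F ζ) 2 μF ≤ x) :
    wNorm 1 2 (series false fun ζ => I * waveX ζ * F ζ) +
      wNorm 1 2 (series true fun ζ => waveY ζ.2 * F ζ) ≤ 6 * x := by
  obtain ⟨b0, b1, b2, b11, b12, b22⟩ := h.norm_bounds hx
  rw [wNorm_one, wNorm_one, derivNorm_eq h.d₁₁, derivNorm_eq h.d₁₂, derivNorm_eq h.d₂₁,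
    derivNorm_eq h.d₂₂]
  calc _ ≤ x + x + x + (x + x + x) := by gcongr
    _ = 6 * x := by ring

end norms

/-! ### Existence -/

/-- Coefficients of data with the decay that the construction of the solution needs. -/
structure DataBound (A B : ℝ × ℕ → ℂ) (N : ℝ) : Prop where
  meas_A : Measurable A
  meas_B : Measurable B
  bound : ∀ ζ, freq ζ ^ 4 * (‖A ζ‖ + ‖B ζ‖) ≤ N

/-- The weight `λ⁻⁴` is integrable over the frequencies, so decay of order two suffices. -/
theorem memLp_of_le_freq {F : ℝ × ℕ → ℂ} (hF : Measurable F) {N : ℝ}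
    (h : ∀ ζ, freq ζ ^ 2 * ‖F ζ‖ ≤ N) : MemLp F 2 μF := by
  refine ⟨hF.aestronglyMeasurable, lt_of_le_of_lt (eLpNorm_two_le
    (x := ENNReal.ofReal (N * √(freqMass / 2))) ?_) ENNReal.ofReal_lt_top⟩
  have hN : 0 ≤ N := le_trans (by positivity) (h (0, 0))
  have hM := freqMass_nonneg
  have hpt : ∀ ζ, ‖F ζ‖ₑ ^ 2 ≤ ENNReal.ofReal (N ^ 2) * ENNReal.ofReal ((freq ζ ^ 4)⁻¹) := by
    intro ζ
    have hl := freq_pos ζ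
    rw [← ofReal_norm, ← ENNReal.ofReal_pow (norm_nonneg _), ← ENNReal.ofReal_mul (by positivity)]
    apply ENNReal.ofReal_le_ofReal
    rw [← div_eq_mul_inv, le_div_iff₀ (by positivity)]
    calc ‖F ζ‖ ^ 2 * freq ζ ^ 4 = (freq ζ ^ 2 * ‖F ζ‖) ^ 2 := by ring
      _ ≤ N ^ 2 := by gcongr; exact h ζ
  refine (lintegral_mono hpt).trans ?_
  rw [lintegral_const_mul' _ _ ENNReal.ofReal_ne_top, ← ENNReal.ofReal_pow (by positivity), mul_pow,
    Real.sq_sqrt (by positivity), ENNReal.ofReal_mul (by positivity)]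
  gcongr
  exact lintegral_freq_le

section existence

variable {ν N : ℝ} {A B : ℝ × ℕ → ℂ}

/-- Two of the four available powers of `λ` are spent on second derivatives and two on square
integrability. -/
theorem DataBound.sineDerivs_of_le (h : DataBound A B N) {F : ℝ × ℕ → ℂ} (hF : Measurable F) {c : ℝ}
    (hc : 0 ≤ c) (hb : ∀ ζ, ‖F ζ‖ ≤ c * (‖A ζ‖ + ‖B ζ‖)) : SineDerivs F := by
  refine sineDerivs hF (memLp_of_le_freq (N := c * N) ?_ fun ζ => ?_)
  · have := continuous_freq.measurable
    fun_prop
  rw [norm_mul, norm_real, Real.norm_of_nonneg (by positivity : 0 ≤ freq ζ ^ 2)]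
  calc freq ζ ^ 2 * (freq ζ ^ 2 * ‖F ζ‖) ≤ freq ζ ^ 2 * (freq ζ ^ 2 * (c * (‖A ζ‖ + ‖B ζ‖))) := by
        gcongr; exact hb ζ
    _ = c * (freq ζ ^ 4 * (‖A ζ‖ + ‖B ζ‖)) := by ring
    _ ≤ c * N := by gcongr; exact h.bound ζ

theorem DataBound.memLp_of_le (h : DataBound A B N) {F : ℝ × ℕ → ℂ} (hF : Measurable F) {c : ℝ}
    (hc : 0 ≤ c) (hb : ∀ ζ, ‖F ζ‖ ≤ c * (freq ζ ^ 2 * (‖A ζ‖ + ‖B ζ‖))) : MemLp F 2 μF := by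
  refine memLp_of_le_freq hF (N := c * N) fun ζ => ?_
  calc freq ζ ^ 2 * ‖F ζ‖ ≤ freq ζ ^ 2 * (c * (freq ζ ^ 2 * (‖A ζ‖ + ‖B ζ‖))) := by
        gcongr; exact hb ζ
    _ = c * (freq ζ ^ 4 * (‖A ζ‖ + ‖B ζ‖)) := by ring
    _ ≤ c * N := by gcongr; exact h.bound ζ

theorem DataBound.memLp_dom (h : DataBound A B N) {c : ℝ} (hc : 0 ≤ c) :
    MemLp (fun ζ => c * (freq ζ ^ 2 * (‖A ζ‖ + ‖B ζ‖))) 2 μF := by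
  have h1 := h.meas_A
  have h2 := h.meas_B
  have h3 := continuous_freq.measurable
  have := h.memLp_of_le (F := fun ζ => ((c * (freq ζ ^ 2 * (‖A ζ‖ + ‖B ζ‖)) : ℝ) : ℂ))
    (by fun_prop) hc (fun ζ => by
      rw [norm_real, Real.norm_of_nonneg (by positivity)])
  exact this.re

theorem DataBound.sineDerivs_solW (hν : 0 < ν) (h : DataBound A B N) {t : ℝ} (ht : 0 ≤ t) :
    SineDerivs (solW ν A B t) :=
  h.sineDerivs_of_le (measurable_solW h.meas_A h.meas_B t) (by positivity)
    (fun ζ => norm_solW_le_crude hν A B ht ζ)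

theorem DataBound.sineDerivs_solΦ (hν : 0 < ν) (h : DataBound A B N) {t : ℝ} (ht : 0 ≤ t) :
    SineDerivs (solΦ ν A B t) :=
  h.sineDerivs_of_le (measurable_solΦ h.meas_A h.meas_B t) (by positivity)
    (fun ζ => norm_solΦ_le hν A B ht ζ)

theorem DataBound.memLp_solW' (hν : 0 < ν) (h : DataBound A B N) {t : ℝ} (ht : 0 ≤ t) :
    MemLp (solW' ν A B t) 2 μF :=
  h.memLp_of_le (measurable_solW' h.meas_A h.meas_B t) (by positivity)
    (fun ζ => norm_solW'_le_crude hν A B ht ζ)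

theorem DataBound.memLp_solΦ' (hν : 0 < ν) (h : DataBound A B N) {t : ℝ} (ht : 0 ≤ t) :
    MemLp (solΦ' ν A B t) 2 μF :=
  h.memLp_of_le (measurable_solΦ' h.meas_A h.meas_B t) (by positivity)
    (fun ζ => norm_solΦ'_le_crude hν A B ht ζ)

theorem DataBound.hasDerivAt_W (hν : 0 < ν) (h : DataBound A B N) {t : ℝ} (ht : 0 < t) :
    HasDerivAt (fun t => series false (solW ν A B t)) (series false (solW' ν A B t)) t := by
  have := hasDerivAt_curve (μ := μF) (Φ := fun t => toL2 (solW ν A B t)) (Ψ := toL2 (solW' ν A B t))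
    (measurable_solW h.meas_A h.meas_B) (measurable_solW' h.meas_A h.meas_B) (hasDerivAt_solW ν A B)
    (fun t ht ζ => norm_solW'_le_crude hν A B ht ζ) (h.memLp_dom (by positivity))
    (fun t ht => coeFn_toL2 (h.sineDerivs_solW hν ht).memLp) ht (coeFn_toL2 (h.memLp_solW' hν ht.le))
  exact (synth false).hasFDerivAt.comp_hasDerivAt t this

theorem DataBound.hasDerivAt_Φ (hν : 0 < ν) (h : DataBound A B N) {t : ℝ} (ht : 0 < t) :
    HasDerivAt (fun t => series false (solΦ ν A B t)) (series false (solΦ' ν A B t)) t := by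
  have := hasDerivAt_curve (μ := μF) (Φ := fun t => toL2 (solΦ ν A B t)) (Ψ := toL2 (solΦ' ν A B t))
    (measurable_solΦ h.meas_A h.meas_B) (measurable_solΦ' h.meas_A h.meas_B) (hasDerivAt_solΦ ν A B)
    (fun t ht ζ => norm_solΦ'_le_crude hν A B ht ζ) (h.memLp_dom (by positivity))
    (fun t ht => coeFn_toL2 (h.sineDerivs_solΦ hν ht).memLp) ht (coeFn_toL2 (h.memLp_solΦ' hν ht.le))
  exact (synth false).hasFDerivAt.comp_hasDerivAt t this

theorem series_rcoeff {f : ℝ × ℝ → ℝ} (h1 : MemLp f 1 μΩ) (h2 : MemLp f 2 μΩ) :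
    series false (rcoeff false f) =ᵐ[μΩ] f := by
  have hi : Integrable (fun z => (f z : ℂ)) μΩ := (memLp_one_iff_integrable.1 h1).ofReal
  have h2' : MemLp (fun z => (f z : ℂ)) 2 μΩ := h2.ofReal
  have e : toComplex (h2.toLp f) = h2'.toLp _ := by
    apply Lp.ext
    filter_upwards [coeFn_toComplex (h2.toLp f), h2.coeFn_toLp, h2'.coeFn_toLp] with z a b c
    rw [a, b, c]
  have := synth_transform (h2.toLp f)
  rw [e, transform_of_integrable false hi h2'] at this
  have hm : MemLp (rcoeff false f) 2 μF := memLp_coeff false hi h2'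
  have e2 : series false (rcoeff false f) = h2.toLp f := by
    unfold series
    rw [toL2_eq hm, ← this]
    rfl
  rw [e2]
  exact h2.coeFn_toLp

/-- On the side of the coefficients all equations are pointwise identities; the work lies in the
membership of each series in `L²`. -/
theorem isSolution_series (hν : 0 < ν) {w₀ φ₀ : ℝ × ℝ → ℝ}
    (h : DataBound (rcoeff false w₀) (rcoeff false φ₀) N) (w1 : MemLp w₀ 1 μΩ) (w2 : MemLp w₀ 2 μΩ)
    (p1 : MemLp φ₀ 1 μΩ) (p2 : MemLp φ₀ 2 μΩ) :
    IsSolution ν w₀ φ₀ (fun t => series false (solW ν (rcoeff false w₀) (rcoeff false φ₀) t))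
      (fun t => series false (solΦ ν (rcoeff false w₀) (rcoeff false φ₀) t)) := by
  set A := rcoeff false w₀
  set B := rcoeff false φ₀
  refine ⟨?_, ?_, ?_, ?_, ?_, ?_, ?_, ?_⟩
  · exact (synth false).continuous.comp_continuousOn (continuousOn_curve (μ := μF)
      (Φ := fun t => toL2 (solW ν A B t)) (hasDerivAt_solW ν A B)
      (fun t ht ζ => norm_solW'_le_crude hν A B ht ζ) (h.memLp_dom (by positivity))
      (fun t ht => coeFn_toL2 (h.sineDerivs_solW hν ht).memLp))
  · exact (synth false).continuous.comp_continuousOn (continuousOn_curve (μ := μF)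
      (Φ := fun t => toL2 (solΦ ν A B t)) (hasDerivAt_solΦ ν A B)
      (fun t ht ζ => norm_solΦ'_le_crude hν A B ht ζ) (h.memLp_dom (by positivity))
      (fun t ht => coeFn_toL2 (h.sineDerivs_solΦ hν ht).memLp))
  · simp only [solW_zero]; exact series_rcoeff w1 w2
  · simp only [solΦ_zero]; exact series_rcoeff p1 p2
  · exact fun t ht => (h.sineDerivs_solW hν ht.le).memW
  · exact fun t ht => (h.sineDerivs_solW hν ht.le).vanishes
  · intro t ht
    have hW := h.sineDerivs_solW hν ht.le
    have hP := h.sineDerivs_solΦ hν ht.le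
    refine ⟨_, _, _, h.hasDerivAt_W hν ht, hW.isLaplacian rfl, hP.d₁, ?_⟩
    have hm : MemLp (fun ζ => -((freq ζ ^ 2 : ℝ) : ℂ) * solW ν A B t ζ) 2 μF := by
      have := hW.m₁₁.add hW.m₂₂
      refine this.congr_norm ?_ ?_
      · have h1 := measurable_solW (ν := ν) h.meas_A h.meas_B t
        have h3 := continuous_freq.measurable
        exact (by fun_prop : Measurable _).aestronglyMeasurable
      · refine Eventually.of_forall fun ζ => ?_
        rw [Pi.add_apply, ← add_mul, norm_mul, norm_mul]
        congr 2
        rw [freq_sq]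
        push_cast
        linear_combination ((waveX ζ : ℂ) ^ 2) * I_sq
    have e : solW' ν A B t = ν • (fun ζ => -((freq ζ ^ 2 : ℝ) : ℂ) * solW ν A B t ζ) +
        fun ζ => I * waveX ζ * solΦ ν A B t ζ := by
      ext ζ
      simp only [solW', Pi.add_apply, Pi.smul_apply, real_smul]
      push_cast
      ring
    have e2 : series false (solW' ν A B t) =
        ν • (series false fun ζ => -((freq ζ ^ 2 : ℝ) : ℂ) * solW ν A B t ζ) +
          series false fun ζ => I * waveX ζ * solΦ ν A B t ζ := by
      rw [e, series_add false (hm.const_smul ν) hP.m₁, series_smul false ν hm]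
    rw [e2]
    filter_upwards [Lp.coeFn_add (ν • (series false fun ζ => -((freq ζ ^ 2 : ℝ) : ℂ) * solW ν A B t ζ))
      (series false fun ζ => I * waveX ζ * solΦ ν A B t ζ), Lp.coeFn_smul ν
      (series false fun ζ => -((freq ζ ^ 2 : ℝ) : ℂ) * solW ν A B t ζ)] with z h1 h2
    rw [h1, Pi.add_apply, h2, Pi.smul_apply, smul_eq_mul]
    ring
  · intro t ht
    have hW := h.sineDerivs_solW hν ht.le
    -- The stream function has the coefficients of `w` divided by `λ²`.
    have hψ : SineDerivs fun ζ => ((freq ζ ^ 2 : ℝ) : ℂ)⁻¹ * solW ν A B t ζ := by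
      refine h.sineDerivs_of_le ?_ (by positivity : 0 ≤ 1 + 4 / ν) fun ζ => ?_
      · have h1 := measurable_solW (ν := ν) h.meas_A h.meas_B t
        have h3 := continuous_freq.measurable
        fun_prop
      · have hl := freq_pos ζ
        rw [norm_mul, norm_inv, norm_real, Real.norm_of_nonneg (by positivity : 0 ≤ freq ζ ^ 2)]
        exact (mul_le_of_le_one_left (norm_nonneg _) (inv_le_one_of_one_le₀ (one_le_freq_sq ζ))).trans
          (norm_solW_le_crude hν A B ht.le ζ)
    have hc : ∀ ζ, ((freq ζ ^ 2 : ℝ) : ℂ) ≠ 0 := fun ζ => by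
      exact_mod_cast (pow_pos (freq_pos ζ) 2).ne'
    refine ⟨_, _, _, _, h.hasDerivAt_Φ hν ht, ⟨hψ.memW, hψ.vanishes, ?_⟩, hψ.d₁, rfl, ?_⟩
    · have e : (-1 : ℝ) • solW ν A B t = fun ζ => -((freq ζ ^ 2 : ℝ) : ℂ) *
          (((freq ζ ^ 2 : ℝ) : ℂ)⁻¹ * solW ν A B t ζ) := by
        ext ζ
        rw [neg_mul, mul_inv_cancel_left₀ (hc ζ)]
        simp
      obtain ⟨g₁, g₂, d1, d2, d3⟩ := hψ.isLaplacian (u := -series false (solW ν A B t)) (by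
        rw [← e, series_smul false _ hW.memLp, neg_one_smul])
      exact ⟨g₁, g₂, d1, d2, (Lp.coeFn_neg _).symm.trans d3⟩
    · have e : solΦ' ν A B t = fun ζ => I * waveX ζ * (((freq ζ ^ 2 : ℝ) : ℂ)⁻¹ * solW ν A B t ζ) := by
        ext ζ; simp only [solΦ']; ring
      rw [e]
      exact Eventually.of_forall fun z => by simp

end existence

end

section

open Topology Complex

/-! ### Uniqueness -/

/-- The sine coefficients of a real function. -/
def sineCoeff : L2Ω →L[ℝ] L2F := ((transform false).restrictScalars ℝ).comp toComplex

theorem sineCoeff_injective : Function.Injective sineCoeff := fun f g h => by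
  rw [← synth_transform f, ← synth_transform g]
  exact congrArg (synth false) h

theorem sineCoeff_deriv_fst {f g : L2Ω} (h : IsWeakDeriv 1 0 f g) :
    ∀ᵐ ζ ∂μF, sineCoeff g ζ = I * waveX ζ * sineCoeff f ζ := transform_deriv_fst h

/-- Membership in `H²` and zero trace are all that is used, so the diagonalisation applies to an
arbitrary solution and not only to a sine series. -/
theorem sineCoeff_laplacian {f u : L2Ω} (hf : MemW 2 2 f) (hv : VanishesOnBoundary f)
    (hu : IsLaplacian f u) :
    ∀ᵐ ζ ∂μF, sineCoeff u ζ = -((freq ζ ^ 2 : ℝ) : ℂ) * sineCoeff f ζ := by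
  obtain ⟨g₁, g₂, h₁, h₂, he⟩ := hu
  have m₁ := hf.memLp (by norm_num) h₁
  have m₂ := hf.memLp (by norm_num) h₂
  obtain ⟨f₁, hf₁, n₁⟩ := hf.2 1 0 (by norm_num)
  obtain ⟨f₂, hf₂, n₂⟩ := hf.2 0 1 (by norm_num)
  have a₁ := sineCoeff_deriv_fst (hf₁.congr (EventuallyEq.refl _ _) n₁.coeFn_toLp.symm)
  have a₂ := sineCoeff_deriv_fst (f := n₁.toLp f₁) (g := m₁.toLp g₁)
    ((hf₁.of_add (c := 1) (d := 0) h₁).congr n₁.coeFn_toLp.symm m₁.coeFn_toLp.symm)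
  have a₃ : ∀ᵐ ζ ∂μF, sineCoeff (m₂.toLp g₂) ζ = -(waveY ζ.2 : ℂ) ^ 2 * sineCoeff f ζ :=
    transform_deriv_snd n₂ hf₂ ((hf₂.of_add (c := 0) (d := 1) h₂).congr (EventuallyEq.refl _ _)
      m₂.coeFn_toLp.symm) hv
  have e : u = m₁.toLp g₁ + m₂.toLp g₂ := by
    apply Lp.ext
    filter_upwards [he, Lp.coeFn_add (m₁.toLp g₁) (m₂.toLp g₂), m₁.coeFn_toLp, m₂.coeFn_toLp]
      with z h1 h2 h3 h4
    rw [h1, h2, Pi.add_apply, Pi.add_apply, h3, h4]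
  rw [e, map_add]
  filter_upwards [a₁, a₂, a₃, Lp.coeFn_add (sineCoeff (m₁.toLp g₁)) (sineCoeff (m₂.toLp g₂))]
    with ζ h1 h2 h3 h4
  rw [h4, Pi.add_apply, h2, h1, h3, freq_sq]
  push_cast
  linear_combination ((waveX ζ : ℂ) ^ 2 * sineCoeff f ζ) * I_sq

section solution

variable {ν : ℝ} {w₀ φ₀ : ℝ × ℝ → ℝ} {w φ : ℝ → L2Ω}

theorem IsSolution.sineCoeff_w (h : IsSolution ν w₀ φ₀ w φ) {t : ℝ} (ht : 0 < t) :
    ∃ wt : L2Ω, HasDerivAt w wt t ∧ ∀ᵐ ζ ∂μF, sineCoeff wt ζ =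
      -(ν * freq ζ ^ 2) * sineCoeff (w t) ζ + I * waveX ζ * sineCoeff (φ t) ζ := by
  obtain ⟨wt, lap, φx, hd, hl, hx, he⟩ := h.eq_w t ht
  have ml : MemLp lap 2 μΩ := by
    obtain ⟨g₁, g₂, h₁, h₂, he⟩ := hl
    exact (((h.reg_w t ht).memLp (by norm_num) h₁).add ((h.reg_w t ht).memLp (by norm_num) h₂)).ae_eq
      he.symm
  refine ⟨wt, hd, ?_⟩
  have a₁ : ∀ᵐ ζ ∂μF, sineCoeff (ml.toLp lap) ζ = -((freq ζ ^ 2 : ℝ) : ℂ) * sineCoeff (w t) ζ := by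
    refine sineCoeff_laplacian (h.reg_w t ht) (h.boundary_w t ht) ?_
    obtain ⟨g₁, g₂, h₁, h₂, he⟩ := hl
    exact ⟨g₁, g₂, h₁, h₂, ml.coeFn_toLp.trans he⟩
  -- A solution is not assumed to have `∂₁φ` in `L²`; the equation itself shows it, since `∂₁φ = ∂ₜw
  -- - νΔw`.
  have a₂ := sineCoeff_deriv_fst (f := φ t) (g := wt - ν • ml.toLp lap) (hx.congr
    (EventuallyEq.refl _ _) (by
      filter_upwards [he, Lp.coeFn_sub wt (ν • ml.toLp lap), Lp.coeFn_smul ν (ml.toLp lap),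
        ml.coeFn_toLp] with z h1 h2 h3 h4
      rw [h2, Pi.sub_apply, h3, Pi.smul_apply, h4, smul_eq_mul, h1]))
  rw [map_sub, map_smul] at a₂
  filter_upwards [a₁, a₂, Lp.coeFn_sub (sineCoeff wt) (ν • sineCoeff (ml.toLp lap)),
    Lp.coeFn_smul ν (sineCoeff (ml.toLp lap))] with ζ h1 h2 h3 h4
  rw [h3, Pi.sub_apply, h4, Pi.smul_apply, h1, real_smul] at h2
  push_cast at h2
  linear_combination h2

theorem IsSolution.sineCoeff_φ (h : IsSolution ν w₀ φ₀ w φ) {t : ℝ} (ht : 0 < t) :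
    ∃ φt : L2Ω, HasDerivAt φ φt t ∧ ∀ᵐ ζ ∂μF, sineCoeff φt ζ =
      I * waveX ζ * ((freq ζ ^ 2 : ℝ) : ℂ)⁻¹ * sineCoeff (w t) ζ := by
  obtain ⟨φt, u₂, ψ, ψx, hd, ⟨hW, hv, hl⟩, hx, rfl, he⟩ := h.eq_φ t ht
  refine ⟨φt, hd, ?_⟩
  have eψ := hW.1.coeFn_toLp.symm
  have hWψ : MemW 2 2 (hW.1.toLp ψ) := ⟨Lp.memLp _, fun a b hab => by
    obtain ⟨g, hg, hg'⟩ := hW.2 a b hab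
    exact ⟨g, hg.congr eψ (EventuallyEq.refl _ _), hg'⟩⟩
  have a₁ := sineCoeff_laplacian (f := hW.1.toLp ψ) (u := -w t) hWψ (hv.congr eψ) (by
    obtain ⟨g₁, g₂, h₁, h₂, he⟩ := hl
    exact ⟨g₁, g₂, h₁.congr eψ (EventuallyEq.refl _ _), h₂.congr eψ (EventuallyEq.refl _ _),
      (Lp.coeFn_neg _).trans he⟩)
  have a₂ := sineCoeff_deriv_fst (f := hW.1.toLp ψ) (g := φt) (hx.congr eψ (by
    filter_upwards [he] with z hz
    simp only [Pi.neg_apply] at hz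
    linarith))
  rw [map_neg] at a₁
  filter_upwards [a₁, a₂, Lp.coeFn_neg (sineCoeff (w t))] with ζ h1 h2 h3
  have hc : ((freq ζ ^ 2 : ℝ) : ℂ) ≠ 0 := by exact_mod_cast (pow_pos (freq_pos ζ) 2).ne'
  rw [h3, Pi.neg_apply, neg_mul, neg_inj] at h1
  rw [h2, h1, mul_assoc _ (_)⁻¹, inv_mul_cancel_left₀ hc]

end solution

/-! ### The energy on the frequency side -/

theorem memLp_dampen (F : L2F) : MemLp (fun ζ => ((freq ζ)⁻¹ : ℂ) * F ζ) 2 μF := by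
  have hf := continuous_freq.measurable
  refine (Lp.memLp F).of_le ((by fun_prop : Measurable fun ζ => ((freq ζ)⁻¹ : ℂ)).aestronglyMeasurable.mul
    (Lp.aestronglyMeasurable F)) (Eventually.of_forall fun ζ => ?_)
  rw [norm_mul, norm_inv, norm_real, Real.norm_of_nonneg (freq_pos ζ).le]
  exact mul_le_of_le_one_left (norm_nonneg _) (inv_le_one_of_one_le₀ (one_le_freq ζ))

/-- Division by the length of the wave vector. -/
def dampen : L2F →L[ℝ] L2F :=
  LinearMap.mkContinuous
    { toFun := fun F => (memLp_dampen F).toLp _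
      map_add' := fun F G => by
        rw [← MemLp.toLp_add]
        apply MemLp.toLp_congr
        filter_upwards [Lp.coeFn_add F G] with ζ h
        rw [h, Pi.add_apply, mul_add]; rfl
      map_smul' := fun r F => by
        rw [RingHom.id_apply, ← MemLp.toLp_const_smul]
        apply MemLp.toLp_congr
        filter_upwards [Lp.coeFn_smul r F] with ζ h
        rw [h, Pi.smul_apply, Pi.smul_apply, mul_smul_comm] } 1 fun F => by
    refine Lp.norm_le_mul_norm_of_ae_le_mul ?_
    filter_upwards [(memLp_dampen F).coeFn_toLp] with ζ h
    change ‖((memLp_dampen F).toLp _ : ℝ × ℕ → ℂ) ζ‖ ≤ _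
    rw [h, norm_mul, norm_inv, norm_real, Real.norm_of_nonneg (freq_pos ζ).le]
    exact mul_le_mul_of_nonneg_right (inv_le_one_of_one_le₀ (one_le_freq ζ)) (norm_nonneg _)

theorem coeFn_dampen (F : L2F) : dampen F =ᵐ[μF] fun ζ => ((freq ζ)⁻¹ : ℂ) * F ζ :=
  (memLp_dampen F).coeFn_toLp

theorem dampen_injective {F : L2F} (h : dampen F = 0) : F = 0 := by
  apply Lp.ext
  have h0 : dampen F =ᵐ[μF] (0 : L2F) := by rw [h]
  filter_upwards [coeFn_dampen F, h0, Lp.coeFn_zero ℂ 2 μF] with ζ h1 h2 h3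
  rw [h3, Pi.zero_apply]
  rw [h1, h3, Pi.zero_apply] at h2
  refine (mul_eq_zero.1 h2).resolve_left (inv_ne_zero ?_)
  exact_mod_cast (freq_pos ζ).ne'

theorem re_inner_eq_integral (F G : L2F) : (inner ℂ F G).re = ∫ ζ, (inner ℂ (F ζ) (G ζ)).re ∂μF := by
  rw [L2.inner_def]
  exact (integral_re (L2.integrable_inner (𝕜 := ℂ) F G)).symm

theorem integrable_re_inner (F G : L2F) : Integrable (fun ζ => (inner ℂ (F ζ) (G ζ)).re) μF :=
  (L2.integrable_inner (𝕜 := ℂ) F G).re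

/-- With the weight `λ⁻¹` on the vorticity, its coupling to `φ` is skew and cancels in the sum. What
remains is `-ν` times the square of the modulus of the vorticity coefficient. -/
theorem energy_dissipation {ν : ℝ} (hν : 0 < ν) {a a' b b' : L2F}
    (ha : ∀ᵐ ζ ∂μF, a' ζ = -(ν * freq ζ ^ 2) * a ζ + I * waveX ζ * b ζ)
    (hb : ∀ᵐ ζ ∂μF, b' ζ = I * waveX ζ * ((freq ζ ^ 2 : ℝ) : ℂ)⁻¹ * a ζ) :
    (inner ℂ (dampen a) (dampen a')).re + (inner ℂ b b').re ≤ 0 := by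
  rw [re_inner_eq_integral, re_inner_eq_integral, ← integral_add
    (integrable_re_inner _ _) (integrable_re_inner _ _)]
  refine integral_nonpos_of_ae ?_
  filter_upwards [ha, hb, coeFn_dampen a, coeFn_dampen a'] with ζ h1 h2 h3 h4
  rw [h3, h4, h1, h2]
  have hl := freq_pos ζ
  have e : (inner ℂ (((freq ζ)⁻¹ : ℂ) * a ζ) (((freq ζ)⁻¹ : ℂ) *
      (-(ν * freq ζ ^ 2) * a ζ + I * waveX ζ * b ζ))).re +
      (inner ℂ (b ζ) (I * waveX ζ * ((freq ζ ^ 2 : ℝ) : ℂ)⁻¹ * a ζ)).re =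
      -(ν * ((a ζ).re ^ 2 + (a ζ).im ^ 2)) := by
    have e1 : ((freq ζ)⁻¹ : ℂ) = ((freq ζ)⁻¹ : ℝ) := by push_cast; rfl
    have e2 : ((freq ζ ^ 2 : ℝ) : ℂ)⁻¹ = (((freq ζ ^ 2)⁻¹ : ℝ) : ℂ) := by push_cast; rfl
    have e3 : ((ν : ℂ) * (freq ζ : ℂ) ^ 2) = ((ν * freq ζ ^ 2 : ℝ) : ℂ) := by push_cast; rfl
    rw [e1, e2, e3]
    simp only [RCLike.inner_apply, map_mul, mul_re, mul_im, add_re, add_im, neg_re, neg_im, ofReal_re,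
      ofReal_im, I_re, I_im, conj_re, conj_im]
    field_simp
    ring
  show _ ≤ (0 : ℝ)
  have : (inner ℂ (((freq ζ)⁻¹ : ℂ) * a ζ) (((freq ζ)⁻¹ : ℂ) *
      (-(ν * freq ζ ^ 2) * a ζ + I * waveX ζ * b ζ))).re +
      (inner ℂ (b ζ) (I * waveX ζ * ((freq ζ ^ 2 : ℝ) : ℂ)⁻¹ * a ζ)).re ≤ 0 := by
    rw [e]
    have : 0 ≤ ν * ((a ζ).re ^ 2 + (a ζ).im ^ 2) := by positivity
    linarith
  exact this

theorem hasDerivAt_re_inner_self {f : ℝ → L2F} {f' : L2F} {t : ℝ} (h : HasDerivAt f f' t) :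
    HasDerivAt (fun t => (inner ℂ (f t) (f t)).re) (2 * (inner ℂ (f t) f').re) t := by
  have := reCLM.hasFDerivAt.comp_hasDerivAt t (HasDerivAt.inner ℂ h h)
  refine this.congr_deriv ?_
  simp only [reCLM_apply, add_re]
  have e : (inner ℂ f' (f t)).re = (inner ℂ (f t) f').re := by
    rw [← inner_conj_symm, conj_re]
  rw [e]; ring

/-- The energy of the difference is continuous up to `t = 0`, where it vanishes, and it cannot
increase afterwards. The weight `λ⁻¹` is positive and the sine transform is injective, so zero
energy means equality. -/
theorem isSolution_unique {ν : ℝ} (hν : 0 < ν) {w₀ φ₀ : ℝ × ℝ → ℝ} {w φ w' φ' : ℝ → L2Ω}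
    (h : IsSolution ν w₀ φ₀ w φ) (h' : IsSolution ν w₀ φ₀ w' φ') :
    EqOn w' w (Ici 0) ∧ EqOn φ' φ (Ici 0) := by
  set a : ℝ → L2F := fun t => sineCoeff (w' t - w t) with ha
  set b : ℝ → L2F := fun t => sineCoeff (φ' t - φ t) with hb
  set E : ℝ → ℝ := fun t => (inner ℂ (dampen (a t)) (dampen (a t))).re + (inner ℂ (b t) (b t)).re with hE
  have ca : ContinuousOn a (Ici 0) := sineCoeff.continuous.comp_continuousOn (h'.cont_w.sub h.cont_w)
  have cb : ContinuousOn b (Ici 0) := sineCoeff.continuous.comp_continuousOn (h'.cont_φ.sub h.cont_φ)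
  have cE : ContinuousOn E (Ici 0) := by
    have cd : ContinuousOn (fun t => dampen (a t)) (Ici 0) := dampen.continuous.comp_continuousOn ca
    exact (continuous_re.comp_continuousOn (cd.inner cd)).add
      (continuous_re.comp_continuousOn (cb.inner cb))
  have dE : ∀ t, 0 < t → ∃ d ≤ 0, HasDerivAt E d t := by
    intro t ht
    obtain ⟨wt, d1, e1⟩ := h.sineCoeff_w ht
    obtain ⟨wt', d1', e1'⟩ := h'.sineCoeff_w ht
    obtain ⟨φt, d2, e2⟩ := h.sineCoeff_φ ht
    obtain ⟨φt', d2', e2'⟩ := h'.sineCoeff_φ ht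
    have da : HasDerivAt a (sineCoeff (wt' - wt)) t :=
      sineCoeff.hasFDerivAt.comp_hasDerivAt t (d1'.sub d1)
    have db : HasDerivAt b (sineCoeff (φt' - φt)) t :=
      sineCoeff.hasFDerivAt.comp_hasDerivAt t (d2'.sub d2)
    have da' : HasDerivAt (fun t => dampen (a t)) (dampen (sineCoeff (wt' - wt))) t :=
      dampen.hasFDerivAt.comp_hasDerivAt t da
    refine ⟨_, ?_, (hasDerivAt_re_inner_self da').add (hasDerivAt_re_inner_self db)⟩
    have hsub : ∀ f g : L2Ω, ∀ᵐ ζ ∂μF, sineCoeff (f - g) ζ = sineCoeff f ζ - sineCoeff g ζ :=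
      fun f g => by rw [map_sub]; exact Lp.coeFn_sub _ _
    have := energy_dissipation hν (a := a t) (a' := sineCoeff (wt' - wt)) (b := b t)
      (b' := sineCoeff (φt' - φt)) (by
        filter_upwards [e1, e1', hsub wt' wt, hsub (w' t) (w t), hsub (φ' t) (φ t)]
          with ζ h1 h2 h3 h4 h5
        simp only [ha, hb]
        rw [h3, h4, h5, h1, h2]; ring) (by
        filter_upwards [e2, e2', hsub φt' φt, hsub (w' t) (w t)] with ζ h1 h2 h3 h4
        simp only [ha]
        rw [h3, h4, h1, h2]; ring)
    linarith
  have anti : AntitoneOn E (Ici 0) := by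
    refine antitoneOn_of_deriv_nonpos (convex_Ici 0) cE (fun t ht => ?_) fun t ht => ?_
    all_goals
      rw [interior_Ici] at ht
      obtain ⟨d, hd, hd'⟩ := dE t ht
    · exact hd'.differentiableAt.differentiableWithinAt
    · rw [hd'.deriv]; exact hd
  have hw0 : w' 0 = w 0 := Lp.ext (h'.init_w.trans h.init_w.symm)
  have hφ0 : φ' 0 = φ 0 := Lp.ext (h'.init_φ.trans h.init_φ.symm)
  have E0 : E 0 = 0 := by simp [hE, ha, hb, hw0, hφ0]
  have key : ∀ t, 0 ≤ t → a t = 0 ∧ b t = 0 := by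
    intro t ht
    have h1 : E t ≤ 0 := E0 ▸ anti (by simp) ht ht
    have p1 : 0 ≤ (inner ℂ (dampen (a t)) (dampen (a t))).re := inner_self_nonneg (𝕜 := ℂ)
    have p2 : 0 ≤ (inner ℂ (b t) (b t)).re := inner_self_nonneg (𝕜 := ℂ)
    simp only [hE] at h1
    have q1 : (inner ℂ (dampen (a t)) (dampen (a t))).re ≤ 0 := by linarith
    have q2 : (inner ℂ (b t) (b t)).re ≤ 0 := by linarith
    have z : ∀ F : L2F, (inner ℂ F F).re ≤ 0 → F = 0 := fun F hF => by
      have e : ‖F‖ ^ 2 = (inner ℂ F F).re := (inner_self_eq_norm_sq (𝕜 := ℂ) F).symm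
      rw [← e] at hF
      exact norm_eq_zero.1 (pow_eq_zero_iff two_ne_zero |>.1 (le_antisymm hF (sq_nonneg _)))
    exact ⟨dampen_injective (z _ q1), z _ q2⟩
  constructor
  · intro t ht
    exact sub_eq_zero.1 (sineCoeff_injective ((key t ht).1.trans (map_zero _).symm))
  · intro t ht
    exact sub_eq_zero.1 (sineCoeff_injective ((key t ht).2.trans (map_zero _).symm))

end

section

open Topology Complex

/-! ### Decay of the solution -/

/-- `N` controls the weighted coefficients of the data. -/
structure DataDecay (m : ℕ) (A B : ℝ × ℕ → ℂ) (N : ℝ) : Prop where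
  fst : ∀ ζ, freq ζ ^ m * ‖A ζ‖ ≤ N
  snd : ∀ ζ, freq ζ ^ (m + 3) * ‖B ζ‖ ≤ N

theorem dataDecay_rcoeff {m : ℕ} {w₀ φ₀ : ℝ × ℝ → ℝ} (hw : MemD m 1 w₀) (hφ : MemD (m + 3) 1 φ₀) :
    DataDecay m (rcoeff false w₀) (rcoeff false φ₀)
      (2 ^ (m + 3) * (2 * √2) * (wNorm m 1 w₀ + wNorm (m + 3) 1 φ₀).toReal) := by
  have e := ENNReal.toReal_add hw.1.wNorm_ne_top hφ.1.wNorm_ne_top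
  have p1 : 0 ≤ (wNorm m 1 w₀).toReal := ENNReal.toReal_nonneg
  have p2 : 0 ≤ (wNorm (m + 3) 1 φ₀).toReal := ENNReal.toReal_nonneg
  constructor
  · intro ζ
    refine (hw.freq_pow_mul_le ζ).trans ?_
    rw [e]
    gcongr
    · norm_num
    · omega
    · linarith
  · intro ζ
    refine (hφ.freq_pow_mul_le ζ).trans ?_
    rw [e]
    gcongr
    linarith

section decay

variable {ν N : ℝ} {A B : ℝ × ℕ → ℂ} {m : ℕ}

theorem DataDecay.nonneg (h : DataDecay m A B N) : 0 ≤ N := by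
  have := freq_pos (0, 0)
  exact le_trans (by positivity) (h.fst (0, 0))

/-- Vorticity enters the slow part with a factor `λ⁻¹`, so one power more than the regularity of `A`
is available there. -/
theorem DataDecay.slowData_le (h : DataDecay m A B N) (ζ : ℝ × ℕ) :
    freq ζ ^ (m + 1) * slowData A B ζ ≤ 2 * N := by
  have hl := freq_pos ζ
  have h1 := h.fst ζ
  have h2 := h.snd ζ
  have h3 : freq ζ ^ (m + 1) * ‖B ζ‖ ≤ freq ζ ^ (m + 3) * ‖B ζ‖ := by
    gcongr
    · exact one_le_freq ζ
    · omega
  have e : freq ζ ^ (m + 1) * slowData A B ζ = freq ζ ^ m * ‖A ζ‖ + freq ζ ^ (m + 1) * ‖B ζ‖ := by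
    unfold slowData; field_simp; ring
  linarith

theorem DataDecay.freq_pow_mul_solW_le (hν : 0 < ν) (h : DataDecay m A B N) {t : ℝ} (ht : 0 ≤ t)
    (ζ : ℝ × ℕ) : freq ζ ^ m * ‖solW ν A B t ζ‖ ≤ (1 + 8 / ν) * N *
      (Real.exp (-(ν * freq ζ ^ 2 * t)) + |waveX ζ| * (freq ζ ^ 3)⁻¹ * Real.exp (-rate ν ζ * t)) := by
  have hl := freq_pos ζ
  have hN := h.nonneg
  have h1 := mul_le_mul_of_nonneg_left (norm_solW_le hν A B ht ζ) (pow_pos hl m).le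
  refine h1.trans ?_
  have e : freq ζ ^ m * (Real.exp (-(ν * freq ζ ^ 2 * t)) * ‖A ζ‖ +
      4 / ν * (|waveX ζ| * (freq ζ ^ 2)⁻¹) * Real.exp (-rate ν ζ * t) * slowData A B ζ) =
      Real.exp (-(ν * freq ζ ^ 2 * t)) * (freq ζ ^ m * ‖A ζ‖) + 4 / ν * (|waveX ζ| * (freq ζ ^ 3)⁻¹) *
        Real.exp (-rate ν ζ * t) * (freq ζ ^ (m + 1) * slowData A B ζ) := by
    field_simp
    ring
  rw [e]
  calc _ ≤ Real.exp (-(ν * freq ζ ^ 2 * t)) * N + 4 / ν * (|waveX ζ| * (freq ζ ^ 3)⁻¹) *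
        Real.exp (-rate ν ζ * t) * (2 * N) := by
        refine add_le_add (mul_le_mul_of_nonneg_left (h.fst ζ) (by positivity))
          (mul_le_mul_of_nonneg_left (h.slowData_le ζ) (by positivity))
    _ = 1 * N * Real.exp (-(ν * freq ζ ^ 2 * t)) + 8 / ν * N * (|waveX ζ| * (freq ζ ^ 3)⁻¹ *
        Real.exp (-rate ν ζ * t)) := by ring
    _ ≤ (1 + 8 / ν) * N * Real.exp (-(ν * freq ζ ^ 2 * t)) +
        (1 + 8 / ν) * N * (|waveX ζ| * (freq ζ ^ 3)⁻¹ * Real.exp (-rate ν ζ * t)) := by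
        have : 0 ≤ 8 / ν := by positivity
        gcongr <;> linarith
    _ = _ := by ring

theorem exp_fast_le (hν : 0 < ν) {t : ℝ} (ht : 0 ≤ t) (ζ : ℝ × ℕ) :
    Real.exp (-(ν * freq ζ ^ 2 * t)) ≤ Real.exp (-(ν * freq ζ ^ 2 / 2) * t) := by
  apply Real.exp_le_exp.2
  have : 0 ≤ ν * freq ζ ^ 2 * t := by positivity
  linarith

theorem exp_slow_le (hν : 0 < ν) {t : ℝ} (ht : 0 ≤ t) (ζ : ℝ × ℕ) :
    Real.exp (-rate ν ζ * t) ≤ Real.exp (-rate ν ζ / 2 * t) := by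
  apply Real.exp_le_exp.2
  have := mul_nonneg (rate_nonneg hν ζ) ht
  linarith

theorem inv_freq_pow_le (ζ : ℝ × ℕ) {a b : ℕ} (h : a ≤ b) : (freq ζ ^ b)⁻¹ ≤ (freq ζ ^ a)⁻¹ :=
  inv_anti₀ (pow_pos (freq_pos ζ) a) (pow_le_pow_right₀ (one_le_freq ζ) h)

/-- The slow part carries one factor `p`, hence `i = 1` and the rate `3/4`. Every derivative costs
one power of `λ`, and three are needed for integration; `r = 0, 1, 2` account for the norms of order
three, four and five of `w₀`. -/
theorem exists_decay_freq_pow (hν : 0 < ν) : ∃ C : ℝ, 0 ≤ C ∧ ∀ (r : ℕ) (A B : ℝ × ℕ → ℂ) (N : ℝ),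
    DataDecay (r + 3) A B N → ∀ t, 0 ≤ t →
      eLpNorm (fun ζ => ((freq ζ ^ r : ℝ) : ℂ) * solW ν A B t ζ) 2 μF ≤
        ENNReal.ofReal (C * bracket t ^ (-3 / 4 : ℝ) * N) := by
  obtain ⟨C, hC, hb⟩ := exists_decay_two hν (i := 1) (by norm_num)
  refine ⟨C * (1 + 8 / ν), by positivity, fun r A B N h t ht => ?_⟩
  have hN := h.nonneg
  refine (hb t ht ((1 + 8 / ν) * N) (by positivity) _ fun ζ => ?_).trans (le_of_eq ?_)
  · have hl := freq_pos ζ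
    rw [norm_mul, norm_real, Real.norm_of_nonneg (by positivity : 0 ≤ freq ζ ^ r)]
    have e : freq ζ ^ r * ‖solW ν A B t ζ‖ =
        (freq ζ ^ 3)⁻¹ * (freq ζ ^ (r + 3) * ‖solW ν A B t ζ‖) := by
      rw [pow_add]; field_simp
    rw [e]
    refine (mul_le_mul_of_nonneg_left (h.freq_pow_mul_solW_le hν ht ζ) (by positivity)).trans ?_
    rw [mul_left_comm]
    refine mul_le_mul_of_nonneg_left ?_ (by positivity)
    rw [mul_add]
    unfold fastWeight slowWeight
    have k1 := inv_freq_pow_le ζ (a := 2) (b := 3) (by norm_num)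
    have k2 := exp_fast_le hν ht ζ
    have k3 := exp_slow_le hν ht ζ
    have k4 : (freq ζ ^ 3)⁻¹ * (freq ζ ^ 3)⁻¹ ≤ (freq ζ ^ (2 * 1 + 3))⁻¹ := by
      rw [← mul_inv, ← pow_add]
      exact inv_freq_pow_le ζ (by norm_num)
    refine add_le_add (by gcongr) ?_
    calc (freq ζ ^ 3)⁻¹ * (|waveX ζ| * (freq ζ ^ 3)⁻¹ * Real.exp (-rate ν ζ * t))
        = |waveX ζ| ^ 1 * ((freq ζ ^ 3)⁻¹ * (freq ζ ^ 3)⁻¹) * Real.exp (-rate ν ζ * t) := by ring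
      _ ≤ _ := by gcongr
  · congr 1
    have e : (-((2 * ((1 : ℕ) : ℝ) + 1) / 4) : ℝ) = -3 / 4 := by norm_num
    rw [e]; ring

/-- The derivative `∂₁` contributes a second factor `p`, hence `i = 2` and the rate `5/4`. -/
theorem exists_decay_waveX (hν : 0 < ν) : ∃ C : ℝ, 0 ≤ C ∧ ∀ (A B : ℝ × ℕ → ℂ) (N : ℝ),
    DataDecay 5 A B N → ∀ t, 0 ≤ t →
      eLpNorm (fun ζ => I * waveX ζ * solW ν A B t ζ) 2 μF ≤
        ENNReal.ofReal (C * bracket t ^ (-5 / 4 : ℝ) * N) := by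
  obtain ⟨C, hC, hb⟩ := exists_decay_two hν (i := 2) le_rfl
  refine ⟨C * (1 + 8 / ν), by positivity, fun A B N h t ht => ?_⟩
  have hN := h.nonneg
  refine (hb t ht ((1 + 8 / ν) * N) (by positivity) _ fun ζ => ?_).trans (le_of_eq ?_)
  · have hl := freq_pos ζ
    rw [norm_mul, norm_mul, norm_I, one_mul, norm_real, Real.norm_eq_abs]
    have e : |waveX ζ| * ‖solW ν A B t ζ‖ =
        |waveX ζ| * (freq ζ ^ 5)⁻¹ * (freq ζ ^ 5 * ‖solW ν A B t ζ‖) := by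
      field_simp
    rw [e]
    refine (mul_le_mul_of_nonneg_left (h.freq_pow_mul_solW_le hν ht ζ) (by positivity)).trans ?_
    rw [mul_left_comm]
    refine mul_le_mul_of_nonneg_left ?_ (by positivity)
    rw [mul_add]
    unfold fastWeight slowWeight
    have k0 := abs_waveX_le_freq ζ
    have k1 : |waveX ζ| * (freq ζ ^ 5)⁻¹ ≤ (freq ζ ^ 2)⁻¹ := by
      calc |waveX ζ| * (freq ζ ^ 5)⁻¹ ≤ freq ζ * (freq ζ ^ 5)⁻¹ := by gcongr
        _ = (freq ζ ^ 4)⁻¹ := by field_simp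
        _ ≤ _ := inv_freq_pow_le ζ (by norm_num)
    have k2 := exp_fast_le hν ht ζ
    have k3 := exp_slow_le hν ht ζ
    have k4 : (freq ζ ^ 5)⁻¹ * (freq ζ ^ 3)⁻¹ ≤ (freq ζ ^ (2 * 2 + 3))⁻¹ := by
      rw [← mul_inv, ← pow_add]
      exact inv_freq_pow_le ζ (by norm_num)
    refine add_le_add (by gcongr) ?_
    calc |waveX ζ| * (freq ζ ^ 5)⁻¹ * (|waveX ζ| * (freq ζ ^ 3)⁻¹ * Real.exp (-rate ν ζ * t))
        = |waveX ζ| ^ 2 * ((freq ζ ^ 5)⁻¹ * (freq ζ ^ 3)⁻¹) * Real.exp (-rate ν ζ * t) := by ring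
      _ ≤ _ := by gcongr
  · congr 1
    have e : (-((2 * ((2 : ℕ) : ℝ) + 1) / 4) : ℝ) = -5 / 4 := by norm_num
    rw [e]; ring

/-- The five powers from the data and three from the mode give exactly the weight `λ⁻⁸` of
`exists_decay_one`. This integral dominates the supremum of the solution. -/
theorem exists_decay_integral (hν : 0 < ν) : ∃ C : ℝ, 0 ≤ C ∧ ∀ (A B : ℝ × ℕ → ℂ) (N : ℝ),
    DataDecay 5 A B N → ∀ t, 0 ≤ t →
      ∫⁻ ζ, ‖solW ν A B t ζ‖ₑ ∂μF ≤ ENNReal.ofReal (C * bracket t ^ (-1 : ℝ) * N) := by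
  obtain ⟨C, hC, hb⟩ := exists_decay_one hν
  refine ⟨C * (1 + 8 / ν), by positivity, fun A B N h t ht => ?_⟩
  have hN := h.nonneg
  refine (hb t ht ((1 + 8 / ν) * N) (by positivity) _ fun ζ => ?_).trans (le_of_eq ?_)
  · have hl := freq_pos ζ
    have e : ‖solW ν A B t ζ‖ = (freq ζ ^ 5)⁻¹ * (freq ζ ^ 5 * ‖solW ν A B t ζ‖) := by
      field_simp
    rw [e]
    refine (mul_le_mul_of_nonneg_left (h.freq_pow_mul_solW_le hν ht ζ) (by positivity)).trans ?_
    rw [mul_left_comm]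
    refine mul_le_mul_of_nonneg_left ?_ (by positivity)
    rw [mul_add]
    have k1 := inv_freq_pow_le ζ (a := 4) (b := 5) (by norm_num)
    refine add_le_add (by gcongr) (le_of_eq ?_)
    field_simp
  · congr 1; ring

/-- The fast part acts on `λ⁴A` and is estimated by its `L²` norm, given as a separate hypothesis.
In the slow part one of the three factors `p` is given up for `λ`, which leaves `i = 2`. -/
theorem exists_decay_deriv (hν : 0 < ν) : ∃ C : ℝ, 0 ≤ C ∧ ∀ (A B : ℝ × ℕ → ℂ) (N : ℝ),
    Measurable A → DataDecay 5 A B N →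
    eLpNorm (fun ζ => ((freq ζ ^ 4 : ℝ) : ℂ) * A ζ) 2 μF ≤ ENNReal.ofReal N → ∀ t, 0 ≤ t →
      eLpNorm (fun ζ => ((freq ζ ^ 2 : ℝ) : ℂ) * solW' ν A B t ζ) 2 μF ≤
        ENNReal.ofReal (C * bracket t ^ (-5 / 4 : ℝ) * N) := by
  obtain ⟨C, hC, hb⟩ := exists_decay_two hν (i := 2) le_rfl
  -- The fast exponential in `norm_solW'_le` runs at half the viscosity.
  obtain ⟨D, hD, hd⟩ := exists_exp_le_bracket (ν := ν / 2) (by positivity)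
  refine ⟨D * (ν + 2 / ν) + C * (1 + 16 / ν ^ 2), by positivity, fun A B N hA h h4 t ht => ?_⟩
  have hN := h.nonneg
  have hT := bracket_pos t
  set T := bracket t with hTd
  set G₁ : ℝ × ℕ → ℂ := fun ζ => ((freq ζ ^ 4 : ℝ) : ℂ) * A ζ with hG₁
  set G₂ : ℝ × ℕ → ℝ := fun ζ => (1 + 16 / ν ^ 2) * N * (fastWeight ν t ζ + slowWeight ν 2 t ζ) with hG₂
  have hG₂0 : ∀ ζ, 0 ≤ G₂ ζ := fun ζ => by
    have := fastWeight_nonneg ν t ζ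
    have := slowWeight_nonneg ν 2 t ζ
    simp only [hG₂]; positivity
  set c := D * (ν + 2 / ν) * T ^ (-5 / 4 : ℝ) with hc
  have hc0 : 0 ≤ c := by positivity
  have hf := continuous_freq.measurable
  have hr := (continuous_rate ν).measurable
  have hx := measurable_waveX
  have hm₁ : AEStronglyMeasurable (fun ζ => c * ‖G₁ ζ‖) μF := by
    simp only [hG₁]
    exact (by fun_prop : Measurable _).aestronglyMeasurable
  have hm₂ : AEStronglyMeasurable G₂ μF := by
    simp only [hG₂]
    unfold fastWeight slowWeight
    exact (by fun_prop : Measurable _).aestronglyMeasurable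
  have hpt : ∀ ζ, ‖((freq ζ ^ 2 : ℝ) : ℂ) * solW' ν A B t ζ‖ ≤ c * ‖G₁ ζ‖ + G₂ ζ := by
    intro ζ
    have hl := freq_pos ζ
    rw [norm_mul, norm_real, Real.norm_of_nonneg (by positivity : 0 ≤ freq ζ ^ 2)]
    refine (mul_le_mul_of_nonneg_left (norm_solW'_le hν A B ht ζ) (by positivity)).trans ?_
    have e : freq ζ ^ 2 * (Real.exp (-(ν * freq ζ ^ 2 / 2) * t) *
        ((ν + 2 / ν) * freq ζ ^ 2 * ‖A ζ‖ + |waveX ζ| * ‖B ζ‖) +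
        8 / ν ^ 2 * (|waveX ζ| ^ 3 * (freq ζ ^ 6)⁻¹) * Real.exp (-rate ν ζ * t) * slowData A B ζ) =
        Real.exp (-(ν * freq ζ ^ 2 / 2) * t) * (ν + 2 / ν) * (freq ζ ^ 4 * ‖A ζ‖) +
        (Real.exp (-(ν * freq ζ ^ 2 / 2) * t) * (|waveX ζ| * (freq ζ ^ 6)⁻¹ * (freq ζ ^ (5 + 3) * ‖B ζ‖)) +
        8 / ν ^ 2 * (|waveX ζ| ^ 3 * (freq ζ ^ 10)⁻¹) * Real.exp (-rate ν ζ * t) *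
          (freq ζ ^ (5 + 1) * slowData A B ζ)) := by
      field_simp
      ring
    rw [e]
    have k0 := abs_waveX_le_freq ζ
    refine add_le_add ?_ ?_
    · have h1 : Real.exp (-(ν * freq ζ ^ 2 / 2) * t) ≤ D * T ^ (-5 / 4 : ℝ) := by
        have := hd t ht ζ
        have e' : -(ν / 2 * freq ζ ^ 2 * t) = -(ν * freq ζ ^ 2 / 2) * t := by ring
        rw [e'] at this
        exact this.trans (mul_le_mul_of_nonneg_left (bracket_rpow_le t (by norm_num)) hD)
      have e1 : ‖G₁ ζ‖ = freq ζ ^ 4 * ‖A ζ‖ := by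
        simp only [hG₁]
        rw [norm_mul, norm_real, Real.norm_of_nonneg (by positivity : 0 ≤ freq ζ ^ 4)]
      rw [e1, hc]
      calc _ ≤ D * T ^ (-5 / 4 : ℝ) * (ν + 2 / ν) * (freq ζ ^ 4 * ‖A ζ‖) := by gcongr
        _ = _ := by ring
    · have k1 : |waveX ζ| * (freq ζ ^ 6)⁻¹ ≤ (freq ζ ^ 2)⁻¹ := by
        calc |waveX ζ| * (freq ζ ^ 6)⁻¹ ≤ freq ζ * (freq ζ ^ 6)⁻¹ := by gcongr
          _ = (freq ζ ^ 5)⁻¹ := by field_simp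
          _ ≤ _ := inv_freq_pow_le ζ (by norm_num)
      have k2 : |waveX ζ| ^ 3 * (freq ζ ^ 10)⁻¹ ≤ |waveX ζ| ^ 2 * (freq ζ ^ (2 * 2 + 3))⁻¹ := by
        calc |waveX ζ| ^ 3 * (freq ζ ^ 10)⁻¹ = |waveX ζ| ^ 2 * (|waveX ζ| * (freq ζ ^ 10)⁻¹) := by ring
          _ ≤ |waveX ζ| ^ 2 * (freq ζ * (freq ζ ^ 10)⁻¹) := by gcongr
          _ = |waveX ζ| ^ 2 * (freq ζ ^ 9)⁻¹ := by field_simp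
          _ ≤ _ := mul_le_mul_of_nonneg_left (inv_freq_pow_le ζ (by norm_num)) (by positivity)
      have k3 := exp_slow_le hν ht ζ
      calc _ ≤ Real.exp (-(ν * freq ζ ^ 2 / 2) * t) * ((freq ζ ^ 2)⁻¹ * N) +
            8 / ν ^ 2 * (|waveX ζ| ^ 2 * (freq ζ ^ (2 * 2 + 3))⁻¹) * Real.exp (-rate ν ζ / 2 * t) *
              (2 * N) := by
            have s0 := mul_nonneg (pow_pos hl (5 + 1)).le (slowData_nonneg A B ζ)
            have s1 := h.slowData_le ζ
            have s2 := h.snd ζ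
            have s3 : 0 ≤ freq ζ ^ (5 + 3) * ‖B ζ‖ := by positivity
            refine add_le_add (mul_le_mul_of_nonneg_left
              (mul_le_mul k1 s2 s3 (by positivity)) (by positivity)) (mul_le_mul ?_ s1 s0 (by positivity))
            gcongr
        _ = 1 * N * fastWeight ν t ζ + 16 / ν ^ 2 * N * slowWeight ν 2 t ζ := by
            unfold fastWeight slowWeight; ring
        _ ≤ (1 + 16 / ν ^ 2) * N * fastWeight ν t ζ + (1 + 16 / ν ^ 2) * N * slowWeight ν 2 t ζ := by
            have a1 := fastWeight_nonneg ν t ζ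
            have a2 := slowWeight_nonneg ν 2 t ζ
            have a3 : 0 ≤ 16 / ν ^ 2 := by positivity
            gcongr <;> linarith
        _ = G₂ ζ := by simp only [hG₂]; ring
  have b₁ : eLpNorm (fun ζ => c * ‖G₁ ζ‖) 2 μF ≤ ENNReal.ofReal (c * N) := by
    have : (fun ζ => c * ‖G₁ ζ‖) = c • fun ζ => ‖G₁ ζ‖ := rfl
    rw [this, eLpNorm_const_smul, eLpNorm_norm, ← ofReal_norm, Real.norm_of_nonneg hc0,
      ENNReal.ofReal_mul hc0]
    gcongr
  have b₂ : eLpNorm G₂ 2 μF ≤ ENNReal.ofReal (C * T ^ (-5 / 4 : ℝ) * ((1 + 16 / ν ^ 2) * N)) := by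
    have := hb t ht ((1 + 16 / ν ^ 2) * N) (by positivity) (fun ζ => (G₂ ζ : ℂ)) (fun ζ => by
      rw [norm_real, Real.norm_of_nonneg (hG₂0 ζ)])
    have e : (-((2 * ((2 : ℕ) : ℝ) + 1) / 4) : ℝ) = -5 / 4 := by norm_num
    rw [e] at this
    refine le_trans (le_of_eq ?_) this
    exact eLpNorm_congr_norm_ae (Eventually.of_forall fun ζ => (norm_real _).symm)
  calc _ ≤ eLpNorm ((fun ζ => c * ‖G₁ ζ‖) + G₂) 2 μF := eLpNorm_mono_real hpt
    _ ≤ ENNReal.ofReal (c * N) + ENNReal.ofReal (C * T ^ (-5 / 4 : ℝ) * ((1 + 16 / ν ^ 2) * N)) :=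
        (eLpNorm_add_le hm₁ hm₂ (by norm_num)).trans (add_le_add b₁ b₂)
    _ = _ := by
        rw [← ENNReal.ofReal_add (by positivity) (by positivity), hc]
        congr 1; ring

end decay

/-! ### From frequency bounds to the norms of the theorem -/

theorem eLpNorm_top_series_le (c : Bool) {F : ℝ × ℕ → ℂ} (hF : MemLp F 2 μF) {x : ℝ} (hx : 0 ≤ x)
    (h : ∫⁻ ζ, ‖F ζ‖ₑ ∂μF ≤ ENNReal.ofReal x) :
    eLpNorm (series c F) ⊤ μΩ ≤ ENNReal.ofReal (√2 * x) := by
  have hi : Integrable F μF := ⟨hF.1, h.trans_lt ENNReal.ofReal_lt_top⟩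
  unfold series
  rw [toL2_eq hF]
  refine (eLpNorm_top_synth_le c hF hi).trans (ENNReal.ofReal_le_ofReal ?_)
  gcongr
  rw [integral_norm_eq_lintegral_enorm hF.1]
  exact ENNReal.toReal_le_of_le_ofReal hx h

theorem dataBound_rcoeff {w₀ φ₀ : ℝ × ℝ → ℝ} (hw : MemD 5 1 w₀) (hφ : MemD 8 1 φ₀) :
    ∃ N, DataBound (rcoeff false w₀) (rcoeff false φ₀) N := by
  have h := dataDecay_rcoeff (m := 5) hw hφ
  refine ⟨2 * (2 ^ (5 + 3) * (2 * √2) * (wNorm 5 1 w₀ + wNorm (5 + 3) 1 φ₀).toReal),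
    measurable_coeff false (memLp_one_iff_integrable.1 hw.1.1).ofReal,
    measurable_coeff false (memLp_one_iff_integrable.1 hφ.1.1).ofReal, fun ζ => ?_⟩
  have hl := freq_pos ζ
  have h1 := h.fst ζ
  have h2 := h.snd ζ
  have k1 : freq ζ ^ 4 * ‖rcoeff false w₀ ζ‖ ≤ freq ζ ^ 5 * ‖rcoeff false w₀ ζ‖ := by
    gcongr
    · exact one_le_freq ζ
    · norm_num
  have k2 : freq ζ ^ 4 * ‖rcoeff false φ₀ ζ‖ ≤ freq ζ ^ (5 + 3) * ‖rcoeff false φ₀ ζ‖ := by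
    gcongr
    · exact one_le_freq ζ
    · norm_num
  rw [mul_add]
  linarith

theorem ofReal_mul_toReal_le {c C K y : ℝ} {X : ℝ≥0∞} (hX : X ≠ ⊤) (hc : 0 ≤ c) (hK : 0 ≤ K)
    (hy : 0 ≤ y) (h : c * K ≤ C) :
    ENNReal.ofReal (c * y * (K * X.toReal)) ≤ ENNReal.ofReal (C * y) * X := by
  have e : c * y * (K * X.toReal) = c * K * y * X.toReal := by ring
  rw [e, ENNReal.ofReal_mul (by positivity), ENNReal.ofReal_toReal hX]
  gcongr

/-- The decay estimates for the solution given by its sine series. -/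
theorem exists_series_estimates {ν : ℝ} (hν : 0 < ν) : ∃ C : ℝ, 0 < C ∧ ∀ w₀ φ₀ : ℝ × ℝ → ℝ,
    MemD 5 1 w₀ → MemD 8 1 φ₀ → ∀ t : ℝ, 0 < t →
    ∀ F : ℝ × ℕ → ℂ, F = solW ν (rcoeff false w₀) (rcoeff false φ₀) t →
      eLpNorm (series false F) ⊤ μΩ ≤
          ENNReal.ofReal (C * bracket t ^ (-1 : ℝ)) * (wNorm 5 1 w₀ + wNorm 8 1 φ₀) ∧
      eLpNorm (series false F) 2 μΩ ≤
          ENNReal.ofReal (C * bracket t ^ (-3 / 4 : ℝ)) * (wNorm 3 1 w₀ + wNorm 6 1 φ₀) ∧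
      eLpNorm (series false fun ζ => I * waveX ζ * F ζ) 2 μΩ ≤
          ENNReal.ofReal (C * bracket t ^ (-5 / 4 : ℝ)) * (wNorm 5 1 w₀ + wNorm 8 1 φ₀) ∧
      eLpNorm (series true fun ζ => waveY ζ.2 * F ζ) 2 μΩ ≤
          ENNReal.ofReal (C * bracket t ^ (-3 / 4 : ℝ)) * (wNorm 4 1 w₀ + wNorm 7 1 φ₀) ∧
      wNorm 1 2 (series false fun ζ => I * waveX ζ * F ζ) +
          wNorm 1 2 (series true fun ζ => waveY ζ.2 * F ζ) ≤
          ENNReal.ofReal (C * bracket t ^ (-3 / 4 : ℝ)) * (wNorm 5 1 w₀ + wNorm 8 1 φ₀) ∧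
      wNorm 2 2 (series false (solW' ν (rcoeff false w₀) (rcoeff false φ₀) t)) ≤
          ENNReal.ofReal (C * bracket t ^ (-5 / 4 : ℝ)) * (wNorm 5 1 w₀ + wNorm 8 1 φ₀) := by
  obtain ⟨C₁, hC₁, h₁⟩ := exists_decay_integral hν
  obtain ⟨C₂, hC₂, h₂⟩ := exists_decay_freq_pow hν
  obtain ⟨C₃, hC₃, h₃⟩ := exists_decay_waveX hν
  obtain ⟨C₄, hC₄, h₄⟩ := exists_decay_deriv hν
  obtain ⟨S, hS, hs⟩ := exists_eLpNorm_freq_pow_four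
  -- The constant of `dataDecay_rcoeff` for `m = 5`; those for `m = 3` and `m = 4` are smaller.
  set K : ℝ := 2 ^ 8 * (2 * √2) with hK
  have hK0 : 0 ≤ K := by positivity
  refine ⟨√2 * C₁ * K + 6 * C₂ * K + C₃ * K + 4 * C₄ * (K + S) + 1, by positivity,
    fun w₀ φ₀ hw hφ t ht F hF => ?_⟩
  obtain ⟨M, hM⟩ := dataBound_rcoeff hw hφ
  have hT : ∀ a : ℝ, 0 ≤ bracket t ^ a := fun a => Real.rpow_nonneg (bracket_pos t).le a
  have hSD : SineDerivs F := hF ▸ hM.sineDerivs_solW hν ht.le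
  have p1 : 0 ≤ √2 * C₁ * K := by positivity
  have p2 : 0 ≤ C₂ * K := by positivity
  have p3 : 0 ≤ C₃ * K := by positivity
  have p4 : 0 ≤ C₄ * (K + S) := by positivity
  have X5 : wNorm 5 1 w₀ + wNorm 8 1 φ₀ ≠ ⊤ :=
    ENNReal.add_ne_top.2 ⟨hw.1.wNorm_ne_top, hφ.1.wNorm_ne_top⟩
  have D5 : DataDecay 5 (rcoeff false w₀) (rcoeff false φ₀)
      (K * (wNorm 5 1 w₀ + wNorm 8 1 φ₀).toReal) := dataDecay_rcoeff (m := 5) hw hφ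
  have hw4 : MemD 4 1 w₀ := hw.mono (by norm_num)
  have hφ7 : MemD 7 1 φ₀ := hφ.mono (by norm_num)
  have hw3 : MemD 3 1 w₀ := hw.mono (by norm_num)
  have hφ6 : MemD 6 1 φ₀ := hφ.mono (by norm_num)
  have D4 : DataDecay 4 (rcoeff false w₀) (rcoeff false φ₀)
      (2 ^ 7 * (2 * √2) * (wNorm 4 1 w₀ + wNorm 7 1 φ₀).toReal) := dataDecay_rcoeff (m := 4) hw4 hφ7
  have D3 : DataDecay 3 (rcoeff false w₀) (rcoeff false φ₀)
      (2 ^ 6 * (2 * √2) * (wNorm 3 1 w₀ + wNorm 6 1 φ₀).toReal) := dataDecay_rcoeff (m := 3) hw3 hφ6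
  have X4 : wNorm 4 1 w₀ + wNorm 7 1 φ₀ ≠ ⊤ :=
    ENNReal.add_ne_top.2 ⟨hw4.1.wNorm_ne_top, hφ7.1.wNorm_ne_top⟩
  have X3 : wNorm 3 1 w₀ + wNorm 6 1 φ₀ ≠ ⊤ :=
    ENNReal.add_ne_top.2 ⟨hw3.1.wNorm_ne_top, hφ6.1.wNorm_ne_top⟩
  have K7 : (2 : ℝ) ^ 7 * (2 * √2) ≤ K := by rw [hK]; gcongr <;> norm_num
  have K6 : (2 : ℝ) ^ 6 * (2 * √2) ≤ K := by rw [hK]; gcongr <;> norm_num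
  have q7 := mul_le_mul_of_nonneg_left K7 hC₂
  have q6 := mul_le_mul_of_nonneg_left K6 hC₂
  refine ⟨?_, ?_, ?_, ?_, ?_, ?_⟩
  · have hb := h₁ _ _ _ D5 t ht.le
    rw [← hF] at hb
    refine (eLpNorm_top_series_le false hSD.memLp (by have := hT (-1); positivity) hb).trans ?_
    have e : √2 * (C₁ * bracket t ^ (-1 : ℝ) * (K * (wNorm 5 1 w₀ + wNorm 8 1 φ₀).toReal)) =
      √2 * C₁ * bracket t ^ (-1 : ℝ) * (K * (wNorm 5 1 w₀ + wNorm 8 1 φ₀).toReal) := by ring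
    rw [e]
    exact ofReal_mul_toReal_le X5 (by positivity) hK0 (hT _) (by linarith)
  · have hb := h₂ 0 _ _ _ D3 t ht.le
    simp only [pow_zero, ofReal_one, one_mul] at hb
    have hF' : (fun ζ => solW ν (rcoeff false w₀) (rcoeff false φ₀) t ζ) = F := hF.symm
    rw [hF'] at hb
    exact ((eLpNorm_series_le false hSD.memLp).trans hb).trans
      (ofReal_mul_toReal_le (K := 2 ^ 6 * (2 * √2)) X3 hC₂ (by positivity) (hT _) (by linarith))
  · have hb := h₃ _ _ _ D5 t ht.le
    rw [← hF] at hb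
    exact ((eLpNorm_series_le false hSD.m₁).trans hb).trans
      (ofReal_mul_toReal_le X5 hC₃ hK0 (hT _) (by linarith))
  · have hb := h₂ 1 _ _ _ D4 t ht.le
    rw [← hF] at hb
    refine ((eLpNorm_series_le true hSD.m₂).trans ?_).trans
      (ofReal_mul_toReal_le (K := 2 ^ 7 * (2 * √2)) X4 hC₂ (by positivity) (hT _) (by linarith))
    refine le_trans (eLpNorm_mono fun ζ => ?_) hb
    rw [norm_mul, norm_mul, pow_one, norm_real (freq ζ), Real.norm_of_nonneg (freq_pos ζ).le]
    exact mul_le_mul_of_nonneg_right (norm_waveY_le ζ) (norm_nonneg _)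
  · have hb := h₂ 2 _ _ _ D5 t ht.le
    rw [← hF] at hb
    refine (hSD.wNorm_gradient_le hb).trans ?_
    have e : 6 * (C₂ * bracket t ^ (-3 / 4 : ℝ) * (K * (wNorm 5 1 w₀ + wNorm 8 1 φ₀).toReal)) =
      6 * C₂ * bracket t ^ (-3 / 4 : ℝ) * (K * (wNorm 5 1 w₀ + wNorm 8 1 φ₀).toReal) := by ring
    rw [← ENNReal.ofReal_ofNat 6, ← ENNReal.ofReal_mul (by norm_num), e]
    exact ofReal_mul_toReal_le X5 (by positivity) hK0 (hT _) (by linarith)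
  · have D5' : DataDecay 5 (rcoeff false w₀) (rcoeff false φ₀)
        ((K + S) * (wNorm 5 1 w₀ + wNorm 8 1 φ₀).toReal) := by
      have : K * (wNorm 5 1 w₀ + wNorm 8 1 φ₀).toReal ≤
        (K + S) * (wNorm 5 1 w₀ + wNorm 8 1 φ₀).toReal := by
        gcongr; linarith
      exact ⟨fun ζ => (D5.fst ζ).trans this, fun ζ => (D5.snd ζ).trans this⟩
    have hb := h₄ _ _ _ hM.meas_A D5' ((hs w₀ hw).trans (ENNReal.ofReal_le_ofReal (by
      have : (wNorm 5 1 w₀).toReal ≤ (wNorm 5 1 w₀ + wNorm 8 1 φ₀).toReal :=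
        ENNReal.toReal_mono X5 le_self_add
      have h0 : 0 ≤ (wNorm 5 1 w₀).toReal := ENNReal.toReal_nonneg
      gcongr
      linarith))) t ht.le
    have hmeas := measurable_solW' (ν := ν) hM.meas_A hM.meas_B t
    have hSD' : SineDerivs (solW' ν (rcoeff false w₀) (rcoeff false φ₀) t) := by
      refine sineDerivs hmeas ⟨?_, hb.trans_lt ENNReal.ofReal_lt_top⟩
      have := continuous_freq.measurable
      exact (by fun_prop : Measurable _).aestronglyMeasurable
    refine (hSD'.wNorm_two_le hb).trans ?_
    have e : 4 * (C₄ * bracket t ^ (-5 / 4 : ℝ) * ((K + S) * (wNorm 5 1 w₀ + wNorm 8 1 φ₀).toReal)) =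
      4 * C₄ * bracket t ^ (-5 / 4 : ℝ) * ((K + S) * (wNorm 5 1 w₀ + wNorm 8 1 φ₀).toReal) := by ring
    rw [← ENNReal.ofReal_ofNat 4, ← ENNReal.ofReal_mul (by norm_num), e]
    exact ofReal_mul_toReal_le X5 (by positivity) (by positivity) (hT _) (by linarith)

end

end StripBoussinesq

end

/-! ### The theorem -/

theorem lemma3p5 (ν : ℝ) (hν : 0 < ν) :
    ∃ C : ℝ, 0 < C ∧
      ∀ φ₀ u₁₀ u₂₀ w₀ : ℝ × ℝ → ℝ,
        MemD 8 1 φ₀ → MemN 6 1 u₁₀ → MemD 6 1 u₂₀ → IsCurl u₁₀ u₂₀ w₀ →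
        MemD 5 1 w₀ ∧
        (∃ w φ : ℝ → L2Ω, IsSolution ν w₀ φ₀ w φ ∧
          ∀ w' φ' : ℝ → L2Ω, IsSolution ν w₀ φ₀ w' φ' →
            EqOn w' w (Ici 0) ∧ EqOn φ' φ (Ici 0)) ∧
        ∀ w φ : ℝ → L2Ω, IsSolution ν w₀ φ₀ w φ → ∀ t : ℝ, 0 < t →
          eLpNorm (w t) ∞ μΩ ≤
              ENNReal.ofReal (C * bracket t ^ (-1 : ℝ)) * (wNorm 5 1 w₀ + wNorm 8 1 φ₀) ∧
          eLpNorm (w t) 2 μΩ ≤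
              ENNReal.ofReal (C * bracket t ^ (-3 / 4 : ℝ)) * (wNorm 3 1 w₀ + wNorm 6 1 φ₀) ∧
          (∃ w₁ w₂ : ℝ × ℝ → ℝ, IsWeakDeriv 1 0 (w t) w₁ ∧ IsWeakDeriv 0 1 (w t) w₂ ∧
            eLpNorm w₁ 2 μΩ ≤
              ENNReal.ofReal (C * bracket t ^ (-5 / 4 : ℝ)) * (wNorm 5 1 w₀ + wNorm 8 1 φ₀) ∧
            eLpNorm w₂ 2 μΩ ≤
              ENNReal.ofReal (C * bracket t ^ (-3 / 4 : ℝ)) * (wNorm 4 1 w₀ + wNorm 7 1 φ₀) ∧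
            wNorm 1 2 w₁ + wNorm 1 2 w₂ ≤
              ENNReal.ofReal (C * bracket t ^ (-3 / 4 : ℝ)) * (wNorm 5 1 w₀ + wNorm 8 1 φ₀)) ∧
          ∃ wt : L2Ω, HasDerivAt w wt t ∧
            wNorm 2 2 wt ≤
              ENNReal.ofReal (C * bracket t ^ (-5 / 4 : ℝ)) * (wNorm 5 1 w₀ + wNorm 8 1 φ₀) := by
  obtain ⟨C, hC, hest⟩ := exists_series_estimates hν
  refine ⟨C, hC, fun φ₀ u₁₀ u₂₀ w₀ hφ h₁ h₂ hw => ?_⟩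
  have hw₀ : MemD 5 1 w₀ := memD_curl le_rfl h₁ h₂ hw
  obtain ⟨N, hN⟩ := dataBound_rcoeff hw₀ hφ
  have hsol := isSolution_series hν hN hw₀.1.1 (hw₀.memLp_two (by norm_num)) hφ.1.1
    (hφ.memLp_two (by norm_num))
  refine ⟨hw₀, ⟨_, _, hsol, fun w' φ' h' => isSolution_unique hν hsol h'⟩, fun w φ h t ht => ?_⟩
  have hW := hN.sineDerivs_solW hν ht.le
  -- By uniqueness the given solution is the series, for which the estimates are known.
  have heq := (isSolution_unique hν hsol h).1
  obtain ⟨e₁, e₂, e₃, e₄, e₅, e₆⟩ := hest w₀ φ₀ hw₀ hφ t ht _ rfl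
  have hwt : w t = _ := heq ht.le
  rw [hwt]
  refine ⟨e₁, e₂, ⟨_, _, hW.d₁, hW.d₂, e₃, e₄, e₅⟩, _, ?_, e₆⟩
  -- The two curves agree only for nonnegative times, which suffices near `t > 0`.
  exact (hN.hasDerivAt_W hν ht).congr_of_eventuallyEq
    ((lt_mem_nhds ht).mono fun s hs => heq (le_of_lt hs))
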